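/- Let $V=\mathbb F_2^8$ (row vectors). For subspaces $U,W\le V$ let $d_s(U,W)=\dim(U+W)-\dim(U\cap W)$. An $(8,257,6;4)_2$ code is a set of $257$ four-dimensional subspaces of $V$ with minimum distance $\min_{U\ne W}d_s(U,W)=6$. Two sets of $4$-dimensional subspaces of $V$ are isomorphic if one is mapped onto the other by an element of the group generated by $\mathrm{GL}_8(\mathbb F_2)$ and the polarity $U\mapsto U^\perp$ (with respect to the standard dot product). A $4\times4$ MRD code with minimum rank distance $3$ over $\mathbb F_2$ is a (not necessarily linear) set of $2^8=256$ matrices in $\mathbb F_2^{4\times4}$ such that the minimum of $\operatorname{rk}(A-B)$ over pairs of distinct elements $A,B$ is $3$; its lifting is the set of the row spaces $\langle(I_4\mid A)\rangle$ of the matrices $(I_4\mid A)$, with $A$ in the code. An LMRD code is a code that is isomorphic to such a lifting. Fix any $\mathbb F_2$-basis of $\mathbb F_{16}$ and let $M$ be the $4\times4$ Gabidulin code with minimum rank distance $3$, that is, the set of the matrices which represent, in this basis and acting on row vectors of coordinates, the maps $x\mapsto a_0x+a_1x^2$ of $\mathbb F_{16}$, where $a_0,a_1\in\mathbb F_{16}$.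 Put $$\mathcal C_1=\{\langle(I_4\mid B)\rangle : B\in M\}\cup\{\langle(0_{4\times4}\mid I_4)\rangle\},\qquad \mathcal C_2=\{\langle(I_4\mid B)\rangle : B\in M\}\cup\{\langle(0_{4\times3}\mid I_4\mid 0_{4\times1})\rangle\}.$$ Then every $(8,257,6;4)_2$ code that contains an LMRD code is isomorphic to $\mathcal C_1$ or to $\mathcal C_2$. Moreover, $M$ is an MRD code with minimum rank distance $3$, $\mathcal C_1$ and $\mathcal C_2$ are $(8,257,6;4)_2$ codes that contain an LMRD code, and $\mathcal C_1$ and $\mathcal C_2$ are not isomorphic. Thus there are exactly two isomorphism types of $(8,257,6;4)_2$ codes that contain an LMRD code. -/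

import Mathlib

open scoped Matrix

namespace SubspaceCode

/-- The subspace distance `dim (U + W) - dim (U ∩ W)`
(the natural-number subtraction never truncates in finite dimension). -/
noncomputable def subspaceDist {F V : Type*} [Field F] [AddCommGroup V] [Module F V]
    (U W : Submodule F V) : ℕ :=
  Module.finrank F ↥(U ⊔ W) - Module.finrank F ↥(U ⊓ W)

/-- `C` is a `(v, N, d; k)_q` constant-dimension code, where `q` is the order of `F`:
a set of `N` subspaces of dimension `k` in the `v`-dimensional space `V`, whose minimum
subspace distance exists and equals `d`. -/
structure IsCDC {F V : Type*} [Field F] [AddCommGroup V] [Module F V]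
    (C : Set (Submodule F V)) (v N d k : ℕ) : Prop where
  finrank_ambient : Module.finrank F V = v
  finite : C.Finite
  ncard_eq : C.ncard = N
  finrank_eq : ∀ U ∈ C, Module.finrank F ↥U = k
  minDist : IsLeast {r : ℕ | ∃ U ∈ C, ∃ W ∈ C, U ≠ W ∧ subspaceDist U W = r} d

/-- `M` is a (not necessarily linear) `m × n` maximum rank distance code over the finite
field `F` with minimum rank distance `d`: it attains the bound
`q ^ ((min m n - d + 1) * max m n)`. -/
structure IsMRD {F : Type*} [Field F] {m n : ℕ}
    (M : Set (Matrix (Fin m) (Fin n) F)) (d : ℕ) : Prop where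
  minDist : IsLeast {r : ℕ | ∃ A ∈ M, ∃ B ∈ M, A ≠ B ∧ (A - B).rank = r} d
  ncard_eq : M.ncard = Nat.card F ^ ((min m n - d + 1) * max m n)

/-- The block matrix `(A | B)`, with columns indexed by `Fin (m + n)`. -/
def hcat {F : Type*} {k m n : ℕ} (A : Matrix (Fin k) (Fin m) F) (B : Matrix (Fin k) (Fin n) F) :
    Matrix (Fin k) (Fin (m + n)) F :=
  Matrix.of fun i => Fin.append (A i) (B i)

/-- The row space of a matrix. -/
def rowSpace {F : Type*} [Field F] {k n : ℕ} (A : Matrix (Fin k) (Fin n) F) :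
    Submodule F (Fin n → F) :=
  Submodule.span F (Set.range fun i => A i)

/-- The lifting map: `A` is sent to the row space of `(I | A)`. -/
def lift {F : Type*} [Field F] {m n : ℕ} (A : Matrix (Fin m) (Fin n) F) :
    Submodule F (Fin (m + n) → F) :=
  rowSpace (hcat (1 : Matrix (Fin m) (Fin m) F) A)

/-- `L` is a lifted `m × n` MRD code of minimum rank distance `d`. -/
def IsLMRD {F : Type*} [Field F] {m n : ℕ} (L : Set (Submodule F (Fin (m + n) → F)))
    (d : ℕ) : Prop :=
  ∃ M : Set (Matrix (Fin m) (Fin n) F), IsMRD M d ∧ L = lift '' M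

/-- The polarity `U ↦ U^⊥` given by the standard dot product. -/
def perp {F : Type*} [Field F] {v : ℕ} (U : Submodule F (Fin v → F)) :
    Submodule F (Fin v → F) where
  carrier := {x | ∀ u ∈ U, u ⬝ᵥ x = 0}
  zero_mem' := fun u _ => dotProduct_zero u
  add_mem' := fun hx hy u hu => by rw [dotProduct_add, hx u hu, hy u hu, add_zero]
  smul_mem' := fun c x hx u hu => by rw [dotProduct_smul, hx u hu, smul_zero]

/-- Isomorphism of binary constant-dimension codes in the case `v = 2k`: the codes are in the
same orbit of the group generated by the collineations and the polarity `perp`. Since the field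
with two elements has no nontrivial automorphism and no scalar other than `1`, the collineations
are exactly the invertible linear maps; and since `perp` normalizes them and is an involution,
every group element is a linear map or a linear map followed by `perp`. -/
def Isomorphic {v : ℕ} (C D : Set (Submodule (ZMod 2) (Fin v → ZMod 2))) : Prop :=
  ∃ e : (Fin v → ZMod 2) ≃ₗ[ZMod 2] (Fin v → ZMod 2),
    D = (fun U => U.map e.toLinearMap) '' C ∨
    D = (fun U => perp (U.map e.toLinearMap)) '' C

/-- The `n × n` Gabidulin code of minimum rank distance `d` (for `1 ≤ d ≤ n`), where `K` is the
extension of degree `n` of the finite field `F` of order `q` and `b` is the chosen `F`-basis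
of `K`. It consists of all matrices that represent, on row vectors of coordinates, the
`F`-linear maps `x ↦ a_0 x + a_1 x^q + ⋯ + a_{n-d} x^(q^(n-d))`. -/
def gabidulinCode {F K : Type*} [Field F] [Field K] [Algebra F K] {n : ℕ}
    (b : Module.Basis (Fin n) F K) (d : ℕ) : Set (Matrix (Fin n) (Fin n) F) :=
  {B | ∃ a : Fin (n - d + 1) → K, ∀ x : K,
    b.equivFun x ᵥ* B = b.equivFun (∑ i, a i * x ^ Nat.card F ^ (i : ℕ))}

/-- The lifted `4 × 4` binary Gabidulin code with `d = 3`, extended by the row space of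
`(0_{4×4} | I_4)`. -/
def extendedCode₁ {K : Type*} [Field K] [Algebra (ZMod 2) K]
    (b : Module.Basis (Fin 4) (ZMod 2) K) : Set (Submodule (ZMod 2) (Fin 8 → ZMod 2)) :=
  lift '' gabidulinCode b 3 ∪
    {rowSpace (hcat (0 : Matrix (Fin 4) (Fin 4) (ZMod 2)) (1 : Matrix (Fin 4) (Fin 4) (ZMod 2)))}

/-- The lifted `4 × 4` binary Gabidulin code with `d = 3`, extended by the row space of
`(0_{4×3} | I_4 | 0_{4×1})`. -/
def extendedCode₂ {K : Type*} [Field K] [Algebra (ZMod 2) K]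
    (b : Module.Basis (Fin 4) (ZMod 2) K) : Set (Submodule (ZMod 2) (Fin 8 → ZMod 2)) :=
  lift '' gabidulinCode b 3 ∪
    {rowSpace (hcat (hcat (0 : Matrix (Fin 4) (Fin 3) (ZMod 2))
      (1 : Matrix (Fin 4) (Fin 4) (ZMod 2))) (0 : Matrix (Fin 4) (Fin 1) (ZMod 2)))}

/-- `C` contains a binary LMRD code with `m = n = 4` and `d = 3`, in the given coordinates or
up to an isomorphism of subspace codes. -/
def ContainsLMRD (C : Set (Submodule (ZMod 2) (Fin 8 → ZMod 2))) : Prop :=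
  ∃ C' ⊆ C, ∃ L : Set (Submodule (ZMod 2) (Fin 8 → ZMod 2)),
    IsLMRD (m := 4) (n := 4) L 3 ∧ Isomorphic C' L

end SubspaceCode

/-! The heart of the matter is that every binary 4×4 MRD code with minimum rank distance 3, linear
or not, is equivalent to the Gabidulin code (`IsCode.exists_equiv_gabidulinCode`). In such a code
`M` any two distinct nonzero vectors `x`, `y` and any `u`, `v` determine one `D` in `M` with `xD =
u`, `yD = v`. So `M` with the lines `{D | xD = u}` is a net of order 16 and degree 15, two parallel
classes short of an affine plane. Counting shows that the graph "the difference is invertible" on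
`M` has the parameters of the 16×16 grid, and that the 30 neighbours of a matrix split into two
cliques. Thus through each member pass a row and a column of 16 matrices each. Translated to the
origin they are spread sets `R` and `C` such that each `r - c` has a kernel with exactly one nonzero
vector: a cross.

Crosses are analysed by computation. After normalising `1 ∈ C`, each `r ∈ R` has just one nonzero
fixed vector, which leaves four similarity types, with characteristic polynomials `(X+1)(X^3+1)`,
`(X+1)(X^3+X+1)`, `(X+1)(X^3+X^2+1)` and `(X+1)^4`. Exhaustive searches exclude the first type, then
the second; the third reduces to the second by inversion and exchange of `R` and `C`. If all members
have the fourth type, a search shows that `R` is additively closed and commutative after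
normalisation, or that no cross exists at another base point of the same row (`IsCross.isField`).
Hence every row is a copy of `F_16`.

Now one row may be taken as the multiplications of `K = F_16`. A member `L` outside it is adjacent
to exactly one multiplication `s`, so `(L(x) - s x)/x` permutes the nonzero elements. Writing `L` as
a linearised polynomial and comparing power sums, as in Hermite's criterion, gives `L = s x + a x^2`
or `L = s x + c x^8`. Additivity of columns forbids both kinds in one column, and a difference with
two nonzero roots forbids different kinds in different columns. The second case becomes the first by
composition with Frobenius.

For the additional codeword `U`: two vectors of `U` with distinct nonzero left halves would lie in a
common lifted codeword, so the left halves span at most a line. If they vanish, `U` is `(0 | I)`.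
Otherwise multiplications and translations by the field act on the lifted Gabidulin code and carry
`U` to the second standard subspace (`eq_infinity_or_exists_map`). The two codes differ because only
the first has a codeword meeting all others trivially, a property which the polarity also preserves.
-/

set_option maxRecDepth 10000

/-! ### Bit-parallel algorithms for the search of spread sets. -/

namespace SpreadSearch

/-- The case distinction makes the kernel evaluate `n` to a numeral before it is substituted into
`k`, so that large masks are not recomputed at each use. -/
def force {α : Type} (n : ℕ) (k : ℕ → α) : α :=
  Nat.rec (k 0) (fun m _ => k (Nat.succ m)) n

def bit (n i : ℕ) : Bool := Nat.beq (Nat.land (Nat.shiftRight n i) 1) 1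

/-- Exhausted fuel gives `false`; hence `true` guarantees that every set bit has been tested. The
bits are visited from the lowest upwards. -/
def allBits (p : ℕ → Bool) (fuel : ℕ) : ℕ → Bool :=
  Nat.rec (fun _ => false) (fun _ ih m => Nat.rec true (fun _ _ =>
    (fun r => bif p (Nat.xor m r) then ih r else false) (Nat.land m (Nat.sub m 1))) m) fuel

/-- The truth table of the `k`-th of `n` Boolean variables: bit `c` of the mask is bit `k` of `c`.
Bitwise operations on such tables evaluate a Boolean function at all 4×4 matrices simultaneously. -/
def varMask (n : ℕ) : ℕ → ℕ :=
  Nat.rec (fun _ => 0) (fun m ih k =>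
    bif Nat.beq k m then
      Nat.shiftLeft (Nat.sub (Nat.pow 2 (Nat.pow 2 m)) 1) (Nat.pow 2 m)
    else Nat.lor (ih k) (Nat.shiftLeft (ih k) (Nat.pow 2 m))) n

def ones (n : ℕ) : ℕ := Nat.sub (Nat.pow 2 n) 1

theorem testBit_ones (n i : ℕ) : (ones n).testBit i = decide (i < n) :=
  Nat.testBit_two_pow_sub_one n i

attribute [irreducible] ones

def fullMask : ℕ := ones 65536

section Circuits

variable (V : ℕ → ℕ) (O : ℕ)

/-- In a layout, bit `p` of `V k` is the `k`-th bit of the code stored at position `p`, and `O`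
marks the used positions. Toggling by an entry of a fixed matrix gives an entry of the difference.
-/
def lit (b : Bool) (k : ℕ) : ℕ := bif b then Nat.xor (V k) O else V k

def minorMask (o i j n : ℕ) : ℕ :=
  Nat.xor
    (Nat.land (lit V O (bit n i) (Nat.add o i))
      (lit V O (bit n (Nat.add 4 j)) (Nat.add o (Nat.add 4 j))))
    (Nat.land (lit V O (bit n j) (Nat.add o j))
      (lit V O (bit n (Nat.add 4 i)) (Nat.add o (Nat.add 4 i))))

/-- Laplace expansion along the first two rows, without signs in characteristic 2. The numbers `a`
and `b` hold the upper and lower row pairs of the matrix that is subtracted. -/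
def detMask (c : ℕ) : ℕ :=
  force (Nat.land c 255) fun a => force (Nat.shiftRight c 8) fun b =>
  Nat.xor
    (Nat.xor
      (Nat.xor (Nat.land (minorMask V O 0 0 1 a) (minorMask V O 8 2 3 b))
        (Nat.land (minorMask V O 0 0 2 a) (minorMask V O 8 1 3 b)))
      (Nat.xor (Nat.land (minorMask V O 0 0 3 a) (minorMask V O 8 1 2 b))
        (Nat.land (minorMask V O 0 1 2 a) (minorMask V O 8 0 3 b))))
    (Nat.xor (Nat.land (minorMask V O 0 1 3 a) (minorMask V O 8 0 2 b))
      (Nat.land (minorMask V O 0 2 3 a) (minorMask V O 8 0 1 b)))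

def rowComb (s x j : ℕ) : ℕ :=
  List.rec 0 (fun i _ r => bif bit x i then
    Nat.xor (lit V O (bit s (Nat.add (Nat.mul 4 i) j)) (Nat.add (Nat.mul 4 i) j)) r else r)
    [0, 1, 2, 3]

def rowZero (s x : ℕ) : ℕ :=
  Nat.xor O (List.rec 0 (fun j _ r => Nat.lor (rowComb V O s x j) r) [0, 1, 2, 3])

def anyZero (s : ℕ) (l : List ℕ) : ℕ :=
  List.rec 0 (fun x _ r => Nat.lor (rowZero V O s x) r) l

def twoZero (s : ℕ) (l : List ℕ) : ℕ :=
  List.rec 0 (fun x t r => Nat.lor (Nat.land (rowZero V O s x) (anyZero V O s t)) r) l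

def nonzeroCodes : List ℕ := [1, 2, 3, 4, 5, 6, 7, 8, 9, 10, 11, 12, 13, 14, 15]

def oneMask (s : ℕ) : ℕ :=
  Nat.xor (anyZero V O s nonzeroCodes)
    (Nat.land (anyZero V O s nonzeroCodes) (twoZero V O s nonzeroCodes))

def traceMask : ℕ := Nat.xor (Nat.xor (V 0) (V 5)) (Nat.xor (V 10) (V 15))

def pminor (i j : ℕ) : ℕ :=
  Nat.xor (Nat.land (V (Nat.mul 5 i)) (V (Nat.mul 5 j)))
    (Nat.land (V (Nat.add (Nat.mul 4 i) j)) (V (Nat.add (Nat.mul 4 j) i)))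

def pminorsMask : ℕ :=
  Nat.xor (Nat.xor (Nat.xor (pminor V 0 1) (pminor V 0 2)) (Nat.xor (pminor V 0 3) (pminor V 1 2)))
    (Nat.xor (pminor V 1 3) (pminor V 2 3))

end Circuits

def fullVar (k : ℕ) : ℕ := varMask 16 k

def typeMask (q : ℕ) : ℕ :=
  bif Nat.beq q 0 then fullMask else
  bif Nat.beq q 1 then
    Nat.xor fullMask (Nat.land (traceMask fullVar) (Nat.xor fullMask (pminorsMask fullVar)))
  else Nat.xor fullMask (Nat.lor (traceMask fullVar) (pminorsMask fullVar))

/-- The necessary conditions on a member of `R` other than `s` when `1 ∈ C`: it is invertible, fixes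
one nonzero vector, differs invertibly from `s`, and has an admissible type. The code `0x8421` is
the identity. -/
def rMask (s q : ℕ) : ℕ :=
  Nat.land (Nat.land (detMask fullVar fullMask 0) (oneMask fullVar fullMask 0x8421))
    (Nat.land (detMask fullVar fullMask s) (typeMask q))

def cMask (s : ℕ) : ℕ :=
  Nat.land (Nat.land (detMask fullVar fullMask 0) (detMask fullVar fullMask 0x8421))
    (oneMask fullVar fullMask s)

def blk (m y : ℕ) : ℕ :=
  Nat.land (Nat.shiftRight m (Nat.mul 4096 y)) (ones 4096)

def bitsIn (k : ℕ) : ℕ → ℕ → List ℕ → List ℕ :=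
  Nat.rec (fun m off acc => Nat.rec acc (fun _ _ => off :: acc) m)
    (fun k ih m off acc => Nat.rec acc (fun _ _ =>
      force (Nat.shiftRight m (Nat.pow 2 k)) fun hi =>
      force (Nat.land m (Nat.sub (Nat.pow 2 (Nat.pow 2 k)) 1)) fun lo =>
      force (Nat.add off (Nat.pow 2 k)) fun off' => ih lo off (ih hi off' acc)) m) k

/-- The matrix `s` has last row `e_3`, encoded by `8`. Members of a spread set have distinct nonzero
last rows, so the other fourteen members of `R` use these. -/
def ys : List ℕ := [1, 2, 3, 4, 5, 6, 7, 9, 10, 11, 12, 13, 14, 15]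

/-- Compact layout of the candidates: a number is read in digits to base `2^168`, each digit being
fourteen fields of 12 bits, one for each last row in `ys`. The `i`-th candidate with last row `y`
keeps its other 12 bits in field `y` of digit `i`; its position is the lowest bit of that field. The
width also leaves room for counters. -/
def base : ℕ := Nat.pow 2 168

def lows (m y : ℕ) : List ℕ := bitsIn 12 (blk m y) 0 []

def fieldCodes (m y : ℕ) : ℕ := List.rec 0 (fun w _ r => Nat.add w (Nat.mul r base)) (lows m y)

def fieldOnes (m y : ℕ) : ℕ := List.rec 0 (fun _ _ r => Nat.add 1 (Nat.mul r base)) (lows m y)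

def off (y : ℕ) : ℕ := Nat.mul 12 (bif Nat.ble y 8 then Nat.sub y 1 else Nat.sub y 2)

def sumFields (g : ℕ → ℕ) : ℕ :=
  List.rec 0 (fun y _ r => Nat.lor (Nat.shiftLeft (g y) (off y)) r) ys

def codesWord (m : ℕ) : ℕ := sumFields (fieldCodes m)

def occupied (m : ℕ) : ℕ := sumFields (fieldOnes m)

def digitOnes : ℕ := Nat.div (Nat.sub (Nat.pow 2 (Nat.mul 168 300)) 1) (Nat.sub base 1)

def fieldLow : ℕ := List.rec 0 (fun y _ r => Nat.add r (Nat.pow 2 (off y))) ys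

def allLow : ℕ := Nat.mul digitOnes fieldLow

def posVar (m k : ℕ) : ℕ :=
  bif Nat.ble 12 k then sumFields fun y => bif bit y (Nat.sub k 12) then fieldOnes m y else 0
  else Nat.land (Nat.shiftRight (codesWord m) k) allLow

def posOf (m c : ℕ) : ℕ :=
  Nat.rec (motive := fun _ => ℕ → ℕ) (fun acc => acc)
    (fun k ih acc => ih (Nat.land acc
      (bif bit c k then posVar m k else Nat.xor (occupied m) (posVar m k)))) 16 (occupied m)

def flags : ℕ := Nat.mul fieldLow 2048

def block (y : ℕ) : ℕ := Nat.mul digitOnes (Nat.pow 2 (off y))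

def flag (y : ℕ) : ℕ := Nat.pow 2 (Nat.add 11 (off y))

/-- Two is a primitive root modulo 59, and the fourteen flags have distinct residues there; the
table translates the residue back into the last row. -/
def flagTable : ℕ := 0x3040600200d01009e000000a0000000c00000000000700b0f000500

def fieldOf (z : ℕ) : ℕ :=
  Nat.land (Nat.shiftRight flagTable
    (Nat.mul 4 (Nat.mod (Nat.xor z (Nat.land z (Nat.sub z 1))) 59))) 15

/-- Each field of `v` holds a number of remaining candidates and a flag above it. Subtracting `k'`
from all fields clears the flag exactly where fewer than `k'` candidates remain, so the first
success is an open last row with the fewest candidates. -/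
def pick (v F : ℕ) (fuel : ℕ) : ℕ → ℕ :=
  Nat.rec (fun _ => 0) (fun _ ih k => force (Nat.succ k) fun k' =>
    (fun z => Nat.rec (ih k') (fun _ _ => fieldOf z) z)
      (Nat.xor F (Nat.land F (Nat.sub v (Nat.mul k' fieldLow))))) fuel

def codeOf (m y b : ℕ) : ℕ :=
  Nat.add (Nat.mul 4096 y) (Nat.land (Nat.div (codesWord m) b) 4095)

/-- Depth-first search: `S` holds the positions compatible with the chosen codes `acc`, and `F` the
flags of the uncovered last rows. The remainder modulo `base - 1` is the sum of the digits of `S`,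
which counts the candidates in each field. A last row without candidates closes a branch; exhausted
fuel counts as failure. -/
def search (m : ℕ) (leaf : List ℕ → Bool) (fuel : ℕ) : ℕ → ℕ → List ℕ → Bool :=
  Nat.rec (fun _ _ _ => false) (fun _ ih S F acc =>
    Nat.rec (leaf acc) (fun _ _ =>
      force (pick (Nat.lor (Nat.mod S (Nat.sub base 1)) flags) F 512 0) fun y =>
        bif bit 0xFEFE y then
          allBits (fun b => force (codeOf m y b) fun c =>
            ih (Nat.land S (Nat.lor b (detMask (posVar m) (occupied m) c)))
              (Nat.xor F (flag y)) (c :: acc)) 512 (Nat.land S (block y))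
        else false) F) fuel

def row (c i : ℕ) : ℕ := Nat.land (Nat.shiftRight c (Nat.mul 4 i)) 15

def vecMul (v c : ℕ) : ℕ :=
  List.rec 0 (fun i _ r => bif bit v i then Nat.xor (row c i) r else r) [0, 1, 2, 3]

def mulCode (a b : ℕ) : ℕ :=
  List.rec 0 (fun i _ r => Nat.add (vecMul (row a i) b) (Nat.mul 16 r)) [0, 1, 2, 3]

/-- Seven conjugation steps run through the whole orbit, including the starting code, since the
matrices `s` in use have orders 6, 7 and 4. -/
def orbit (m s s' : ℕ) (n : ℕ) : ℕ → ℕ → ℕ :=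
  Nat.rec (fun _ acc => acc) (fun _ ih c acc =>
    force (mulCode (mulCode s c) s') fun c' => ih c' (Nat.lor acc (posOf m c'))) n

def remove (m s s' c R : ℕ) : ℕ := Nat.xor R (Nat.land R (orbit m s s' 7 c 0))

def removeAll (m s s' : ℕ) (l : List ℕ) (R : ℕ) : ℕ :=
  List.rec (motive := fun _ => ℕ → ℕ) (fun R => R) (fun c _ ih R => ih (remove m s s' c R)) l R

def searchAll (m s s' : ℕ) (leaf : List ℕ → Bool) (y : ℕ) (l : List ℕ) (R : ℕ) : Bool :=
  List.rec (motive := fun _ => ℕ → Bool) (fun _ => true) (fun c _ ih R =>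
    bif search m leaf 16 (Nat.land R (Nat.lor (posOf m c) (detMask (posVar m) (occupied m) c)))
        (Nat.xor flags (flag y)) [c] then ih (remove m s s' c R) else false) l R

/-- Recovers `c` from `2^c`: intersecting with the truth table of a variable reads one binary digit
of `c`. -/
def fullCode (b : ℕ) : ℕ :=
  Nat.rec 0 (fun k r => Nat.add r
    (Nat.rec 0 (fun _ _ => Nat.pow 2 k) (Nat.land b (fullVar k)))) 16

def singularAll (m : ℕ) (l : List ℕ) : ℕ :=
  List.rec m (fun c _ r => Nat.land r (Nat.xor fullMask (detMask fullVar fullMask c))) l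

/-- The value `true` certifies that one cannot choose from `S` a code for each last row in `l` with
pairwise invertible differences. -/
def noColumn (l : List ℕ) : ℕ → Bool :=
  List.rec (fun _ => false) (fun y _ ih S => allBits (fun b => force (fullCode b) fun c =>
    ih (Nat.land S (detMask fullVar fullMask c))) 4096
      (Nat.land S (Nat.shiftLeft (ones 4096) (Nat.mul 4096 y)))) l

def columnLeaf (s : ℕ) (l : List ℕ) : Bool := noColumn ys (singularAll (cMask s) l)

def memB (c : ℕ) (l : List ℕ) : Bool :=
  List.rec false (fun a _ r => bif Nat.beq a c then true else r) l

def allB (p : ℕ → Bool) (l : List ℕ) : Bool :=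
  List.rec true (fun a _ r => bif p a then r else false) l

def fieldLeaf (s s' : ℕ) (l : List ℕ) : Bool :=
  bif allB (fun y => memB y
      (List.rec [] (fun a _ r => Nat.shiftRight a 12 :: r) l)) ys then
    allB (fun a => allB (fun b => bif Nat.beq a b then true else
      bif memB (Nat.xor a b) (s :: l) then
        Nat.beq (mulCode (mulCode a s') b) (mulCode (mulCode b s') a)
      else false) (s :: l)) (s :: l)
  else false

/-- Moves the base point: `R ∪ {0}` translated by `s` has the nonzero members `s` and `a + s`. The
translated row is tested for a column, now without the normalisation that the column contains `1`.
-/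
def shiftLeaf (s : ℕ) (l : List ℕ) : Bool :=
  noColumn nonzeroCodes (singularAll (detMask fullVar fullMask 0)
    (s :: List.rec [] (fun a _ r => Nat.xor a s :: r) l))

def squareLeaf (s s' : ℕ) (l : List ℕ) : Bool :=
  bif fieldLeaf s s' l then true else shiftLeaf s l

/-- Evaluating this test replaces a general proof about the layout: the listed candidates are all of
them, and each has a single position, lies in its block and can be read back. -/
def layoutOK (m : ℕ) : Bool :=
  bif Nat.beq m (List.rec 0 (fun y _ r => Nat.lor r (Nat.shiftLeft
      (List.rec 0 (fun w _ r => Nat.lor r (Nat.pow 2 w)) (lows m y)) (Nat.mul 4096 y))) ys) then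
    allB (fun y => allB (fun w => force (Nat.add (Nat.mul 4096 y) w) fun c => (fun b =>
      bif Nat.beq (Nat.land b (Nat.sub b 1)) 0 then
      bif Nat.beq b 0 then false else
      bif Nat.beq (Nat.land b (block y)) b then Nat.beq (codeOf m y b) c
      else false else false) (posOf m c)) (lows m y)) ys
  else false

/-- In this and the next two lists the conjugates under the respective `s` cover all candidates with
one fixed last row, namely 3, 6 and 5. This is verified by evaluation in `removeAll_six`,
`removeAll_seven` and `removeAll_four`. -/
def reps62 : List ℕ := [0x315D, 0x315F, 0x316E, 0x316F, 0x3184, 0x318F, 0x3195, 0x3196, 0x319D,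
  0x319E, 0x31B4, 0x31BF, 0x31D4, 0x31D5, 0x31E4, 0x31E6, 0x3418, 0x341B, 0x341D, 0x341E, 0x345B,
  0x345C, 0x3468, 0x346C, 0x3486, 0x348D, 0x34A5, 0x34A6, 0x34A8, 0x34AB, 0x34B5, 0x34BE, 0x34C5,
  0x34C6, 0x34CD, 0x34CE, 0x34D8, 0x34DC, 0x34EB, 0x34EC, 0x3518, 0x351A, 0x352C, 0x352D, 0x357B,
  0x357F, 0x3597, 0x359D, 0x35A1, 0x35A8, 0x35C4, 0x35CB, 0x35D1, 0x35D4, 0x35DA, 0x35DF, 0x35E1,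
  0x35E7, 0x35EA, 0x35EC, 0x3728, 0x372B, 0x372D, 0x372E, 0x375A, 0x375E, 0x376A, 0x376D, 0x3781,
  0x378A, 0x3795, 0x3796, 0x3798, 0x379B, 0x37B1, 0x37BA, 0x37D1, 0x37D6, 0x37E1, 0x37E5, 0x3815,
  0x381E, 0x3827, 0x382C, 0x3876, 0x387D, 0x3897, 0x389C, 0x38A5, 0x38AE, 0x38C6, 0x38CD, 0x3D1A,
  0x3D1B, 0x3D25, 0x3D27, 0x3D51, 0x3D54, 0x3D5A, 0x3D5F, 0x3D61, 0x3D67, 0x3D6A, 0x3D6C, 0x3D78,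
  0x3D7F, 0x3D95, 0x3D9C, 0x3DA1, 0x3DAB, 0x3DC4, 0x3DC8]

def reps7 : List ℕ := [0x6129, 0x612B, 0x612D, 0x613A, 0x615A, 0x618B, 0x61BF, 0x61C3, 0x61C9,
  0x61D4, 0x61DE, 0x621A, 0x621F, 0x6258, 0x6259, 0x625E, 0x6279, 0x6281, 0x6283, 0x628D, 0x628F,
  0x629A, 0x62B1, 0x62B7, 0x62B8, 0x62E3, 0x62E7, 0x62E9, 0x62ED, 0x62F1, 0x62FA, 0x6318, 0x631B,
  0x6378, 0x637D, 0x6381, 0x6398, 0x63B7, 0x63B9, 0x63E1, 0x63EF, 0x63FB, 0x641A, 0x641B, 0x641E,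
  0x6438, 0x6439, 0x6478, 0x6479, 0x6487, 0x6489, 0x6495, 0x6497, 0x6498, 0x64D7, 0x64D8, 0x64FA,
  0x64FE, 0x6729, 0x672B, 0x673F, 0x6758, 0x675B, 0x67B5, 0x67B8, 0x67C3, 0x67C5, 0x67C9, 0x67D3,
  0x67DF, 0x67E3, 0x67F4, 0x67FA, 0x681D, 0x6825, 0x682B, 0x6854, 0x685A, 0x68BA, 0x68F3, 0x68FD,
  0x6914, 0x691A, 0x6923, 0x6925, 0x6927, 0x6931, 0x693D, 0x6958, 0x69B5, 0x69C7, 0x69CD, 0x69D3,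
  0x69E3, 0x69ED, 0x6A14, 0x6A15, 0x6A1E, 0x6A37, 0x6A38, 0x6A75, 0x6A79, 0x6A97, 0x6A98, 0x6A9B,
  0x6AD8, 0x6AD9, 0x6AE5, 0x6AEB, 0x6AF4, 0x6AFB, 0x6C14, 0x6C1F, 0x6C51, 0x6C57, 0x6C58, 0x6C74,
  0x6C81, 0x6C83, 0x6C8D, 0x6C8F, 0x6C97, 0x6CB8, 0x6CB9, 0x6CBE, 0x6CE3, 0x6CE7, 0x6CE9, 0x6CED,
  0x6CF1, 0x6CF4, 0x6D15, 0x6D18, 0x6D57, 0x6D59, 0x6D73, 0x6D78, 0x6D81, 0x6D8F, 0x6D93, 0x6DE1,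
  0x6DF8, 0x6E34, 0x6E3A, 0x6E3F, 0x6E51, 0x6E5F, 0x6E75, 0x6E95, 0x6E9B, 0x6EB1, 0x6EC3, 0x6ECD,
  0x6ED1, 0x6ED4, 0x6EDF, 0x6F25, 0x6F27, 0x6F34, 0x6F3E, 0x6F51, 0x6F54, 0x6F85, 0x6F8B, 0x6FB1,
  0x6FBA, 0x6FC7, 0x6FCB, 0x6FCD, 0x6FDE]

def reps42 : List ℕ := [0x512B, 0x5139, 0x5169, 0x51B9, 0x51E9, 0x51F3, 0x531C, 0x537B, 0x53AB,
  0x53C8, 0x53E1, 0x53F7, 0x53FD, 0x546A, 0x546E, 0x5478, 0x54A8, 0x54D7, 0x561D, 0x5628, 0x562A,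
  0x567E, 0x5689, 0x56AE, 0x56BC, 0x576C, 0x57F6, 0x5937, 0x597D, 0x59AD, 0x5A23, 0x5B73, 0x5BA3,
  0x5C26, 0x5E76, 0x5EA6]

end SpreadSearch

/-! ### What the bits of the masks mean. -/

namespace SpreadSearch

theorem force_eq {α : Type} (n : ℕ) (k : ℕ → α) : force n k = k n := by
  cases n <;> rfl

theorem land_eq (a b : ℕ) : Nat.land a b = a &&& b := rfl
theorem lor_eq (a b : ℕ) : Nat.lor a b = a ||| b := rfl
theorem xor_eq (a b : ℕ) : Nat.xor a b = a ^^^ b := rfl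
theorem shiftRight_eq (a b : ℕ) : Nat.shiftRight a b = a >>> b := rfl
theorem shiftLeft_eq (a b : ℕ) : Nat.shiftLeft a b = a <<< b := rfl

theorem bit_eq (n i : ℕ) : bit n i = n.testBit i := by
  rw [bit, land_eq, shiftRight_eq, Nat.testBit, Nat.and_one_is_mod, Nat.and_comm, Nat.and_one_is_mod]
  rcases Nat.mod_two_eq_zero_or_one (n >>> i) with h | h <;> rw [h] <;> rfl

theorem exists_lowest_bit {m : ℕ} (hm : m ≠ 0) : ∃ j, m ^^^ (m &&& (m - 1)) = 2 ^ j ∧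
    ∀ i, i ≠ j → (m &&& (m - 1)).testBit i = m.testBit i := by
  obtain ⟨j, q, ⟨t, rfl⟩, rfl⟩ := Nat.exists_eq_two_pow_mul_odd hm
  have hp : 0 < 2 ^ j := Nat.two_pow_pos j
  -- Above bit `j` the numbers `m` and `m - 1` agree; at bit `j` only `m` has a one, and below it
  -- only `m - 1` has ones.
  have h1 : 2 ^ j * (2 * t + 1) = 2 ^ (j + 1) * t + 2 ^ j := by ring
  have h2 : 2 ^ j * (2 * t + 1) - 1 = 2 ^ (j + 1) * t + (2 ^ j - 1) := by
    rw [h1, Nat.add_sub_assoc hp]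
  have hlt : 2 ^ j < 2 ^ (j + 1) := Nat.pow_lt_pow_right (by norm_num) (by omega)
  have hlt' : 2 ^ j - 1 < 2 ^ (j + 1) := by omega
  have key : ∀ i, i ≠ j → ((2 ^ j * (2 * t + 1)) &&& (2 ^ j * (2 * t + 1) - 1)).testBit i
      = (2 ^ j * (2 * t + 1)).testBit i := by
    intro i hij
    rw [h2, h1, Nat.testBit_and, Nat.testBit_two_pow_mul_add _ hlt,
      Nat.testBit_two_pow_mul_add _ hlt', Nat.testBit_two_pow, Nat.testBit_two_pow_sub_one]
    by_cases h : i < j + 1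
    · have : ¬ j = i := fun h => hij h.symm
      simp [h, this]
    · simp [h]
  refine ⟨j, Nat.eq_of_testBit_eq fun i => ?_, key⟩
  rcases eq_or_ne i j with rfl | hij
  · rw [Nat.testBit_xor, Nat.testBit_and, h2, h1, Nat.testBit_two_pow_mul_add _ hlt,
      Nat.testBit_two_pow_mul_add _ hlt', Nat.testBit_two_pow, Nat.testBit_two_pow_sub_one]
    simp
  · rw [Nat.testBit_xor, key i hij, Nat.testBit_two_pow]
    simp [hij.symm]

theorem allBits_sound {p : ℕ → Bool} {fuel m i : ℕ} (h : allBits p fuel m = true)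
    (hi : m.testBit i = true) : p (2 ^ i) = true := by
  induction fuel generalizing m with
  | zero => simp [allBits] at h
  | succ n ih =>
    have hm : m ≠ 0 := by rintro rfl; simp at hi
    obtain ⟨j, hj, hj'⟩ := exists_lowest_bit hm
    obtain ⟨k, rfl⟩ := Nat.exists_eq_succ_of_ne_zero hm
    change (bif p (Nat.succ k ^^^ (Nat.succ k &&& (Nat.succ k - 1))) then
      allBits p n (Nat.succ k &&& (Nat.succ k - 1)) else false) = true at h
    rw [hj, Bool.cond_false_right, Bool.and_eq_true] at h
    rcases eq_or_ne i j with rfl | hij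
    · exact h.1
    · exact ih h.2 ((hj' i hij).trans hi)

theorem testBit_varMask (n k c : ℕ) (hc : c < 2 ^ n) (hk : k < n) :
    (varMask n k).testBit c = c.testBit k := by
  induction n generalizing c with
  | zero => omega
  | succ m ih =>
    change (bif Nat.beq k m then ((2 ^ (2 ^ m) - 1) <<< (2 ^ m))
      else varMask m k ||| (varMask m k <<< (2 ^ m))).testBit c = _
    have hle : ∀ (n k c : ℕ), (varMask n k).testBit c = true → c < 2 ^ n := by
      intro n
      induction n with
      | zero => intro k c h; simp [varMask] at h
      | succ m ih =>
        intro k c h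
        change (bif Nat.beq k m then ((2 ^ (2 ^ m) - 1) <<< (2 ^ m))
          else varMask m k ||| (varMask m k <<< (2 ^ m))).testBit c = true at h
        have h2 : 2 ^ (m + 1) = 2 ^ m + 2 ^ m := by ring
        cases hb : Nat.beq k m <;> rw [hb] at h
        · rw [cond_false, Nat.testBit_or, Nat.testBit_shiftLeft, Bool.or_eq_true,
            Bool.and_eq_true] at h
          rcases h with h | ⟨h, h'⟩
          · have := ih _ _ h; omega
          · have := ih _ _ h'; simp at h; omega
        · rw [cond_true, Nat.testBit_shiftLeft, Nat.testBit_two_pow_sub_one] at h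
          simp at h; omega
    have h2 : 2 ^ (m + 1) = 2 ^ m + 2 ^ m := by ring
    by_cases hkm : k = m
    · subst hkm
      rw [Nat.beq_refl, cond_true, Nat.testBit_shiftLeft, Nat.testBit_two_pow_sub_one]
      by_cases hck : c < 2 ^ k
      · rw [Nat.testBit_lt_two_pow hck]; simp; omega
      · obtain ⟨d, rfl⟩ := Nat.exists_eq_add_of_le (not_lt.1 hck)
        rw [Nat.testBit_two_pow_add_eq, Nat.testBit_lt_two_pow (by omega : d < 2 ^ k)]
        simp; omega
    · have hb : Nat.beq k m = false := by
        cases hb : Nat.beq k m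
        · rfl
        · exact absurd (Nat.eq_of_beq_eq_true hb) hkm
      have hkm' : k < m := by omega
      rw [hb, cond_false, Nat.testBit_or, Nat.testBit_shiftLeft]
      by_cases hck : c < 2 ^ m
      · rw [ih c hck hkm']
        simp; intro h; omega
      · obtain ⟨d, rfl⟩ := Nat.exists_eq_add_of_le (not_lt.1 hck)
        rw [Nat.testBit_two_pow_add_gt hkm', Nat.add_sub_cancel_left, ih d (by omega) hkm']
        have : (varMask m k).testBit (2 ^ m + d) = false := by
          cases h : (varMask m k).testBit (2 ^ m + d)
          · rfl
          · exact absurd (hle _ _ _ h) (by omega)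
        rw [this]; simp

theorem testBit_fullVar {k c : ℕ} (hc : c < 65536) (hk : k < 16) :
    (fullVar k).testBit c = c.testBit k :=
  testBit_varMask 16 k c hc hk

theorem testBit_fullMask {c : ℕ} (hc : c < 65536) : fullMask.testBit c = true := by
  rw [fullMask, testBit_ones]
  simpa using hc

/-- The position `p` of a bit mask layout with bit planes `V` and support `O` carries `c`. -/
structure Carries (V : ℕ → ℕ) (O p c : ℕ) : Prop where
  mem : O.testBit p = true
  plane : ∀ k < 16, (V k).testBit p = c.testBit k

theorem carries_full {c : ℕ} (hc : c < 65536) : Carries fullVar fullMask c c :=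
  ⟨testBit_fullMask hc, fun _ hk => testBit_fullVar hc hk⟩

def minorBits (f : ℕ → Bool) (o i j : ℕ) : Bool :=
  (f (o + i) && f (o + (4 + j))) ^^ (f (o + j) && f (o + (4 + i)))

def detBits (f : ℕ → Bool) : Bool :=
  (((minorBits f 0 0 1 && minorBits f 8 2 3) ^^ (minorBits f 0 0 2 && minorBits f 8 1 3)) ^^
    ((minorBits f 0 0 3 && minorBits f 8 1 2) ^^ (minorBits f 0 1 2 && minorBits f 8 0 3))) ^^
    ((minorBits f 0 1 3 && minorBits f 8 0 2) ^^ (minorBits f 0 2 3 && minorBits f 8 0 1))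

section

variable {V : ℕ → ℕ} {O p c : ℕ}

theorem Carries.testBit_lit (h : Carries V O p c) (b : Bool) {k : ℕ} (hk : k < 16) :
    (lit V O b k).testBit p = (c.testBit k ^^ b) := by
  cases b
  · simp [lit, h.plane k hk]
  · simp [lit, h.plane k hk, h.mem]

theorem Carries.testBit_minorMask (h : Carries V O p c) {o i j n d : ℕ} (hi : i < 4) (hj : j < 4)
    (ho : o ≤ 8) (hn : ∀ k < 8, n.testBit k = d.testBit (o + k)) :
    (minorMask V O o i j n).testBit p = minorBits (fun k => c.testBit k ^^ d.testBit k) o i j := by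
  simp only [minorMask, xor_eq, land_eq, Nat.testBit_xor, Nat.testBit_and, bit_eq, Nat.add_eq]
  rw [h.testBit_lit _ (by omega), h.testBit_lit _ (by omega), h.testBit_lit _ (by omega),
    h.testBit_lit _ (by omega), hn _ (by omega), hn _ (by omega), hn _ (by omega), hn _ (by omega)]
  rfl

theorem Carries.testBit_detMask (h : Carries V O p c) (d : ℕ) :
    (detMask V O d).testBit p = detBits fun k => c.testBit k ^^ d.testBit k := by
  have ha : ∀ k < 8, (d &&& 255).testBit k = d.testBit (0 + k) := fun k hk => by
    have : (255 : ℕ) = 2 ^ 8 - 1 := rfl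
    rw [this, Nat.testBit_and, Nat.testBit_two_pow_sub_one]
    simp [hk]
  have hb : ∀ k < 8, (d >>> 8).testBit k = d.testBit (8 + k) := fun k _ => by
    rw [Nat.testBit_shiftRight]
  simp only [detMask, force_eq, xor_eq, land_eq, shiftRight_eq, Nat.testBit_xor, Nat.testBit_and]
  rw [h.testBit_minorMask (d := d) _ _ _ ha, h.testBit_minorMask (d := d) _ _ _ ha,
    h.testBit_minorMask (d := d) _ _ _ ha, h.testBit_minorMask (d := d) _ _ _ ha,
    h.testBit_minorMask (d := d) _ _ _ ha, h.testBit_minorMask (d := d) _ _ _ ha,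
    h.testBit_minorMask (d := d) _ _ _ hb, h.testBit_minorMask (d := d) _ _ _ hb,
    h.testBit_minorMask (d := d) _ _ _ hb, h.testBit_minorMask (d := d) _ _ _ hb,
    h.testBit_minorMask (d := d) _ _ _ hb, h.testBit_minorMask (d := d) _ _ _ hb]
  · rfl
  all_goals norm_num

/-- The vanishing of `x ᵥ* D`, where the entries of `D` are listed by `f`. -/
def rowZeroBits (f : ℕ → Bool) (x : ℕ) : Bool :=
  !((List.range 4).any fun j => (x.testBit 0 && f j) ^^ ((x.testBit 1 && f (4 + j)) ^^
    ((x.testBit 2 && f (8 + j)) ^^ (x.testBit 3 && f (12 + j)))))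

theorem Carries.testBit_rowComb (h : Carries V O p c) (s x : ℕ) {j : ℕ} (hj : j < 4) :
    (rowComb V O s x j).testBit p =
      ((x.testBit 0 && (c.testBit j ^^ s.testBit j)) ^^
        ((x.testBit 1 && (c.testBit (4 + j) ^^ s.testBit (4 + j))) ^^
        ((x.testBit 2 && (c.testBit (8 + j) ^^ s.testBit (8 + j))) ^^
        (x.testBit 3 && (c.testBit (12 + j) ^^ s.testBit (12 + j)))))) := by
  have key : ∀ (b : Bool) (m r : ℕ) , (bif b then Nat.xor m r else r).testBit p =
      ((b && m.testBit p) ^^ r.testBit p) := by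
    intro b m r; cases b <;> simp
  simp only [rowComb, key, bit_eq, Nat.add_eq, Nat.mul_eq]
  rw [h.testBit_lit _ (by omega), h.testBit_lit _ (by omega), h.testBit_lit _ (by omega),
    h.testBit_lit _ (by omega)]
  simp

theorem Carries.testBit_rowZero (h : Carries V O p c) (s x : ℕ) :
    (rowZero V O s x).testBit p = rowZeroBits (fun k => c.testBit k ^^ s.testBit k) x := by
  simp only [rowZero, xor_eq, lor_eq, Nat.testBit_xor, Nat.testBit_or, h.mem]
  rw [h.testBit_rowComb s x (by omega), h.testBit_rowComb s x (by omega),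
    h.testBit_rowComb s x (by omega), h.testBit_rowComb s x (by omega)]
  simp [rowZeroBits, List.range_succ]
  
theorem testBit_anyZero (V : ℕ → ℕ) (O p s : ℕ) (l : List ℕ) :
    (anyZero V O s l).testBit p = l.any fun x => (rowZero V O s x).testBit p := by
  induction l with
  | nil => simp [anyZero]
  | cons a l ih =>
    rw [List.any_cons, ← ih, ← Nat.testBit_or]; rfl

/-- Uniqueness of the vanishing vector at position `p` is what keeps the pair mask zero there; the
list must be free of repetitions, since otherwise a vector would be paired with itself. -/
theorem testBit_twoZero (V : ℕ → ℕ) (O p s : ℕ) (l : List ℕ) (hl : l.Nodup)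
    (h : ∀ x ∈ l, ∀ y ∈ l, (rowZero V O s x).testBit p = true →
      (rowZero V O s y).testBit p = true → x = y) :
    (twoZero V O s l).testBit p = false := by
  induction l with
  | nil => simp [twoZero]
  | cons a l ih =>
    rw [List.nodup_cons] at hl
    change ((rowZero V O s a &&& anyZero V O s l) ||| twoZero V O s l).testBit p = false
    rw [Nat.testBit_or, Nat.testBit_and, testBit_anyZero,
      ih hl.2 fun x hx y hy => h x (by simp [hx]) y (by simp [hy])]
    cases h1 : (rowZero V O s a).testBit p
    · simp
    · have : (l.any fun x => (rowZero V O s x).testBit p) = false := by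
        rw [List.any_eq_false]
        intro x hx hx'
        have := h a (by simp) x (by simp [hx]) h1 hx'
        exact hl.1 (this ▸ hx)
      simp [this]

theorem Carries.testBit_oneMask (h : Carries V O p c) (s : ℕ)
    (hu : ∃! x, x ∈ nonzeroCodes ∧ rowZeroBits (fun k => c.testBit k ^^ s.testBit k) x = true) :
    (oneMask V O s).testBit p = true := by
  obtain ⟨x, ⟨hx, hx'⟩, hxu⟩ := hu
  simp only [oneMask, xor_eq, land_eq, Nat.testBit_xor, Nat.testBit_and]
  rw [testBit_twoZero, testBit_anyZero]
  · simp only [Bool.and_false, Bool.xor_false, List.any_eq_true]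
    exact ⟨x, hx, by rw [h.testBit_rowZero]; exact hx'⟩
  · decide
  · intro y hy z hz h1 h2
    rw [h.testBit_rowZero] at h1 h2
    rw [hxu y ⟨hy, h1⟩, hxu z ⟨hz, h2⟩]

end

def traceBits (f : ℕ → Bool) : Bool := (f 0 ^^ f 5) ^^ (f 10 ^^ f 15)

def pminorBits (f : ℕ → Bool) (i j : ℕ) : Bool :=
  (f (5 * i) && f (5 * j)) ^^ (f (4 * i + j) && f (4 * j + i))

def pminorsBits (f : ℕ → Bool) : Bool :=
  ((pminorBits f 0 1 ^^ pminorBits f 0 2) ^^ (pminorBits f 0 3 ^^ pminorBits f 1 2)) ^^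
    (pminorBits f 1 3 ^^ pminorBits f 2 3)

theorem testBit_traceMask {c : ℕ} (hc : c < 65536) :
    (traceMask fullVar).testBit c = traceBits c.testBit := by
  simp [traceMask, traceBits, testBit_fullVar hc]

theorem testBit_pminorsMask {c : ℕ} (hc : c < 65536) :
    (pminorsMask fullVar).testBit c = pminorsBits c.testBit := by
  simp [pminorsMask, pminor, pminorsBits, pminorBits, testBit_fullVar hc]

theorem testBit_typeMask_zero {c : ℕ} (hc : c < 65536) : (typeMask 0).testBit c = true :=
  testBit_fullMask hc

theorem testBit_typeMask_one {c : ℕ} (hc : c < 65536) :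
    (typeMask 1).testBit c = !(traceBits c.testBit && !pminorsBits c.testBit) := by
  have e0 : Nat.beq 1 0 = false := rfl
  have e1 : Nat.beq 1 1 = true := rfl
  simp [typeMask, e0, testBit_fullMask hc, testBit_traceMask hc, testBit_pminorsMask hc]

theorem testBit_typeMask_two {c : ℕ} (hc : c < 65536) :
    (typeMask 2).testBit c = !(traceBits c.testBit || pminorsBits c.testBit) := by
  have e0 : Nat.beq 2 0 = false := rfl
  have e1 : Nat.beq 2 1 = false := rfl
  simp [typeMask, e0, e1, testBit_fullMask hc, testBit_traceMask hc, testBit_pminorsMask hc]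

theorem testBit_rMask {s q c : ℕ} (hc : c < 65536)
    (h0 : detBits c.testBit = true)
    (h1 : ∃! x, x ∈ nonzeroCodes ∧
      rowZeroBits (fun k => c.testBit k ^^ Nat.testBit 0x8421 k) x = true)
    (hs : detBits (fun k => c.testBit k ^^ s.testBit k) = true)
    (hq : (typeMask q).testBit c = true) : (rMask s q).testBit c = true := by
  simp only [rMask, land_eq, Nat.testBit_and, (carries_full hc).testBit_detMask,
    (carries_full hc).testBit_oneMask _ h1, hs, hq, Nat.zero_testBit, Bool.xor_false]
  simpa using h0

theorem testBit_cMask {s c : ℕ} (hc : c < 65536)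
    (h0 : detBits c.testBit = true)
    (h1 : detBits (fun k => c.testBit k ^^ Nat.testBit 0x8421 k) = true)
    (hs : ∃! x, x ∈ nonzeroCodes ∧ rowZeroBits (fun k => c.testBit k ^^ s.testBit k) x = true) :
    (cMask s).testBit c = true := by
  simp only [cMask, land_eq, Nat.testBit_and, (carries_full hc).testBit_detMask,
    (carries_full hc).testBit_oneMask _ hs, h1, Nat.zero_testBit, Bool.xor_false]
  simpa using h0

end SpreadSearch

/-! ### Soundness of the search. -/

namespace SpreadSearch

theorem allB_eq (p : ℕ → Bool) (l : List ℕ) : allB p l = l.all p := by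
  induction l with
  | nil => rfl
  | cons a l ih =>
    rw [List.all_cons, ← ih, ← Bool.cond_false_right]; rfl

theorem memB_iff (c : ℕ) (l : List ℕ) : memB c l = true ↔ c ∈ l := by
  induction l with
  | nil => simp [memB]
  | cons a l ih =>
    change (bif Nat.beq a c then true else memB c l) = true ↔ _
    rw [Bool.cond_true_left, Bool.or_eq_true, Nat.beq_eq, ih, List.mem_cons, eq_comm]

theorem foldOr_testBit {α : Type} (g : α → ℕ) (l : List α) (p : ℕ) :
    (List.rec 0 (fun y _ r => Nat.lor r (g y)) l : ℕ).testBit p = true ↔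
      ∃ y ∈ l, (g y).testBit p = true := by
  induction l with
  | nil => simp
  | cons a l ih =>
    simp only [lor_eq, Nat.testBit_or, Bool.or_eq_true, List.exists_mem_cons_iff]
    rw [← ih, or_comm]; rfl

theorem testBit_posOf {m c p : ℕ} (h : (posOf m c).testBit p = true) :
    Carries (posVar m) (occupied m) p c := by
  have key : ∀ (n acc : ℕ), (Nat.rec (motive := fun _ => ℕ → ℕ) (fun acc => acc)
      (fun k ih acc => ih (Nat.land acc
        (bif bit c k then posVar m k else Nat.xor (occupied m) (posVar m k)))) n acc).testBit p
        = true → acc.testBit p = true ∧ ∀ k < n,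
        (bif bit c k then posVar m k else Nat.xor (occupied m) (posVar m k)).testBit p = true := by
    intro n
    induction n with
    | zero => intro acc h; exact ⟨h, by simp⟩
    | succ n ih =>
      intro acc h
      obtain ⟨h1, h2⟩ := ih _ h
      rw [land_eq, Nat.testBit_and, Bool.and_eq_true] at h1
      refine ⟨h1.1, fun k hk => ?_⟩
      rcases Nat.lt_succ_iff_lt_or_eq.1 hk with hk | rfl
      · exact h2 k hk
      · exact h1.2
  obtain ⟨h1, h2⟩ := key 16 _ h
  refine ⟨h1, fun k hk => ?_⟩
  have := h2 k hk
  rw [bit_eq] at this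
  cases hb : c.testBit k <;> rw [hb] at this
  · rw [cond_false, xor_eq, Nat.testBit_xor, h1] at this
    simpa using this
  · exact this

/-- The properties of the position of a candidate code which the search relies on. -/
structure Placed (m c p : ℕ) : Prop where
  pos : posOf m c = 2 ^ p
  block : (block (c / 4096)).testBit p = true
  code : codeOf m (c / 4096) (2 ^ p) = c
  mem : c / 4096 ∈ ys

theorem Placed.carries {m c p : ℕ} (h : Placed m c p) : Carries (posVar m) (occupied m) p c :=
  testBit_posOf (by rw [h.pos, Nat.testBit_two_pow_self])

theorem exists_placed {m : ℕ} (hm : layoutOK m = true) {c : ℕ} (hc : m.testBit c = true) :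
    ∃ p, Placed m c p := by
  rw [layoutOK, Bool.cond_false_right, Bool.and_eq_true, Nat.beq_eq, allB_eq] at hm
  obtain ⟨h1, h2⟩ := hm
  rw [h1, foldOr_testBit] at hc
  obtain ⟨y, hy, hc⟩ := hc
  rw [shiftLeft_eq, Nat.testBit_shiftLeft, Bool.and_eq_true, foldOr_testBit] at hc
  obtain ⟨hle, w, hw, hcw⟩ := hc
  have hcw' : (2 ^ w).testBit (c - Nat.mul 4096 y) = true := hcw
  rw [Nat.testBit_two_pow, decide_eq_true_eq] at hcw'
  have hle' : Nat.mul 4096 y ≤ c := by simpa using hle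
  have hceq : Nat.add (Nat.mul 4096 y) w = c := by
    rw [Nat.add_eq, hcw']; omega
  have h3 := List.all_eq_true.1 h2 y hy
  rw [allB_eq] at h3
  have h4 := List.all_eq_true.1 h3 w hw
  rw [force_eq, hceq] at h4
  simp only [Bool.cond_false_right, Bool.and_eq_true, Nat.beq_eq, Bool.cond_false_left,
    Bool.not_eq_true', land_eq, Nat.sub_eq] at h4
  obtain ⟨h5, h6, h7, h8⟩ := h4
  have h6' : posOf m c ≠ 0 := by
    intro h0
    rw [h0] at h6
    simp at h6
  obtain ⟨p, hp, -⟩ := exists_lowest_bit h6'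
  rw [h5, Nat.xor_zero] at hp
  have hy' : c / 4096 = y := by
    rw [← h8, codeOf, land_eq, Nat.add_eq, Nat.mul_eq]
    have : (Nat.div (codesWord m) (posOf m c) &&& 4095) ≤ 4095 := Nat.and_le_right
    omega
  refine ⟨p, hp, ?_, ?_, ?_⟩
  · have h9 : (posOf m c).testBit p = true := by rw [hp, Nat.testBit_two_pow_self]
    rw [← h7, Nat.testBit_and, Bool.and_eq_true] at h9
    rw [hy']; exact h9.2
  · rw [hy', ← hp]; exact h8
  · rw [hy']; exact hy

/-- The codes of the matrices of a partial spread set with respect to the candidates `m`. -/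
structure IsSystem (m : ℕ) (T : Set ℕ) : Prop where
  cand : ∀ c ∈ T, m.testBit c = true
  adj : ∀ c ∈ T, ∀ d ∈ T, c ≠ d → detBits (fun k => c.testBit k ^^ d.testBit k) = true
  cover : ∀ y ∈ ys, ∃ c ∈ T, c / 4096 = y

/-- The invariant of the search: no member of the hypothetical system `T` has been pruned. -/
def Within (m S : ℕ) (T : Set ℕ) : Prop := ∀ c ∈ T, ∀ p, Placed m c p → S.testBit p = true

theorem Within.child {m S c p : ℕ} {T : Set ℕ} (hT : IsSystem m T) (hS : Within m S T)
    (hc : c ∈ T) (hp : Placed m c p) :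
    Within m (Nat.land S (Nat.lor (2 ^ p) (detMask (posVar m) (occupied m) c))) T := by
  intro d hd q hq
  rw [land_eq, lor_eq, Nat.testBit_and, Nat.testBit_or, hS d hd q hq, Bool.true_and,
    Bool.or_eq_true]
  by_cases hcd : d = c
  · subst hcd
    left
    rw [← hp.pos, hq.pos, Nat.testBit_two_pow_self]
  · right
    rw [hq.carries.testBit_detMask]
    exact hT.adj d hd c hc hcd

theorem mem_ys_of_bit {y : ℕ} (h : bit 0xFEFE y = true) : y ∈ ys := by
  rw [bit_eq] at h
  have hy : y < 16 := by
    by_contra hy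
    rw [Nat.testBit_lt_two_pow (lt_of_lt_of_le (by norm_num : 0xFEFE < 2 ^ 16)
      (Nat.pow_le_pow_right (by norm_num) (not_lt.1 hy)))] at h
    exact Bool.false_ne_true h
  interval_cases y <;> revert h <;> decide

/-- Whichever last row is branched on, `T` has a member there, and choosing it prunes nothing from
`T`. These choices lead to a leaf inside `T`, which fails. Thus a successful search refutes `T`; the
quality of `pick` affects only the running time. -/
theorem search_sound {m : ℕ} (hm : layoutOK m = true) {T : Set ℕ} (hT : IsSystem m T)
    {leaf : List ℕ → Bool} (hleaf : ∀ l, (∀ a ∈ l, a ∈ T) → leaf l = false) (fuel : ℕ) :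
    ∀ S F acc, Within m S T → (∀ a ∈ acc, a ∈ T) → search m leaf fuel S F acc = false := by
  induction fuel with
  | zero => intros; rfl
  | succ n ih =>
    intro S F acc hS hacc
    cases F with
    | zero => exact hleaf acc hacc
    | succ F =>
      change force (pick (Nat.lor (Nat.mod S (Nat.sub base 1)) flags) (F + 1) 512 0) (fun y =>
        bif bit 0xFEFE y then
          allBits (fun b => force (codeOf m y b) fun c =>
            search m leaf n (Nat.land S (Nat.lor b (detMask (posVar m) (occupied m) c)))
              (Nat.xor (F + 1) (flag y)) (c :: acc)) 512 (Nat.land S (block y))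
        else false) = false
      rw [force_eq]
      generalize pick (Nat.lor (Nat.mod S (Nat.sub base 1)) flags) (F + 1) 512 0 = y
      cases hb : bit 0xFEFE y
      · rfl
      · rw [cond_true]
        obtain ⟨c, hc, rfl⟩ := hT.cover y (mem_ys_of_bit hb)
        obtain ⟨p, hp⟩ := exists_placed hm (hT.cand c hc)
        by_contra hne
        rw [Bool.not_eq_false] at hne
        have := allBits_sound hne (i := p) (by
          rw [land_eq, Nat.testBit_and, hS c hc p hp, hp.block]; rfl)
        rw [force_eq, hp.code, ih _ _ _ (hS.child hT hc hp) (by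
          simpa [hc] using hacc)] at this
        exact Bool.false_ne_true this

theorem within_occupied (m : ℕ) (T : Set ℕ) : Within m (occupied m) T :=
  fun _ _ _ hp => hp.carries.mem

section Orbits

variable {m s s' : ℕ} {P : Set ℕ → Prop}

theorem mulCode_lt (a b : ℕ) : mulCode a b < 65536 := by
  have hr : ∀ i, row b i < 2 ^ 4 := fun i =>
    lt_of_le_of_lt (Nat.and_le_right : _ &&& 15 ≤ 15) (by norm_num)
  have key : ∀ (t : Bool) (x r : ℕ), x < 2 ^ 4 → r < 2 ^ 4 →
      (bif t then Nat.xor x r else r) < 2 ^ 4 := by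
    intro t x r hx hr
    cases t
    · exact hr
    · exact Nat.xor_lt_two_pow hx hr
  have hv : ∀ v, vecMul v b < 2 ^ 4 := by
    intro v
    exact key _ _ _ (hr _) (key _ _ _ (hr _) (key _ _ _ (hr _) (key _ _ _ (hr _) (by norm_num))))
  have h0 := hv (row a 0)
  have h1 := hv (row a 1)
  have h2 := hv (row a 2)
  have h3 := hv (row a 3)
  have : mulCode a b = vecMul (row a 0) b + 16 * (vecMul (row a 1) b + 16 * (vecMul (row a 2) b +
    16 * (vecMul (row a 3) b + 16 * 0))) := rfl
  omega

theorem lt_of_testBit_iff {a b : ℕ} (ha : a < 65536) (hb : b < 65536)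
    (h : ∀ k < 16, a.testBit k = b.testBit k) : a = b := by
  refine Nat.eq_of_testBit_eq fun i => ?_
  by_cases hi : i < 16
  · exact h i hi
  · have : 2 ^ 16 ≤ 2 ^ i := Nat.pow_le_pow_right (by norm_num) (not_lt.1 hi)
    rw [Nat.testBit_lt_two_pow (lt_of_lt_of_le ha this),
      Nat.testBit_lt_two_pow (lt_of_lt_of_le hb this)]

variable (hlt : ∀ T, P T → ∀ c ∈ T, c < 65536)
  (hconj : ∀ T, P T → ∀ c < 65536, mulCode (mulCode s c) s' ∈ T → ∃ T', P T' ∧ c ∈ T')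

include hlt hconj

/-- Conjugation by `s` carries members of the family `P` to members of `P`, so a code that occurs in
no member may be deleted together with its orbit. -/
theorem within_remove {c R : ℕ} (hc0 : c < 65536) (hc : ∀ T, P T → c ∉ T) (hR : ∀ T, P T → Within m R T)
    {T : Set ℕ} (hT : P T) : Within m (remove m s s' c R) T := by
  have key : ∀ (n c acc p : ℕ), c < 65536 → (∀ T, P T → c ∉ T) →
      (orbit m s s' n c acc).testBit p = true → acc.testBit p = true ∨
        ∃ c', c' < 65536 ∧ (∀ T, P T → c' ∉ T) ∧ (posOf m c').testBit p = true := by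
    intro n
    induction n with
    | zero => intro c acc p _ _ h; exact Or.inl h
    | succ n ih =>
      intro c acc p hc0 hc h
      change (force (mulCode (mulCode s c) s') fun c' =>
        orbit m s s' n c' (Nat.lor acc (posOf m c'))).testBit p = true at h
      rw [force_eq] at h
      have hc' : ∀ T, P T → mulCode (mulCode s c) s' ∉ T := fun T hT hcT => by
        obtain ⟨T', hT', hcT'⟩ := hconj T hT c hc0 hcT
        exact hc T' hT' hcT'
      rcases ih _ _ _ (mulCode_lt _ _) hc' h with h | h
      · rw [lor_eq, Nat.testBit_or, Bool.or_eq_true] at h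
        exact h.imp id fun h => ⟨_, mulCode_lt _ _, hc', h⟩
      · exact Or.inr h
  intro d hd p hp
  rw [remove, xor_eq, land_eq, Nat.testBit_xor, Nat.testBit_and, hR T hT d hd p hp]
  cases ho : (orbit m s s' 7 c 0).testBit p
  · rfl
  · rcases key 7 c 0 p hc0 hc ho with h | ⟨c', hc'lt, hc', h⟩
    · simp at h
    · refine absurd ?_ (hc' T hT)
      have hcar := testBit_posOf h
      rw [lt_of_testBit_iff hc'lt (hlt T hT d hd) fun k hk => by
        rw [← hcar.plane k hk, hp.carries.plane k hk]]
      exact hd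

theorem within_removeAll {l : List ℕ} (hl0 : ∀ c ∈ l, c < 65536) (hl : ∀ c ∈ l, ∀ T, P T → c ∉ T) {R : ℕ}
    (hR : ∀ T, P T → Within m R T) {T : Set ℕ} (hT : P T) :
    Within m (removeAll m s s' l R) T := by
  induction l generalizing R with
  | nil => exact hR T hT
  | cons a l ih =>
    exact ih (fun c hc => hl0 c (by simp [hc])) (fun c hc => hl c (by simp [hc]))
      (fun T hT => within_remove hlt hconj (hl0 a (by simp)) (hl a (by simp)) hR hT)

variable (hm : layoutOK m = true) (hsys : ∀ T, P T → IsSystem m T) {leaf : List ℕ → Bool}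
  (hleaf : ∀ T, P T → ∀ l, (∀ a ∈ l, a ∈ T) → leaf l = false)

include hm hsys hleaf

theorem searchAll_sound {y : ℕ} {l : List ℕ} {R : ℕ} (hl0 : ∀ c ∈ l, c < 65536) (hR : ∀ T, P T → Within m R T)
    (h : searchAll m s s' leaf y l R = true) : ∀ c ∈ l, ∀ T, P T → c ∉ T := by
  induction l generalizing R with
  | nil => simp
  | cons a l ih =>
    change (bif search m leaf 16
        (Nat.land R (Nat.lor (posOf m a) (detMask (posVar m) (occupied m) a)))
        (Nat.xor flags (flag y)) [a] then searchAll m s s' leaf y l (remove m s s' a R)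
      else false) = true at h
    rw [Bool.cond_false_right, Bool.and_eq_true] at h
    have ha : ∀ T, P T → a ∉ T := by
      intro T hT haT
      obtain ⟨p, hp⟩ := exists_placed hm ((hsys T hT).cand a haT)
      have := search_sound hm (hsys T hT) (hleaf T hT) 16 _ (Nat.xor flags (flag y)) [a]
        ((hR T hT).child (hsys T hT) haT hp) (by simpa using haT)
      rw [← hp.pos, h.1] at this
      exact Bool.false_ne_true this.symm
    intro c hc
    rcases List.mem_cons.1 hc with rfl | hc
    · exact ha
    · exact ih (fun c hc => hl0 c (by simp [hc]))
        (fun T hT => within_remove hlt hconj (hl0 a (by simp)) ha hR hT) h.2 c hc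

/-- Allows a list of representatives to be treated in separate evaluations; the removals due to
earlier segments are redone by `removeAll`. -/
theorem searchAll_chunk {y : ℕ} {l : List ℕ} {a b : ℕ} (hl0 : ∀ c ∈ l, c < 65536)
    (h : searchAll m s s' leaf y ((l.drop a).take b) (removeAll m s s' (l.take a) (occupied m))
      = true) (ha : ∀ c ∈ l.take a, ∀ T, P T → c ∉ T) :
    ∀ c ∈ l.take (a + b), ∀ T, P T → c ∉ T := by
  intro c hc
  rw [List.take_add, List.mem_append] at hc
  rcases hc with hc | hc
  · exact ha c hc
  · exact searchAll_sound hlt hconj hm hsys hleaf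
      (fun c hc => hl0 c (List.mem_of_mem_drop (List.mem_of_mem_take hc)))
      (fun T hT => within_removeAll hlt hconj (fun c hc => hl0 c (List.mem_of_mem_take hc)) ha
        (fun T _ => within_occupied m T) hT) h c hc

-- A system must have a member with last row `y`, but all candidates for it have been removed.
omit hleaf in
theorem not_of_search {y : ℕ} (hy : y ∈ ys) {l : List ℕ}
    (hl0 : ∀ c ∈ l, c < 65536) (hl : ∀ c ∈ l, ∀ T, P T → c ∉ T)
    (h : Nat.land (removeAll m s s' l (occupied m)) (block y) = 0) (T : Set ℕ) : ¬ P T := by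
  intro hT
  obtain ⟨c, hc, rfl⟩ := (hsys T hT).cover y hy
  obtain ⟨p, hp⟩ := exists_placed hm ((hsys T hT).cand c hc)
  have h1 := within_removeAll hlt hconj hl0 hl
    (fun T _ => within_occupied m T) hT c hc p hp
  have h2 : (Nat.land (removeAll m s s' l (occupied m)) (block (c / 4096))).testBit p = true := by
    rw [land_eq, Nat.testBit_and, h1, hp.block]; rfl
  rw [h] at h2
  simp at h2

end Orbits

end SpreadSearch

/-! ### Numbers as codes of matrices and vectors over the field with two elements. -/

namespace SpreadSearch

abbrev Mat := Matrix (Fin 4) (Fin 4) (ZMod 2)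

abbrev Vec := Fin 4 → ZMod 2

def ofBool (b : Bool) : ZMod 2 := bif b then 1 else 0

@[simp] theorem ofBool_xor (a b : Bool) : ofBool (a ^^ b) = ofBool a + ofBool b := by
  cases a <;> cases b <;> decide

@[simp] theorem ofBool_and (a b : Bool) : ofBool (a && b) = ofBool a * ofBool b := by
  cases a <;> cases b <;> decide

theorem ofBool_eq_zero {b : Bool} : ofBool b = 0 ↔ b = false := by
  cases b <;> decide

theorem ofBool_ne_zero {b : Bool} : ofBool b ≠ 0 ↔ b = true := by
  cases b <;> decide

theorem ofBool_injective : Function.Injective ofBool := by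
  decide

theorem ofBool_decide (a : ZMod 2) : ofBool (decide (a = 1)) = a := by
  revert a; decide

def matBits (f : ℕ → Bool) : Mat := Matrix.of fun i j => ofBool (f (4 * i + j))

/-- The matrix whose rows are encoded by the four binary digits of base `16` of `c`. -/
def mat (c : ℕ) : Mat := matBits c.testBit

def vec (n : ℕ) : Vec := fun j => ofBool (n.testBit j)

theorem matBits_xor (f g : ℕ → Bool) : matBits (fun k => f k ^^ g k) = matBits f - matBits g := by
  ext i j
  simp [matBits, CharTwo.sub_eq_add]

theorem mat_xor (a b : ℕ) : mat (a ^^^ b) = mat a - mat b := by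
  rw [mat, mat, mat, ← matBits_xor]
  congr 1
  funext k
  rw [Nat.testBit_xor]

theorem det_matBits (f : ℕ → Bool) : (matBits f).det = ofBool (detBits f) := by
  rw [Matrix.det_succ_row_zero]
  simp [Fin.sum_univ_succ, Matrix.det_fin_three, matBits, detBits, minorBits, CharTwo.sub_eq_add,
    CharTwo.neg_eq, Fin.succAbove]
  ring

theorem detBits_eq_true {f : ℕ → Bool} : detBits f = true ↔ (matBits f).det ≠ 0 := by
  rw [det_matBits, ofBool_ne_zero]

theorem rowZeroBits_eq_true {f : ℕ → Bool} {x : ℕ} :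
    rowZeroBits f x = true ↔ vec x ᵥ* matBits f = 0 := by
  have key : ∀ j : Fin 4, (vec x ᵥ* matBits f) j = ofBool ((x.testBit 0 && f j) ^^
      ((x.testBit 1 && f (4 + j)) ^^ ((x.testBit 2 && f (8 + j)) ^^
        (x.testBit 3 && f (12 + j))))) := by
    intro j
    simp [Matrix.vecMul, dotProduct, Fin.sum_univ_succ, vec, matBits]
  rw [funext_iff]
  simp only [key, Pi.zero_apply, ofBool_eq_zero]
  simp [rowZeroBits, List.range_succ, Fin.forall_fin_succ]

theorem exists_mat_eq (A : Mat) : ∃ c < 65536, mat c = A := by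
  refine ⟨Nat.ofBits fun k : Fin 16 =>
    decide (A ⟨k / 4, by omega⟩ ⟨k % 4, by omega⟩ = 1), Nat.ofBits_lt_two_pow _, ?_⟩
  ext i j
  have h : 4 * (i : ℕ) + j < 16 := by omega
  simp only [mat, matBits, Matrix.of_apply]
  rw [Nat.testBit_ofBits_lt _ _ h, ofBool_decide]
  congr 1
  · ext; simp; omega
  · ext; simp

theorem testBit_of_mat_eq {a b : ℕ} (h : mat a = mat b) : ∀ k < 16, a.testBit k = b.testBit k := by
  intro k hk
  have := congrFun (congrFun h ⟨k / 4, by omega⟩) ⟨k % 4, by omega⟩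
  simp only [mat, matBits, Matrix.of_apply] at this
  have h4 : 4 * (k / 4) + k % 4 = k := Nat.div_add_mod k 4
  rw [h4] at this
  exact ofBool_injective this

theorem mat_injective {a b : ℕ} (ha : a < 65536) (hb : b < 65536) (h : mat a = mat b) : a = b :=
  lt_of_testBit_iff ha hb (testBit_of_mat_eq h)

theorem exists_vec_eq (v : Vec) : ∃ n < 16, vec n = v := by
  refine ⟨Nat.ofBits fun k : Fin 4 => decide (v k = 1), Nat.ofBits_lt_two_pow _, ?_⟩
  ext j
  simp only [vec]
  rw [Nat.testBit_ofBits_lt _ _ j.2, ofBool_decide]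

theorem vec_injective {a b : ℕ} (ha : a < 16) (hb : b < 16) (h : vec a = vec b) : a = b := by
  refine Nat.eq_of_testBit_eq fun i => ?_
  by_cases hi : i < 4
  · exact ofBool_injective (congrFun h ⟨i, hi⟩)
  · have : 2 ^ 4 ≤ 2 ^ i := Nat.pow_le_pow_right (by norm_num) (not_lt.1 hi)
    rw [Nat.testBit_lt_two_pow (lt_of_lt_of_le ha this),
      Nat.testBit_lt_two_pow (lt_of_lt_of_le hb this)]

theorem vec_zero : vec 0 = 0 := by
  ext j; simp [vec, ofBool]

theorem mem_nonzeroCodes {n : ℕ} : n ∈ nonzeroCodes ↔ n ≠ 0 ∧ n < 16 := by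
  constructor
  · intro h
    simp only [nonzeroCodes, List.mem_cons, List.not_mem_nil, or_false] at h
    omega
  · rintro ⟨h0, h⟩
    interval_cases n <;> first | contradiction | decide

/-- Transfers uniqueness from vectors to their codes; this works because codes below 16 correspond
bijectively to vectors. -/
theorem existsUnique_rowZeroBits {f : ℕ → Bool} (h : ∃! x : Vec, x ≠ 0 ∧ x ᵥ* matBits f = 0) :
    ∃! x, x ∈ nonzeroCodes ∧ rowZeroBits f x = true := by
  obtain ⟨v, ⟨hv0, hv⟩, hu⟩ := h
  obtain ⟨n, hn, rfl⟩ := exists_vec_eq v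
  refine ⟨n, ⟨mem_nonzeroCodes.2 ⟨?_, hn⟩, rowZeroBits_eq_true.2 hv⟩, ?_⟩
  · rintro rfl
    exact hv0 vec_zero
  · rintro k ⟨hk, hk'⟩
    rw [mem_nonzeroCodes] at hk
    refine vec_injective hk.2 hn (hu _ ⟨fun h0 => hk.1 ?_, rowZeroBits_eq_true.1 hk'⟩)
    exact vec_injective hk.2 (by norm_num) (h0.trans vec_zero.symm)

theorem testBit_row {c i j : ℕ} (hj : j < 4) : (row c i).testBit j = c.testBit (4 * i + j) := by
  have : (15 : ℕ) = 2 ^ 4 - 1 := rfl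
  rw [row, land_eq, shiftRight_eq, Nat.testBit_and, Nat.testBit_shiftRight, this,
    Nat.testBit_two_pow_sub_one]
  simp [hj]

theorem row_lt (c i : ℕ) : row c i < 16 :=
  lt_of_le_of_lt (Nat.and_le_right : _ &&& 15 ≤ 15) (by norm_num)

theorem vecMul_lt (v b : ℕ) : vecMul v b < 16 := by
  have key : ∀ (t : Bool) (x r : ℕ), x < 2 ^ 4 → r < 2 ^ 4 →
      (bif t then Nat.xor x r else r) < 2 ^ 4 := by
    intro t x r hx hr
    cases t
    · exact hr
    · exact Nat.xor_lt_two_pow hx hr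
  exact key _ _ _ (row_lt _ _) (key _ _ _ (row_lt _ _) (key _ _ _ (row_lt _ _)
    (key _ _ _ (row_lt _ _) (by norm_num))))

theorem vec_vecMul (v c : ℕ) : vec (vecMul v c) = vec v ᵥ* mat c := by
  have key : ∀ (b : Bool) (m r j : ℕ) , (bif b then Nat.xor m r else r).testBit j =
      ((b && m.testBit j) ^^ r.testBit j) := by
    intro b m r j; cases b <;> simp
  ext j
  simp only [vec, vecMul, key, bit_eq, testBit_row j.2]
  simp [Matrix.vecMul, dotProduct, Fin.sum_univ_succ, mat, matBits, vec, -Nat.testBit_zero]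

theorem mulCode_eq (a b : ℕ) : mulCode a b = vecMul (row a 0) b + 16 * (vecMul (row a 1) b +
    16 * (vecMul (row a 2) b + 16 * vecMul (row a 3) b)) := rfl

theorem row_mulCode (a b : ℕ) {i : ℕ} (hi : i < 4) : row (mulCode a b) i = vecMul (row a i) b := by
  have h0 := vecMul_lt (row a 0) b
  have h1 := vecMul_lt (row a 1) b
  have h2 := vecMul_lt (row a 2) b
  have h3 := vecMul_lt (row a 3) b
  have h15 : (15 : ℕ) = 2 ^ 4 - 1 := rfl
  rw [row, land_eq, shiftRight_eq, h15, Nat.and_two_pow_sub_one_eq_mod, Nat.shiftRight_eq_div_pow,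
    mulCode_eq]
  interval_cases i <;> simp only [Nat.mul_eq] <;> norm_num <;> omega

theorem mat_row (c : ℕ) (i : Fin 4) : (mat c) i = vec (row c i) := by
  ext j
  simp only [mat, matBits, Matrix.of_apply, vec]
  rw [testBit_row j.2]

theorem mat_mulCode (a b : ℕ) : mat (mulCode a b) = mat a * mat b := by
  ext i j
  rw [mat_row, row_mulCode _ _ i.2, vec_vecMul, ← mat_row]
  rfl

theorem mat_one : mat 0x8421 = 1 := by decide

end SpreadSearch

/-! ### Spread sets and crosses. -/

namespace SpreadSearch

/-- The nonzero members of a spread set of matrices. -/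
structure IsSpread (R : Set Mat) : Prop where
  det_ne : ∀ r ∈ R, r.det ≠ 0
  sub_ne : ∀ r ∈ R, ∀ r' ∈ R, r ≠ r' → (r - r').det ≠ 0
  trans : ∀ x y : Vec, x ≠ 0 → y ≠ 0 → ∃ r ∈ R, x ᵥ* r = y

/-- Models the row and the column of an MRD code through one matrix, translated to the origin with
zero omitted. A row member and a column member are nonadjacent, and the minimum distance makes their
agreement vector unique. -/
structure IsCross (R C : Set Mat) : Prop where
  left : IsSpread R
  right : IsSpread C
  fix : ∀ r ∈ R, ∀ c ∈ C, ∃! x : Vec, x ≠ 0 ∧ x ᵥ* (r - c) = 0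

theorem vecMul_ne_zero {A : Mat} (hA : A.det ≠ 0) {x : Vec} (hx : x ≠ 0) : x ᵥ* A ≠ 0 :=
  fun h => hx (Matrix.eq_zero_of_vecMul_eq_zero hA h)

theorem IsSpread.eq_of_vecMul_eq {R : Set Mat} (h : IsSpread R) {r r' : Mat} (hr : r ∈ R)
    (hr' : r' ∈ R) {x : Vec} (hx : x ≠ 0) (he : x ᵥ* r = x ᵥ* r') : r = r' := by
  by_contra hne
  exact vecMul_ne_zero (h.sub_ne r hr r' hr' hne) hx (by rw [Matrix.vecMul_sub, he, sub_self])

theorem IsSpread.image {R : Set Mat} (h : IsSpread R) {P Q : Mat} (hP : P.det ≠ 0)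
    (hQ : Q.det ≠ 0) : IsSpread ((fun r => P * r * Q) '' R) := by
  have hsub : ∀ r r' : Mat, P * r * Q - P * r' * Q = P * (r - r') * Q := fun r r' => by
    rw [mul_sub, sub_mul]
  refine ⟨?_, ?_, ?_⟩
  · rintro _ ⟨r, hr, rfl⟩
    simp only [Matrix.det_mul]
    exact mul_ne_zero (mul_ne_zero hP (h.det_ne r hr)) hQ
  · rintro _ ⟨r, hr, rfl⟩ _ ⟨r', hr', rfl⟩ hne
    simp only [hsub, Matrix.det_mul]
    exact mul_ne_zero (mul_ne_zero hP (h.sub_ne r hr r' hr' fun h => hne (by rw [h]))) hQ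
  · intro x y hx hy
    have hQ' : IsUnit Q.det := isUnit_iff_ne_zero.2 hQ
    obtain ⟨r, hr, he⟩ := h.trans (x ᵥ* P) (y ᵥ* Q⁻¹) (vecMul_ne_zero hP hx)
      (vecMul_ne_zero (by rw [Matrix.det_nonsing_inv, Ring.inverse_eq_inv']; exact inv_ne_zero hQ) hy)
    refine ⟨_, ⟨r, hr, rfl⟩, ?_⟩
    change x ᵥ* (P * r * Q) = y
    rw [← Matrix.vecMul_vecMul, ← Matrix.vecMul_vecMul, he, Matrix.vecMul_vecMul,
      Matrix.nonsing_inv_mul _ hQ', Matrix.vecMul_one]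

/-- Invertible factors on both sides move the unique kernel vector by `P⁻¹`; this is the freedom
used in all normalisations below. -/
theorem IsCross.image {R C : Set Mat} (h : IsCross R C) {P Q : Mat} (hP : P.det ≠ 0)
    (hQ : Q.det ≠ 0) :
    IsCross ((fun r => P * r * Q) '' R) ((fun r => P * r * Q) '' C) := by
  refine ⟨h.left.image hP hQ, h.right.image hP hQ, ?_⟩
  rintro _ ⟨r, hr, rfl⟩ _ ⟨c, hc, rfl⟩
  obtain ⟨x, ⟨hx0, hx⟩, hu⟩ := h.fix r hr c hc
  have hP' : IsUnit P.det := isUnit_iff_ne_zero.2 hP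
  have hPi : (P⁻¹).det ≠ 0 := by
    rw [Matrix.det_nonsing_inv, Ring.inverse_eq_inv']; exact inv_ne_zero hP
  have hsub : P * r * Q - P * c * Q = P * (r - c) * Q := by rw [mul_sub, sub_mul]
  refine ⟨x ᵥ* P⁻¹, ⟨vecMul_ne_zero hPi hx0, ?_⟩, ?_⟩
  · simp only [hsub]
    rw [← Matrix.vecMul_vecMul, ← Matrix.vecMul_vecMul, Matrix.vecMul_vecMul x,
      Matrix.nonsing_inv_mul _ hP', Matrix.vecMul_one, hx, Matrix.zero_vecMul]
  · rintro y ⟨hy0, hy⟩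
    simp only [hsub] at hy
    rw [← Matrix.vecMul_vecMul, ← Matrix.vecMul_vecMul] at hy
    have := hu (y ᵥ* P) ⟨vecMul_ne_zero hP hy0, Matrix.eq_zero_of_vecMul_eq_zero hQ hy⟩
    rw [← this, Matrix.vecMul_vecMul, Matrix.mul_nonsing_inv _ hP', Matrix.vecMul_one]

theorem IsCross.symm {R C : Set Mat} (h : IsCross R C) : IsCross C R := by
  refine ⟨h.right, h.left, fun c hc r hr => ?_⟩
  have : ∀ x : Vec, x ᵥ* (c - r) = 0 ↔ x ᵥ* (r - c) = 0 := fun x => by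
    rw [← neg_sub r c, Matrix.vecMul_neg, neg_eq_zero]
  simpa only [this] using h.fix r hr c hc

theorem IsCross.det_sub {R C : Set Mat} (h : IsCross R C) {r c : Mat} (hr : r ∈ R) (hc : c ∈ C) :
    (r - c).det = 0 := by
  obtain ⟨x, hx, -⟩ := h.fix r hr c hc
  exact Matrix.exists_vecMul_eq_zero_iff.1 ⟨x, hx⟩

def codes (R : Set Mat) (s : ℕ) : Set ℕ := {c | c < 65536 ∧ mat c ∈ R ∧ c ≠ s}

theorem row_three {c : ℕ} (hc : c < 65536) : row c 3 = c / 4096 := by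
  have h15 : (15 : ℕ) = 2 ^ 4 - 1 := rfl
  rw [row, land_eq, shiftRight_eq, h15, Nat.and_two_pow_sub_one_eq_mod,
    Nat.shiftRight_eq_div_pow, Nat.mul_eq]
  norm_num; omega

theorem single_vecMul_mat {c : ℕ} (hc : c < 65536) :
    (Pi.single 3 1 : Vec) ᵥ* mat c = vec (c / 4096) := by
  rw [Matrix.single_one_vecMul, ← row_three hc]
  exact mat_row c 3

theorem single_ne_zero : (Pi.single 3 1 : Vec) ≠ 0 := by decide

theorem IsSpread.exists_code {R : Set Mat} (h : IsSpread R) {y : ℕ} (hy : y ∈ nonzeroCodes) :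
    ∃ c < 65536, mat c ∈ R ∧ c / 4096 = y := by
  rw [mem_nonzeroCodes] at hy
  obtain ⟨r, hr, he⟩ := h.trans (Pi.single 3 1) (vec y) single_ne_zero
    fun h0 => hy.1 (vec_injective hy.2 (by norm_num) (h0.trans vec_zero.symm))
  obtain ⟨c, hc, rfl⟩ := exists_mat_eq r
  refine ⟨c, hc, hr, vec_injective (by omega) hy.2 ?_⟩
  rw [← single_vecMul_mat hc, he]

theorem IsSpread.code_eq {R : Set Mat} (h : IsSpread R) {c d : ℕ} (hc : c < 65536) (hd : d < 65536)
    (hcR : mat c ∈ R) (hdR : mat d ∈ R) (he : c / 4096 = d / 4096) : c = d :=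
  mat_injective hc hd (h.eq_of_vecMul_eq hcR hdR single_ne_zero (by
    rw [single_vecMul_mat hc, single_vecMul_mat hd, he]))

theorem ys_subset {y : ℕ} (hy : y ∈ ys) : y ∈ nonzeroCodes ∧ y ≠ 8 := by
  revert y; decide

theorem detBits_xor {c d : ℕ} : detBits (fun k => c.testBit k ^^ d.testBit k) = true ↔
    (mat c - mat d).det ≠ 0 := by
  rw [detBits_eq_true, matBits_xor]; rfl

theorem IsSpread.adj {R : Set Mat} (h : IsSpread R) {c d : ℕ} (hc : c < 65536) (hd : d < 65536)
    (hcR : mat c ∈ R) (hdR : mat d ∈ R) (hne : c ≠ d) :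
    detBits (fun k => c.testBit k ^^ d.testBit k) = true :=
  detBits_xor.2 (h.sub_ne _ hcR _ hdR fun he => hne (mat_injective hc hd he))

theorem isSystem_codes {R C : Set Mat} (h : IsCross R C) (h1 : 1 ∈ C) {s q : ℕ} (hs : mat s ∈ R)
    (hs0 : s < 65536) (hs8 : s / 4096 = 8)
    (hq : ∀ c < 65536, mat c ∈ R → (typeMask q).testBit c = true) :
    IsSystem (rMask s q) (codes R s) := by
  refine ⟨?_, ?_, ?_⟩
  · rintro c ⟨hc, hcR, hcs⟩
    refine testBit_rMask hc (detBits_eq_true.2 (h.left.det_ne _ hcR)) ?_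
      (h.left.adj hc hs0 hcR hs hcs) (hq c hc hcR)
    refine existsUnique_rowZeroBits ?_
    rw [matBits_xor]
    have := h.fix _ hcR _ h1
    rwa [← mat_one] at this
  · rintro c ⟨hc, hcR, -⟩ d ⟨hd, hdR, -⟩ hne
    exact h.left.adj hc hd hcR hdR hne
  · intro y hy
    obtain ⟨c, hc, hcR, rfl⟩ := h.left.exists_code (ys_subset hy).1
    refine ⟨c, ⟨hc, hcR, ?_⟩, rfl⟩
    rintro rfl
    exact (ys_subset hy).2 hs8

theorem fullCode_two_pow {c : ℕ} (hc : c < 65536) : fullCode (2 ^ c) = c := by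
  have key : ∀ n ≤ 16, (Nat.rec 0 (fun k r => Nat.add r
      (Nat.rec 0 (fun _ _ => Nat.pow 2 k) (Nat.land (2 ^ c) (fullVar k)))) n : ℕ) = c % 2 ^ n := by
    intro n hn
    induction n with
    | zero => simp [Nat.mod_one]
    | succ n ih =>
      have h2 : Nat.land (2 ^ c) (fullVar n) = if c.testBit n then 2 ^ c else 0 := by
        refine Nat.eq_of_testBit_eq fun i => ?_
        rw [land_eq, Nat.testBit_and, Nat.testBit_two_pow]
        by_cases hi : c = i
        · subst hi
          rw [testBit_fullVar hc (by omega)]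
          cases c.testBit n <;> simp
        · cases c.testBit n <;> simp [hi]
      change Nat.add (Nat.rec 0 (fun k r => Nat.add r
        (Nat.rec 0 (fun _ _ => Nat.pow 2 k) (Nat.land (2 ^ c) (fullVar k)))) n)
        (Nat.rec 0 (fun _ _ => Nat.pow 2 n) (Nat.land (2 ^ c) (fullVar n))) = _
      rw [ih (by omega), h2, Nat.mod_pow_succ, Nat.add_eq]
      congr 1
      rw [Nat.testBit_eq_decide_div_mod_eq]
      rcases Nat.mod_two_eq_zero_or_one (c / 2 ^ n) with h | h <;> rw [h]
      · simp
      · obtain ⟨k, hk⟩ := Nat.exists_eq_succ_of_ne_zero (Nat.two_pow_pos c).ne'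
        rw [if_pos (by simp), hk]
        simp
  have := key 16 le_rfl
  rw [Nat.mod_eq_of_lt (by norm_num; omega)] at this
  exact this

/-- Same principle as for `search`, but in the full layout, where position `c` carries the code `c`,
and with a fixed order of last rows. -/
theorem noColumn_eq_false {T : Set ℕ} (hlt : ∀ c ∈ T, c < 65536)
    (hadj : ∀ c ∈ T, ∀ d ∈ T, c ≠ d → detBits (fun k => c.testBit k ^^ d.testBit k) = true)
    (l : List ℕ) (hl : l.Nodup) (hcov : ∀ y ∈ l, ∃ c ∈ T, c / 4096 = y) (S : ℕ)
    (hS : ∀ c ∈ T, c / 4096 ∈ l → S.testBit c = true) : noColumn l S = false := by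
  induction l generalizing S with
  | nil => rfl
  | cons y l ih =>
    rw [List.nodup_cons] at hl
    by_contra hne
    rw [Bool.not_eq_false] at hne
    change allBits (fun b => force (fullCode b) fun c =>
      noColumn l (Nat.land S (detMask fullVar fullMask c))) 4096
      (Nat.land S (Nat.shiftLeft (ones 4096) (Nat.mul 4096 y))) = true at hne
    obtain ⟨c, hc, rfl⟩ := hcov y (by simp)
    have := allBits_sound hne (i := c) (by
      rw [land_eq, shiftLeft_eq, Nat.testBit_and, hS c hc (by simp), Nat.testBit_shiftLeft,
        testBit_ones, Nat.mul_eq]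
      simp; omega)
    rw [force_eq, fullCode_two_pow (hlt c hc)] at this
    rw [ih hl.2 (fun y hy => hcov y (by simp [hy]))] at this
    · exact Bool.false_ne_true this
    · intro d hd hdl
      rw [land_eq, Nat.testBit_and, hS d hd (by simp [hdl]),
        (carries_full (hlt d hd)).testBit_detMask, hadj d hd c hc]
      · rfl
      · rintro rfl
        exact hl.1 hdl

theorem testBit_singularAll {c m : ℕ} (hc : c < 65536) (hm : m.testBit c = true) (l : List ℕ)
    (hl : ∀ d ∈ l, (mat c - mat d).det = 0) : (singularAll m l).testBit c = true := by
  induction l with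
  | nil => exact hm
  | cons d l ih =>
    change (Nat.land (singularAll m l) (Nat.xor fullMask (detMask fullVar fullMask d))).testBit c
      = true
    rw [land_eq, xor_eq, Nat.testBit_and, Nat.testBit_xor, ih fun d hd => hl d (by simp [hd]),
      testBit_fullMask hc, (carries_full hc).testBit_detMask]
    have : detBits (fun k => c.testBit k ^^ d.testBit k) = false := by
      by_contra h
      rw [Bool.not_eq_false, detBits_xor] at h
      exact h (hl d (by simp))
    simp [this]

theorem columnLeaf_eq_false {R C : Set Mat} (h : IsCross R C) (h1 : 1 ∈ C) {s : ℕ} (hs : mat s ∈ R)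
    {l : List ℕ} (hl : ∀ a ∈ l, a ∈ codes R s) : columnLeaf s l = false := by
  refine noColumn_eq_false (T := codes C 0x8421) (fun c hc => hc.1)
    (fun c hc d hd hne => h.right.adj hc.1 hd.1 hc.2.1 hd.2.1 hne) _ (by decide) ?_ _ ?_
  · intro y hy
    obtain ⟨c, hc, hcC, rfl⟩ := h.right.exists_code (ys_subset hy).1
    refine ⟨c, ⟨hc, hcC, ?_⟩, rfl⟩
    rintro rfl
    exact (ys_subset hy).2 (by norm_num)
  · rintro c ⟨hc, hcC, hc1⟩ -
    refine testBit_singularAll hc ?_ _ fun d hd => ?_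
    · refine testBit_cMask hc (detBits_eq_true.2 (h.right.det_ne _ hcC))
        (h.right.adj hc (by norm_num) hcC (mat_one ▸ h1) hc1) (existsUnique_rowZeroBits ?_)
      rw [matBits_xor]
      exact h.symm.fix _ hcC _ hs
    · exact h.symm.det_sub hcC (hl d hd).2.1

/-- The data of a search for a spread set `R` containing `mat s` and a cross `(R, C)` with
`1 ∈ C`, where `τ` restricts the members of `R` and `E` is a further property of `R`. -/
def Config (s : ℕ) (τ : Mat → Prop) (E : Set Mat → Prop) (T : Set ℕ) : Prop :=
  ∃ R C, IsCross R C ∧ 1 ∈ C ∧ mat s ∈ R ∧ (∀ r ∈ R, τ r) ∧ E R ∧ T = codes R s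

theorem Config.lt {s : ℕ} {τ : Mat → Prop} {E : Set Mat → Prop} (T : Set ℕ) (h : Config s τ E T)
    (c : ℕ) (hc : c ∈ T) : c < 65536 := by
  obtain ⟨R, C, -, -, -, -, -, rfl⟩ := h
  exact hc.1

/-- Conjugation by `s` fixes both `1` and `s`, hence preserves the normalisation; the restriction
`τ` has to be a similarity invariant. -/
theorem Config.conj {s s' : ℕ} {τ : Mat → Prop} {E : Set Mat → Prop}
    (hss : mulCode s s' = 0x8421)
    (hτ : ∀ A B D : Mat, A * B = 1 → τ D → τ (B * D * A))
    (hE : ∀ R, E R → E ((fun r => mat s' * r * mat s) '' R)) (T : Set ℕ) (h : Config s τ E T)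
    (c : ℕ) (hc : c < 65536) (hcT : mulCode (mulCode s c) s' ∈ T) :
    ∃ T', Config s τ E T' ∧ c ∈ T' := by
  obtain ⟨R, C, hRC, h1, hs, hR, hER, rfl⟩ := h
  have e1 : mat s * mat s' = 1 := by rw [← mat_mulCode, hss, mat_one]
  have e2 : mat s' * mat s = 1 := mul_eq_one_comm.1 e1
  have d1 : (mat s).det ≠ 0 := fun h0 => by
    have := congrArg Matrix.det e1
    rw [Matrix.det_mul, h0, zero_mul, Matrix.det_one] at this
    exact zero_ne_one this
  have d2 : (mat s').det ≠ 0 := fun h0 => by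
    have := congrArg Matrix.det e2
    rw [Matrix.det_mul, h0, zero_mul, Matrix.det_one] at this
    exact zero_ne_one this
  refine ⟨_, ⟨_, _, hRC.image d2 d1, ⟨1, h1, by simp [e2]⟩, ⟨mat s, hs, by simp [e2]⟩, ?_,
    hE R hER, rfl⟩, hc, ?_, ?_⟩
  · rintro _ ⟨r, hr, rfl⟩
    exact hτ _ _ _ e1 (hR r hr)
  · refine ⟨_, hcT.2.1, ?_⟩
    simp only [mat_mulCode]
    rw [mul_assoc, mul_assoc (mat s * mat c), e2, mul_one, ← mul_assoc, e2, one_mul]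
  · rintro rfl
    refine hcT.2.2 (mat_injective hcT.1 hc ?_)
    rw [mat_mulCode, mat_mulCode, mul_assoc, e1, mul_one]

theorem Config.isSystem {s q : ℕ} {τ : Mat → Prop} {E : Set Mat → Prop} (hs0 : s < 65536)
    (hs8 : s / 4096 = 8) (hq : ∀ c < 65536, τ (mat c) → (typeMask q).testBit c = true)
    (T : Set ℕ) (h : Config s τ E T) : IsSystem (rMask s q) T := by
  obtain ⟨R, C, hRC, h1, hs, hR, -, rfl⟩ := h
  exact isSystem_codes hRC h1 hs hs0 hs8 fun c hc hcR => hq c hc (hR _ hcR)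

theorem Config.columnLeaf {s : ℕ} {τ : Mat → Prop} {E : Set Mat → Prop} (T : Set ℕ)
    (h : Config s τ E T) (l : List ℕ) (hl : ∀ a ∈ l, a ∈ T) : columnLeaf s l = false := by
  obtain ⟨R, C, hRC, h1, hs, -, -, rfl⟩ := h
  exact columnLeaf_eq_false hRC h1 hs hl

/-- The difference set of `R ∪ {0}` at the base point `s`. -/
def shift (R : Set Mat) (s : Mat) : Set Mat := insert (-s) ((fun r => r - s) '' (R \ {s}))

theorem shiftLeaf_eq_false {R C : Set Mat} {s : ℕ} (h : IsCross (shift R (mat s)) C)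
    {l : List ℕ} (hl : ∀ a ∈ l, a ∈ codes R s) (hs0 : s < 65536) : shiftLeaf s l = false := by
  have hmap : ∀ l : List ℕ, (List.rec [] (fun a _ r => Nat.xor a s :: r) l : List ℕ)
      = l.map fun a => a ^^^ s := by
    intro l
    induction l with
    | nil => rfl
    | cons a l ih => rw [List.map_cons, ← ih]; rfl
  rw [shiftLeaf, hmap]
  refine noColumn_eq_false (T := {c | c < 65536 ∧ mat c ∈ C}) (fun c hc => hc.1)
    (fun c hc d hd hne => h.right.adj hc.1 hd.1 hc.2 hd.2 hne) _ (by decide) ?_ _ ?_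
  · intro y hy
    obtain ⟨c, hc, hcC, rfl⟩ := h.right.exists_code hy
    exact ⟨c, ⟨hc, hcC⟩, rfl⟩
  · rintro c ⟨hc, hcC⟩ -
    refine testBit_singularAll hc ?_ _ ?_
    · rw [(carries_full hc).testBit_detMask]
      simpa using detBits_eq_true.2 (h.right.det_ne _ hcC)
    · intro d hd
      refine h.symm.det_sub hcC ?_
      rcases List.mem_cons.1 hd with rfl | hd
      · left
        ext i j
        rw [Matrix.neg_apply, CharTwo.neg_eq]
      · obtain ⟨a, ha, rfl⟩ := List.mem_map.1 hd
        right
        refine ⟨mat a, ⟨(hl a ha).2.1, fun he => (hl a ha).2.2 (mat_injective (hl a ha).1 hs0 he)⟩,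
          ?_⟩
        simp only [mat_xor]

end SpreadSearch

/-! ### Similarity types of the members of a row. -/

namespace SpreadSearch

/-- The sum of the principal 2×2 minors is the coefficient of `X^2` in the characteristic
polynomial. Together with the trace it separates the four types. -/
def pminors (A : Mat) : ZMod 2 :=
  (A 0 0 * A 1 1 - A 0 1 * A 1 0) + (A 0 0 * A 2 2 - A 0 2 * A 2 0) +
  ((A 0 0 * A 3 3 - A 0 3 * A 3 0) + (A 1 1 * A 2 2 - A 1 2 * A 2 1)) +
  ((A 1 1 * A 3 3 - A 1 3 * A 3 1) + (A 2 2 * A 3 3 - A 2 3 * A 3 2))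

theorem pminors_mul_comm (A B : Mat) : pminors (A * B) = pminors (B * A) := by
  simp only [pminors, Matrix.mul_apply, Fin.sum_univ_four]
  ring

theorem ofBool_traceBits (c : ℕ) : ofBool (traceBits c.testBit) = (mat c).trace := by
  simp only [traceBits, ofBool_xor, Matrix.trace, Fin.sum_univ_four, Matrix.diag_apply, mat,
    matBits, Matrix.of_apply]
  simp [-Nat.testBit_zero]
  ring

theorem ofBool_pminorsBits (c : ℕ) : ofBool (pminorsBits c.testBit) = pminors (mat c) := by
  simp only [pminorsBits, pminorBits, pminors, ofBool_xor, ofBool_and, mat,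
    matBits, Matrix.of_apply, CharTwo.sub_eq_add]
  rfl

/-- The matrix is not of the similarity type of `mat 0x8942`. -/
def NotTypeSix (A : Mat) : Prop := ¬ (A.trace = 1 ∧ pminors A = 0)

/-- The matrix is of the similarity type of `mat 0x8F42`. -/
def IsTypeFour (A : Mat) : Prop := A.trace = 0 ∧ pminors A = 0

theorem trace_conj {A B : Mat} (h : A * B = 1) (D : Mat) : (B * D * A).trace = D.trace := by
  rw [Matrix.trace_mul_comm, ← mul_assoc, h, one_mul]

theorem pminors_conj {A B : Mat} (h : A * B = 1) (D : Mat) : pminors (B * D * A) = pminors D := by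
  rw [pminors_mul_comm, ← mul_assoc, h, one_mul]

theorem NotTypeSix.conj (A B D : Mat) (h : A * B = 1) (hD : NotTypeSix D) :
    NotTypeSix (B * D * A) := by
  rwa [NotTypeSix, trace_conj h, pminors_conj h]

theorem IsTypeFour.conj (A B D : Mat) (h : A * B = 1) (hD : IsTypeFour D) :
    IsTypeFour (B * D * A) := by
  rwa [IsTypeFour, trace_conj h, pminors_conj h]

theorem testBit_typeMask_of_notTypeSix (c : ℕ) (hc : c < 65536) (h : NotTypeSix (mat c)) :
    (typeMask 1).testBit c = true := by
  rw [NotTypeSix, ← ofBool_traceBits, ← ofBool_pminorsBits, ofBool_eq_zero] at h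
  rw [testBit_typeMask_one hc]
  revert h
  cases traceBits c.testBit <;> cases pminorsBits c.testBit <;> decide

theorem testBit_typeMask_of_isTypeFour (c : ℕ) (hc : c < 65536) (h : IsTypeFour (mat c)) :
    (typeMask 2).testBit c = true := by
  rw [IsTypeFour, ← ofBool_traceBits, ← ofBool_pminorsBits, ofBool_eq_zero, ofBool_eq_zero] at h
  rw [testBit_typeMask_two hc, h.1, h.2]
  rfl

section NormalForm

def anyB (p : ℕ → Bool) (l : List ℕ) : Bool :=
  List.rec false (fun a _ r => bif p a then true else r) l

theorem anyB_iff (p : ℕ → Bool) (l : List ℕ) : anyB p l = true ↔ ∃ a ∈ l, p a = true := by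
  induction l with
  | nil => simp [anyB]
  | cons a l ih =>
    change (bif p a then true else anyB p l) = true ↔ _
    rw [Bool.cond_true_left, Bool.or_eq_true, ih, List.exists_mem_cons_iff]

/-- Each representative sends `e_0 ↦ e_1 ↦ e_2`, fixes `e_3`, and acts modulo `e_3` as the companion
matrix of one of the four cubics with constant term 1. An invertible matrix with a one-dimensional
fixed space is cyclic, because the part of its characteristic polynomial prime to `X + 1` is
squarefree; so the polynomial determines its type. -/
def typeReps : List ℕ := [0x8942, 0x8B42, 0x8D42, 0x8F42]

/-- The rows are `v`, `vt`, `vt²` and a fourth one, solved from the third row of `g t = s g`. Thus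
the first three rows of that equation hold by construction, and only the fourth has to be tested. -/
def cyclicCode (t v s : ℕ) : ℕ :=
  Nat.add v (Nat.mul 16 (Nat.add (vecMul v t) (Nat.mul 16 (Nat.add (vecMul (vecMul v t) t)
    (Nat.mul 16 (vecMul (row s 2) (Nat.add v (Nat.mul 16 (Nat.add (vecMul v t) (Nat.mul 16
      (Nat.add (vecMul (vecMul v t) t) (Nat.mul 16 (vecMul (vecMul (vecMul v t) t) t)))))))))))))

def isConjugator (t s g : ℕ) : Bool :=
  bif Nat.beq (vecMul (row g 3) t) (row g 3) then
    bif Nat.beq (mulCode g t) (mulCode s g) then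
      allB (fun x => bif Nat.beq (vecMul x g) 0 then false else true) nonzeroCodes
    else false
  else false

def hasNormalForm (t : ℕ) : Bool :=
  anyB (fun v => anyB (fun s => force (cyclicCode t v s) fun g => isConjugator t s g) typeReps)
    nonzeroCodes

/-- The shift `32768 = 8 · 4096` selects the matrices with last row `e_3`, that is, those that fix
`e_3`. -/
def allNormalForm : Bool :=
  allBits (fun b => force (fullCode b) fun t => hasNormalForm t) 4096
    (Nat.land (Nat.land (detMask fullVar fullMask 0) (oneMask fullVar fullMask 0x8421))
      (Nat.shiftLeft (ones 4096) 32768))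

set_option maxRecDepth 100000 in
theorem allNormalForm_eq_true : allNormalForm = true := by decide +kernel

theorem exists_conjugator {t : ℕ} (ht : t < 65536) (h8 : t / 4096 = 8) (hdet : (mat t).det ≠ 0)
    (hfix : ∃! x : Vec, x ≠ 0 ∧ x ᵥ* (mat t - 1) = 0) :
    ∃ P : Mat, P.det ≠ 0 ∧ ∃ s ∈ typeReps, P * mat t = mat s * P := by
  have h := allBits_sound allNormalForm_eq_true (i := t) (by
    rw [land_eq, land_eq, shiftLeft_eq, Nat.testBit_and, Nat.testBit_and, Nat.testBit_shiftLeft,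
      testBit_ones, (carries_full ht).testBit_detMask, (carries_full ht).testBit_oneMask]
    · simp only [Nat.zero_testBit, Bool.xor_false, Bool.and_true, Bool.and_eq_true]
      refine ⟨detBits_eq_true.2 hdet, ?_⟩
      simp only [decide_eq_true_eq]
      omega
    · refine existsUnique_rowZeroBits ?_
      rw [matBits_xor]
      rwa [← mat_one] at hfix)
  rw [force_eq, fullCode_two_pow ht, hasNormalForm, anyB_iff] at h
  obtain ⟨v, -, h⟩ := h
  rw [anyB_iff] at h
  obtain ⟨s, hs, h⟩ := h
  rw [force_eq, isConjugator, Bool.cond_false_right, Bool.cond_false_right, Bool.and_eq_true,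
    Bool.and_eq_true, Nat.beq_eq, Nat.beq_eq, allB_eq] at h
  generalize cyclicCode t v s = g at h
  refine ⟨mat g, fun h0 => ?_, s, hs, ?_⟩
  · obtain ⟨x, hx0, hx⟩ := Matrix.exists_vecMul_eq_zero_iff.2 h0
    obtain ⟨n, hn, rfl⟩ := exists_vec_eq x
    have := List.all_eq_true.1 h.2.2 n (mem_nonzeroCodes.2 ⟨fun h0 => hx0 (h0 ▸ vec_zero), hn⟩)
    rw [← vec_vecMul, ← vec_zero] at hx
    rw [vec_injective (vecMul_lt _ _) (by norm_num) hx] at this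
    exact absurd this (by decide)
  · rw [← mat_mulCode, ← mat_mulCode, h.2.1]

end NormalForm

theorem det_inv_ne {A : Mat} (h : A.det ≠ 0) : A⁻¹.det ≠ 0 := by
  rw [Matrix.det_nonsing_inv, Ring.inverse_eq_inv']; exact inv_ne_zero h

theorem mul_inv_self {A : Mat} (h : A.det ≠ 0) : A * A⁻¹ = 1 :=
  Matrix.mul_nonsing_inv _ (isUnit_iff_ne_zero.2 h)

theorem inv_mul_self {A : Mat} (h : A.det ≠ 0) : A⁻¹ * A = 1 :=
  Matrix.nonsing_inv_mul _ (isUnit_iff_ne_zero.2 h)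

/-- The spread set itself contains some `g` that takes `e_3` to the fixed vector of `t`. Then `g t
g⁻¹` fixes `e_3` and falls under the evaluated list of normal forms. -/
theorem IsCross.exists_conj {R C : Set Mat} (h : IsCross R C) (h1 : 1 ∈ C) {t : Mat} (ht : t ∈ R) :
    ∃ P : Mat, P.det ≠ 0 ∧ ∃ s ∈ typeReps, P * t * P⁻¹ = mat s := by
  obtain ⟨x, ⟨hx0, hx⟩, hu⟩ := h.fix t ht 1 h1
  obtain ⟨g, hg, hgx⟩ := h.left.trans _ x single_ne_zero hx0
  have hgd := h.left.det_ne g hg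
  have hR' := h.image hgd (det_inv_ne hgd)
  obtain ⟨c, hc, hct⟩ := exists_mat_eq (g * t * g⁻¹)
  have hcR : mat c ∈ (fun r => g * r * g⁻¹) '' R := ⟨t, ht, hct.symm⟩
  have h8 : c / 4096 = 8 := by
    refine vec_injective (by omega) (by norm_num) ?_
    rw [← single_vecMul_mat hc, hct, ← Matrix.vecMul_vecMul, ← Matrix.vecMul_vecMul, hgx]
    have : x ᵥ* t = x := by
      rw [Matrix.vecMul_sub, Matrix.vecMul_one, sub_eq_zero] at hx; exact hx
    rw [this, ← hgx, Matrix.vecMul_vecMul, mul_inv_self hgd, Matrix.vecMul_one]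
    decide
  obtain ⟨P, hP, s, hs, hPs⟩ := exists_conjugator hc h8 (hR'.left.det_ne _ hcR) (by
    have := hR'.fix _ hcR 1 ⟨1, h1, by simp [mul_inv_self hgd]⟩
    exact this)
  have hPg : (P * g).det ≠ 0 := by rw [Matrix.det_mul]; exact mul_ne_zero hP hgd
  refine ⟨P * g, hPg, s, hs, ?_⟩
  rw [hct] at hPs
  calc P * g * t * (P * g)⁻¹ = P * (g * t * g⁻¹) * P⁻¹ := by
        rw [Matrix.mul_inv_rev]; simp only [mul_assoc]
    _ = mat s := by rw [hPs, mul_assoc, mul_inv_self hP, mul_one]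

theorem IsCross.mul_left {R C : Set Mat} (h : IsCross R C) {P : Mat} (hP : P.det ≠ 0) :
    IsCross ((fun r => P * r) '' R) ((fun r => P * r) '' C) := by
  simpa using h.image hP (Q := 1) (by simp)

end SpreadSearch

/-! ### The evaluations. -/

namespace SpreadSearch

set_option maxRecDepth 100000

theorem layoutOK_six : layoutOK (rMask 0x8942 0) = true := by decide +kernel

theorem removeAll_six : Nat.land (removeAll (rMask 0x8942 0) 0x8942 0x821C reps62 (occupied (rMask 0x8942 0))) (block 3) = 0 := by
  decide +kernel

/-- The list `reps62` is cut into segments of lengths 14, 14, 16, 20 and 48. For this type every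
leaf is refuted by the absence of a column. -/
theorem searchAll_six_0 : searchAll (rMask 0x8942 0) 0x8942 0x821C (columnLeaf 0x8942)
    3 ((reps62.drop 0).take 14) (removeAll (rMask 0x8942 0) 0x8942 0x821C (reps62.take 0)
      (occupied (rMask 0x8942 0))) = true := by decide +kernel

theorem searchAll_six_14 : searchAll (rMask 0x8942 0) 0x8942 0x821C (columnLeaf 0x8942)
    3 ((reps62.drop 14).take 14) (removeAll (rMask 0x8942 0) 0x8942 0x821C (reps62.take 14)
      (occupied (rMask 0x8942 0))) = true := by decide +kernel

theorem searchAll_six_28 : searchAll (rMask 0x8942 0) 0x8942 0x821C (columnLeaf 0x8942)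
    3 ((reps62.drop 28).take 16) (removeAll (rMask 0x8942 0) 0x8942 0x821C (reps62.take 28)
      (occupied (rMask 0x8942 0))) = true := by decide +kernel

theorem searchAll_six_44 : searchAll (rMask 0x8942 0) 0x8942 0x821C (columnLeaf 0x8942)
    3 ((reps62.drop 44).take 20) (removeAll (rMask 0x8942 0) 0x8942 0x821C (reps62.take 44)
      (occupied (rMask 0x8942 0))) = true := by decide +kernel

theorem searchAll_six_64 : searchAll (rMask 0x8942 0) 0x8942 0x821C (columnLeaf 0x8942)
    3 ((reps62.drop 64).take 48) (removeAll (rMask 0x8942 0) 0x8942 0x821C (reps62.take 64)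
      (occupied (rMask 0x8942 0))) = true := by decide +kernel

theorem layoutOK_seven : layoutOK (rMask 0x8B42 1) = true := by decide +kernel

theorem removeAll_seven : Nat.land (removeAll (rMask 0x8B42 1) 0x8B42 0x821D reps7 (occupied (rMask 0x8B42 1))) (block 6) = 0 := by
  decide +kernel

/-- Here the candidates of the type already excluded are absent from the mask. -/
theorem searchAll_seven_0 : searchAll (rMask 0x8B42 1) 0x8B42 0x821D (columnLeaf 0x8B42)
    6 ((reps7.drop 0).take 40) (removeAll (rMask 0x8B42 1) 0x8B42 0x821D (reps7.take 0)
      (occupied (rMask 0x8B42 1))) = true := by decide +kernel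

theorem searchAll_seven_40 : searchAll (rMask 0x8B42 1) 0x8B42 0x821D (columnLeaf 0x8B42)
    6 ((reps7.drop 40).take 45) (removeAll (rMask 0x8B42 1) 0x8B42 0x821D (reps7.take 40)
      (occupied (rMask 0x8B42 1))) = true := by decide +kernel

theorem searchAll_seven_85 : searchAll (rMask 0x8B42 1) 0x8B42 0x821D (columnLeaf 0x8B42)
    6 ((reps7.drop 85).take 85) (removeAll (rMask 0x8B42 1) 0x8B42 0x821D (reps7.take 85)
      (occupied (rMask 0x8B42 1))) = true := by decide +kernel

theorem layoutOK_four : layoutOK (rMask 0x8F42 2) = true := by decide +kernel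

theorem removeAll_four : Nat.land (removeAll (rMask 0x8F42 2) 0x8F42 0x821F reps42 (occupied (rMask 0x8F42 2))) (block 5) = 0 := by
  decide +kernel

/-- The leaf test differs from the previous ones: rows that come from a field are accepted, and only
the others have to be refuted, at a shifted base point. -/
theorem searchAll_four_0 : searchAll (rMask 0x8F42 2) 0x8F42 0x821F (squareLeaf 0x8F42 0x821F)
    5 ((reps42.drop 0).take 36) (removeAll (rMask 0x8F42 2) 0x8F42 0x821F (reps42.take 0)
      (occupied (rMask 0x8F42 2))) = true := by decide +kernel

end SpreadSearch

/-! ### Every row of a cross with movable base point is a field. -/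

namespace SpreadSearch

theorem lt_reps62 : ∀ c ∈ reps62, c < 65536 := by decide +kernel

theorem lt_reps7 : ∀ c ∈ reps7, c < 65536 := by decide +kernel

theorem lt_reps42 : ∀ c ∈ reps42, c < 65536 := by decide +kernel

theorem forall_take_zero {l : List ℕ} {p : ℕ → Prop} : ∀ c ∈ l.take 0, p c := by simp

theorem not_config_six (T : Set ℕ) :
    ¬ Config 0x8942 (fun _ => True) (fun _ => True) T := by
  have hconj := Config.conj (s := 0x8942) (s' := 0x821C) (τ := fun _ => True) (E := fun _ => True)
    (by decide) (fun _ _ _ _ _ => trivial) (fun _ _ => trivial)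
  have hsys := Config.isSystem (s := 0x8942) (q := 0) (τ := fun _ => True) (E := fun _ => True)
    (by norm_num) (by norm_num) (fun c hc _ => testBit_typeMask_zero hc)
  have step := fun {a b : ℕ} => searchAll_chunk (a := a) (b := b) (y := 3) Config.lt hconj
    layoutOK_six hsys Config.columnLeaf lt_reps62
  have h := step searchAll_six_64 (step searchAll_six_44 (step searchAll_six_28
    (step searchAll_six_14 (step searchAll_six_0 forall_take_zero))))
  exact not_of_search Config.lt hconj layoutOK_six hsys (by decide) lt_reps62 h removeAll_six T

theorem not_config_seven (T : Set ℕ) : ¬ Config 0x8B42 NotTypeSix (fun _ => True) T := by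
  have hconj := Config.conj (s := 0x8B42) (s' := 0x821D) (τ := NotTypeSix) (E := fun _ => True)
    (by decide) NotTypeSix.conj (fun _ _ => trivial)
  have hsys := Config.isSystem (s := 0x8B42) (q := 1) (τ := NotTypeSix) (E := fun _ => True)
    (by norm_num) (by norm_num) testBit_typeMask_of_notTypeSix
  have step := fun {a b : ℕ} => searchAll_chunk (a := a) (b := b) (y := 6) Config.lt hconj
    layoutOK_seven hsys Config.columnLeaf lt_reps7
  have h := step searchAll_seven_85 (step searchAll_seven_40 (step searchAll_seven_0
    forall_take_zero))
  exact not_of_search Config.lt hconj layoutOK_seven hsys (by decide) lt_reps7 h removeAll_seven T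

/-- `R ∪ {0}` is additively closed, and `a⁻¹ R` is commutative. -/
def IsField (R : Set Mat) (a : Mat) : Prop :=
  (∀ r ∈ R, ∀ r' ∈ R, r ≠ r' → r - r' ∈ R) ∧ ∀ r ∈ R, ∀ r' ∈ R, r * a⁻¹ * r' = r' * a⁻¹ * r

theorem image_sub {P Q r r' : Mat} : P * r * Q - P * r' * Q = P * (r - r') * Q := by
  rw [mul_sub, sub_mul]

theorem mul_mul_cancel {P Q r r' : Mat} (hP : P.det ≠ 0) (hQ : Q.det ≠ 0)
    (h : P * r * Q = P * r' * Q) : r = r' := by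
  have := congrArg (fun A => P⁻¹ * A * Q⁻¹) h
  simpa [mul_assoc, mul_inv_self hQ, ← mul_assoc P⁻¹ P, inv_mul_self hP] using this

theorem shift_image (R : Set Mat) (a : Mat) {P Q : Mat} (hP : P.det ≠ 0) (hQ : Q.det ≠ 0) :
    shift ((fun r => P * r * Q) '' R) (P * a * Q) = (fun r => P * r * Q) '' shift R a := by
  ext A
  simp only [shift, Set.mem_insert_iff, Set.mem_image, Set.mem_sdiff, Set.mem_singleton_iff]
  constructor
  · rintro (rfl | ⟨_, ⟨⟨r, hr, rfl⟩, hne⟩, rfl⟩)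
    · exact ⟨-a, Or.inl rfl, by simp⟩
    · exact ⟨r - a, Or.inr ⟨r, ⟨hr, fun h => hne (by rw [h])⟩, rfl⟩, image_sub.symm⟩
  · rintro ⟨_, rfl | ⟨r, ⟨hr, hne⟩, rfl⟩, rfl⟩
    · left; simp
    · exact Or.inr ⟨_, ⟨⟨r, hr, rfl⟩, fun h => hne (mul_mul_cancel hP hQ h)⟩, image_sub⟩

theorem IsField.of_image {R : Set Mat} {a P Q : Mat} (hP : P.det ≠ 0) (hQ : Q.det ≠ 0)
    (h : IsField ((fun r => P * r * Q) '' R) (P * a * Q)) : IsField R a := by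
  refine ⟨fun r hr r' hr' hne => ?_, fun r hr r' hr' => ?_⟩
  · obtain ⟨r'', hr'', he⟩ := h.1 _ ⟨r, hr, rfl⟩ _ ⟨r', hr', rfl⟩
      fun h => hne (mul_mul_cancel hP hQ h)
    rw [image_sub] at he
    rw [← mul_mul_cancel hP hQ he]
    exact hr''
  · have := h.2 _ ⟨r, hr, rfl⟩ _ ⟨r', hr', rfl⟩
    refine mul_mul_cancel hP hQ ?_
    simpa [Matrix.mul_inv_rev, mul_assoc, ← mul_assoc Q Q⁻¹, mul_inv_self hQ,
      ← mul_assoc P⁻¹ P, inv_mul_self hP] using this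

theorem mat_inv_of_mulCode {s s' : ℕ} (h : mulCode s s' = 0x8421) : (mat s)⁻¹ = mat s' :=
  Matrix.inv_eq_right_inv (by rw [← mat_mulCode, h, mat_one])

theorem shiftRight_fold (l : List ℕ) :
    (List.rec [] (fun a _ r => Nat.shiftRight a 12 :: r) l : List ℕ) = l.map fun a => a / 4096 := by
  induction l with
  | nil => rfl
  | cons a l ih =>
    rw [List.map_cons, ← ih, show (4096 : ℕ) = 2 ^ 12 from rfl, ← Nat.shiftRight_eq_div_pow]
    rfl

/-- A member of a spread set is determined by its last row. Since `s :: l` realises all fifteen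
nonzero last rows, it lists all of `R`, and the finite tests speak about `R` itself. -/
theorem isField_of_fieldLeaf {R : Set Mat} (hR : IsSpread R) {s s' : ℕ} (hs : mat s ∈ R)
    (hs0 : s < 65536) (hs8 : s / 4096 = 8) (hss : mulCode s s' = 0x8421) {l : List ℕ}
    (hl : ∀ a ∈ l, a ∈ codes R s) (h : fieldLeaf s s' l = true) : IsField R (mat s) := by
  rw [fieldLeaf, Bool.cond_false_right, Bool.and_eq_true, allB_eq, allB_eq, List.all_eq_true,
    List.all_eq_true, shiftRight_fold] at h
  obtain ⟨hcov, hpair⟩ := h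
  have hmem : ∀ a ∈ s :: l, mat a ∈ R ∧ a < 65536 := by
    intro a ha
    rcases List.mem_cons.1 ha with rfl | ha
    · exact ⟨hs, hs0⟩
    · exact ⟨(hl a ha).2.1, (hl a ha).1⟩
  have hall : ∀ r ∈ R, ∃ a ∈ s :: l, mat a = r := by
    intro r hr
    obtain ⟨c, hc, rfl⟩ := exists_mat_eq r
    have hc0 : c / 4096 ∈ nonzeroCodes := by
      refine mem_nonzeroCodes.2 ⟨fun h0 => ?_, by omega⟩
      refine vecMul_ne_zero (hR.det_ne _ hr) single_ne_zero ?_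
      rw [single_vecMul_mat hc, h0, vec_zero]
    have : c / 4096 ∈ (s :: l).map fun a => a / 4096 := by
      rw [List.map_cons, hs8]
      by_cases h8 : c / 4096 = 8
      · simp [h8]
      · refine List.mem_cons_of_mem _ ((memB_iff _ _).1 (hcov _ ?_))
        revert h8 hc0
        generalize c / 4096 = y
        revert y
        decide
    obtain ⟨a, ha, hac⟩ := List.mem_map.1 this
    exact ⟨a, ha, by rw [hR.code_eq (hmem a ha).2 hc (hmem a ha).1 hr hac]⟩
  have key : ∀ a ∈ s :: l, ∀ b ∈ s :: l, a = b ∨ (mat a - mat b ∈ R ∧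
      mat a * mat s' * mat b = mat b * mat s' * mat a) := by
    intro a ha b hb
    have := hpair a ha
    rw [allB_eq, List.all_eq_true] at this
    have := this b hb
    rw [Bool.cond_true_left, Bool.cond_false_right, Bool.or_eq_true, Bool.and_eq_true, Nat.beq_eq,
      Nat.beq_eq, memB_iff] at this
    refine this.imp id fun h => ⟨?_, ?_⟩
    · rw [← mat_xor]; exact (hmem _ h.1).1
    · rw [← mat_mulCode, ← mat_mulCode, h.2, mat_mulCode, mat_mulCode]
  refine ⟨fun r hr r' hr' hne => ?_, fun r hr r' hr' => ?_⟩
  · obtain ⟨a, ha, rfl⟩ := hall r hr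
    obtain ⟨b, hb, rfl⟩ := hall r' hr'
    rcases key a ha b hb with rfl | h
    · exact absurd rfl hne
    · exact h.1
  · obtain ⟨a, ha, rfl⟩ := hall r hr
    obtain ⟨b, hb, rfl⟩ := hall r' hr'
    rw [mat_inv_of_mulCode hss]
    rcases key a ha b hb with rfl | h
    · rfl
    · exact h.2

/-- Both extra conditions are conjugation invariant because `s` commutes with itself, so the
reduction to orbit representatives remains valid. -/
theorem not_config_four (T : Set ℕ) : ¬ Config 0x8F42 IsTypeFour
    (fun R => (∃ C, IsCross (shift R (mat 0x8F42)) C) ∧ ¬ IsField R (mat 0x8F42)) T := by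
  have hss : mulCode 0x8F42 0x821F = 0x8421 := by decide
  have e1 : mat 0x8F42 * mat 0x821F = 1 := by rw [← mat_mulCode, hss, mat_one]
  have e2 : mat 0x821F * mat 0x8F42 = 1 := mul_eq_one_comm.1 e1
  have d : (mat 0x8F42).det * (mat 0x821F).det = 1 := by
    rw [← Matrix.det_mul, e1, Matrix.det_one]
  have d1 : (mat 0x8F42).det ≠ 0 := left_ne_zero_of_mul_eq_one d
  have d2 : (mat 0x821F).det ≠ 0 := right_ne_zero_of_mul_eq_one d
  have hs : mat 0x821F * mat 0x8F42 * mat 0x8F42 = mat 0x8F42 := by rw [e2, one_mul]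
  have hconj := Config.conj (s := 0x8F42) (s' := 0x821F) (τ := IsTypeFour)
    (E := fun R => (∃ C, IsCross (shift R (mat 0x8F42)) C) ∧ ¬ IsField R (mat 0x8F42))
    hss IsTypeFour.conj (by
      rintro R ⟨⟨C, hC⟩, hF⟩
      refine ⟨?_, fun hF' => hF (IsField.of_image d2 d1 ?_)⟩
      · have := hC.image d2 d1
        rw [← shift_image _ _ d2 d1, hs] at this
        exact ⟨_, this⟩
      · rwa [hs])
  have hsys := Config.isSystem (s := 0x8F42) (q := 2) (τ := IsTypeFour)
    (E := fun R => (∃ C, IsCross (shift R (mat 0x8F42)) C) ∧ ¬ IsField R (mat 0x8F42))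
    (by norm_num) (by norm_num) testBit_typeMask_of_isTypeFour
  have hleaf : ∀ T, Config 0x8F42 IsTypeFour
      (fun R => (∃ C, IsCross (shift R (mat 0x8F42)) C) ∧ ¬ IsField R (mat 0x8F42)) T →
      ∀ l : List ℕ, (∀ a ∈ l, a ∈ T) → squareLeaf 0x8F42 0x821F l = false := by
    rintro _ ⟨R, C, hRC, -, hsR, -, ⟨⟨C', hC'⟩, hF⟩, rfl⟩ l hl
    rw [squareLeaf, shiftLeaf_eq_false hC' hl (by norm_num)]
    cases hf : fieldLeaf 0x8F42 0x821F l
    · rfl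
    · exact absurd (isField_of_fieldLeaf hRC.left hsR (by norm_num) (by norm_num) hss hl hf) hF
  have h := searchAll_chunk (a := 0) Config.lt hconj layoutOK_four hsys hleaf lt_reps42
    searchAll_four_0 forall_take_zero
  exact not_of_search Config.lt hconj layoutOK_four hsys (by decide) lt_reps42 h
    removeAll_four T

theorem IsCross.not_mem_six {R C : Set Mat} (h : IsCross R C) (h1 : 1 ∈ C) : mat 0x8942 ∉ R :=
  fun hs => not_config_six _ ⟨R, C, h, h1, hs, fun _ _ => trivial, trivial, rfl⟩

theorem conj_eq_iff {P A B : Mat} (hP : P.det ≠ 0) (h : P * A * P⁻¹ = B) : A = P⁻¹ * B * P := by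
  rw [← h]
  simp [mul_assoc, inv_mul_self hP, ← mul_assoc P⁻¹ P]

theorem notTypeSix_of {s : ℕ} (hs : traceBits s.testBit = false ∨ pminorsBits s.testBit = true) :
    NotTypeSix (mat s) := by
  rw [NotTypeSix, ← ofBool_traceBits, ← ofBool_pminorsBits]
  rcases hs with h | h <;> rw [h] <;> simp [ofBool]

/-- Any member can be brought to its normal form by conjugating the whole cross, which keeps `1` in
the column; so excluding one representative excludes its similarity type. -/
theorem IsCross.notTypeSix {R C : Set Mat} (h : IsCross R C) (h1 : 1 ∈ C) {r : Mat} (hr : r ∈ R) :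
    NotTypeSix r := by
  obtain ⟨P, hP, s, hs, he⟩ := h.exists_conj h1 hr
  have hcr := h.image hP (det_inv_ne hP)
  have h1' : (1 : Mat) ∈ (fun r => P * r * P⁻¹) '' C := ⟨1, h1, by simp [mul_inv_self hP]⟩
  rw [conj_eq_iff hP he]
  refine NotTypeSix.conj _ _ _ (mul_inv_self hP) ?_
  simp only [typeReps, List.mem_cons, List.not_mem_nil, or_false] at hs
  rcases hs with rfl | rfl | rfl | rfl
  · exact absurd ⟨r, hr, he⟩ (hcr.not_mem_six h1')
  · exact notTypeSix_of (Or.inr (by decide))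
  · exact notTypeSix_of (Or.inl (by decide))
  · exact notTypeSix_of (Or.inl (by decide))

theorem IsCross.not_mem_seven {R C : Set Mat} (h : IsCross R C) (h1 : 1 ∈ C) : mat 0x8B42 ∉ R :=
  fun hs => not_config_seven _ ⟨R, C, h, h1, hs, fun _ hr => h.notTypeSix h1 hr, trivial, rfl⟩

/-- Multiplying by `s⁻¹`, where `s = mat 0x8D42`, and exchanging row and column turns `s` into the
identity of the new column and `1` into the member `s⁻¹` of the new row. Inversion reverses the
characteristic polynomial, so `s⁻¹` has the type of `mat 0x8B42`. -/
theorem IsCross.not_mem_seven' {R C : Set Mat} (h : IsCross R C) (h1 : 1 ∈ C) :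
    mat 0x8D42 ∉ R := by
  intro hs
  have hss : mulCode 0x8D42 0x821E = 0x8421 := by decide
  have hinv : mat 0x821E * mat 0x8D42 = 1 := mul_eq_one_comm.1 (by rw [← mat_mulCode, hss, mat_one])
  have hd : (mat 0x821E).det ≠ 0 := left_ne_zero_of_mul_eq_one (by
    rw [← Matrix.det_mul, hinv, Matrix.det_one])
  -- The permutation matrix that exchanges the coordinates 0 and 2; it conjugates `s⁻¹` into `mat
  -- 0x8B42`.
  have hg : (mat 0x8124).det ≠ 0 := detBits_eq_true.1 (by decide)
  have hcr := (h.symm.mul_left hd).image hg (det_inv_ne hg)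
  refine hcr.not_mem_seven ⟨_, ⟨_, hs, rfl⟩, ?_⟩ ⟨_, ⟨1, h1, rfl⟩, ?_⟩
  · simp only [hinv, mul_one, mul_inv_self hg]
  · have : mat 0x8124 * mat 0x821E = mat 0x8B42 * mat 0x8124 := by
      rw [← mat_mulCode, ← mat_mulCode]; congr 1
    simp only [mul_one, this]
    rw [mul_assoc, mul_inv_self hg, mul_one]

theorem IsCross.exists_conj_four {R C : Set Mat} (h : IsCross R C) (h1 : 1 ∈ C) {r : Mat}
    (hr : r ∈ R) : ∃ P : Mat, P.det ≠ 0 ∧ P * r * P⁻¹ = mat 0x8F42 := by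
  obtain ⟨P, hP, s, hs, he⟩ := h.exists_conj h1 hr
  have hcr := h.image hP (det_inv_ne hP)
  have h1' : (1 : Mat) ∈ (fun r => P * r * P⁻¹) '' C := ⟨1, h1, by simp [mul_inv_self hP]⟩
  simp only [typeReps, List.mem_cons, List.not_mem_nil, or_false] at hs
  rcases hs with rfl | rfl | rfl | rfl
  · exact absurd ⟨r, hr, he⟩ (hcr.not_mem_six h1')
  · exact absurd ⟨r, hr, he⟩ (hcr.not_mem_seven h1')
  · exact absurd ⟨r, hr, he⟩ (hcr.not_mem_seven' h1')
  · exact ⟨P, hP, he⟩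

theorem IsCross.isTypeFour {R C : Set Mat} (h : IsCross R C) (h1 : 1 ∈ C) {r : Mat} (hr : r ∈ R) :
    IsTypeFour r := by
  obtain ⟨P, hP, he⟩ := h.exists_conj_four h1 hr
  rw [conj_eq_iff hP he]
  refine IsTypeFour.conj _ _ _ (mul_inv_self hP) ?_
  rw [IsTypeFour, ← ofBool_traceBits, ← ofBool_pminorsBits]
  decide

/-- The row `R ∪ {0}` of a cross is a field up to equivalence, provided that the base point may be
moved along the row. -/
theorem IsCross.isField {R C : Set Mat} (h : IsCross R C)
    (hb : ∀ r ∈ R, ∃ C', IsCross (shift R r) C') {a : Mat} (ha : a ∈ R) : IsField R a := by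
  -- Any member `c` of the column will do: left multiplication by `c⁻¹` puts `1` into the column.
  obtain ⟨c, hc, -⟩ := h.right.trans _ _ single_ne_zero single_ne_zero
  have hcd := h.right.det_ne c hc
  have h' := h.mul_left (det_inv_ne hcd)
  have h1 : (1 : Mat) ∈ (fun r => c⁻¹ * r) '' C := ⟨c, hc, inv_mul_self hcd⟩
  obtain ⟨P, hP, he⟩ := h'.exists_conj_four h1 ⟨a, ha, rfl⟩
  have hPc : (P * c⁻¹).det ≠ 0 := by rw [Matrix.det_mul]; exact mul_ne_zero hP (det_inv_ne hcd)
  have he' : P * c⁻¹ * a * P⁻¹ = mat 0x8F42 := by rw [← he, ← mul_assoc]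
  refine IsField.of_image hPc (det_inv_ne hP) ?_
  rw [he']
  have hcr := h.image hPc (det_inv_ne hP)
  have h1' : (1 : Mat) ∈ (fun r => P * c⁻¹ * r * P⁻¹) '' C :=
    ⟨c, hc, by simp only [mul_assoc P, inv_mul_self hcd, mul_one, mul_inv_self hP]⟩
  by_contra hF
  refine not_config_four _ ⟨_, _, hcr, h1', ⟨a, ha, he'⟩, fun r hr => hcr.isTypeFour h1' hr,
    ⟨?_, hF⟩, rfl⟩
  obtain ⟨C', hC'⟩ := hb a ha
  rw [← he', shift_image _ _ hPc (det_inv_ne hP)]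
  exact ⟨_, hC'.image hPc (det_inv_ne hP)⟩

end SpreadSearch

/-! ### The graph of invertible differences on an MRD code. -/

namespace SpreadSearch

/-- A set of `256` matrices such that the difference of two distinct members has at most one
nonzero vector in its left kernel. -/
structure IsCode (M : Finset Mat) : Prop where
  card_eq : M.card = 256
  sep : ∀ A ∈ M, ∀ B ∈ M, A ≠ B → ∀ x y : Vec, x ≠ 0 → y ≠ 0 →
    x ᵥ* A = x ᵥ* B → y ᵥ* A = y ᵥ* B → x = y

def Adj (A B : Mat) : Prop := (A - B).det ≠ 0

instance : DecidableRel Adj := fun _ _ => inferInstanceAs (Decidable (_ ≠ _))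

theorem not_adj_iff {A B : Mat} : ¬ Adj A B ↔ ∃ x : Vec, x ≠ 0 ∧ x ᵥ* A = x ᵥ* B := by
  rw [Adj, not_not, ← Matrix.exists_vecMul_eq_zero_iff]
  simp only [Matrix.vecMul_sub, sub_eq_zero]

theorem adj_iff {A B : Mat} : Adj A B ↔ ∀ x : Vec, x ≠ 0 → x ᵥ* A ≠ x ᵥ* B := by
  rw [← not_iff_not, not_adj_iff]; push Not; rfl

theorem Adj.symm {A B : Mat} (h : Adj A B) : Adj B A := by
  rw [adj_iff] at h ⊢
  exact fun x hx he => h x hx he.symm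

theorem Adj.ne {A B : Mat} (h : Adj A B) : A ≠ B := by
  rintro rfl
  exact h (by simp)

theorem card_vec : Fintype.card Vec = 16 := by simp [ZMod.card]

def points : Finset Vec := Finset.univ.erase 0

theorem mem_points {x : Vec} : x ∈ points ↔ x ≠ 0 := by simp [points]

theorem card_points : points.card = 15 := by
  rw [points, Finset.card_erase_of_mem (Finset.mem_univ _), Finset.card_univ, card_vec]

def nbrs (M : Finset Mat) (A : Mat) : Finset Mat := M.filter fun D => Adj D A

theorem mem_nbrs {M : Finset Mat} {A D : Mat} : D ∈ nbrs M A ↔ D ∈ M ∧ Adj D A := by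
  simp [nbrs]

theorem nbrs_subset (M : Finset Mat) (A : Mat) : nbrs M A ⊆ M := Finset.filter_subset _ _

namespace IsCode

variable {M : Finset Mat} (hM : IsCode M)

include hM

/-- The map `D ↦ (xD, yD)` is injective on `M`, and there are as many pairs of vectors as matrices
in `M`. -/
theorem exists_of_pair {x y : Vec} (hx : x ≠ 0) (hy : y ≠ 0) (hxy : x ≠ y) (u v : Vec) :
    ∃ D ∈ M, x ᵥ* D = u ∧ y ᵥ* D = v := by
  have hinj : Set.InjOn (fun D : Mat => (x ᵥ* D, y ᵥ* D)) M := by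
    intro A hA B hB h
    simp only [Prod.mk.injEq] at h
    by_contra hne
    exact hxy (hM.sep A hA B hB hne x y hx hy h.1 h.2)
  have hcard := Finset.card_image_of_injOn hinj
  have huniv : M.image (fun D : Mat => (x ᵥ* D, y ᵥ* D)) = Finset.univ := by
    rw [← Finset.card_eq_iff_eq_univ, hcard, hM.card_eq, Fintype.card_prod, card_vec]
  have := Finset.mem_univ (u, v)
  rw [← huniv, Finset.mem_image] at this
  obtain ⟨D, hD, h⟩ := this
  simp only [Prod.mk.injEq] at h
  exact ⟨D, hD, h⟩

theorem eq_of_pair {x y : Vec} (hx : x ≠ 0) (hy : y ≠ 0) (hxy : x ≠ y) {A B : Mat} (hA : A ∈ M)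
    (hB : B ∈ M) (h1 : x ᵥ* A = x ᵥ* B) (h2 : y ᵥ* A = y ᵥ* B) : A = B := by
  by_contra hne
  exact hxy (hM.sep A hA B hB hne x y hx hy h1 h2)

theorem card_line {x : Vec} (hx : x ≠ 0) (u : Vec) : (M.filter fun D => x ᵥ* D = u).card = 16 := by
  obtain ⟨y, hy⟩ : ∃ y, y ∈ points.erase x := by
    refine Finset.card_pos.1 ?_
    rw [Finset.card_erase_of_mem (mem_points.2 hx), card_points]; norm_num
  rw [Finset.mem_erase, mem_points] at hy
  rw [← card_vec, ← Finset.card_univ]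
  refine Finset.card_nbij' (fun D => y ᵥ* D)
    (fun v => (hM.exists_of_pair hx hy.2 hy.1.symm u v).choose) ?_ ?_ ?_ ?_
  · intro D _; exact Finset.mem_coe.2 (Finset.mem_univ _)
  · intro v _
    have := (hM.exists_of_pair hx hy.2 hy.1.symm u v).choose_spec
    simpa using ⟨this.1, this.2.1⟩
  · intro D hD
    have := (hM.exists_of_pair hx hy.2 hy.1.symm u (y ᵥ* D)).choose_spec
    simp only [Finset.coe_filter, Set.mem_ofPred_eq] at hD
    exact hM.eq_of_pair hx hy.2 hy.1.symm this.1 hD.1 (this.2.1.trans hD.2.symm) this.2.2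
  · intro v _
    exact (hM.exists_of_pair hx hy.2 hy.1.symm u v).choose_spec.2.2

/-- A line that misses `A` contains exactly two neighbours of `A`. -/
theorem card_line_nbrs {A : Mat} (hA : A ∈ M) {x u : Vec} (hx : x ≠ 0) (hu : x ᵥ* A ≠ u) :
    ((nbrs M A).filter fun D => x ᵥ* D = u).card = 2 := by
  -- For each of the 14 nonzero `y ≠ x` exactly one member of the line agrees with `A` at `y`. These
  -- members are distinct and are the non-neighbours, so `16 - 14 = 2` neighbours remain.
  have h14 : ((M.filter fun D => x ᵥ* D = u).filter fun D => ¬ Adj D A).card = 14 := by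
    have h15 : (points.erase x).card = 14 := by
      rw [Finset.card_erase_of_mem (mem_points.2 hx), card_points]
    rw [← h15]
    symm
    have hex : ∀ y ∈ points.erase x, ∃ D ∈ M, x ᵥ* D = u ∧ y ᵥ* D = y ᵥ* A := by
      intro y hy
      rw [Finset.mem_erase, mem_points] at hy
      exact hM.exists_of_pair hx hy.2 hy.1.symm _ _
    choose! f hf using hex
    refine Finset.card_nbij f ?_ ?_ ?_
    · intro y hy
      have hy' := Finset.mem_coe.1 hy
      have := hf y hy'
      simp only [Finset.coe_filter, Finset.mem_filter, Set.mem_ofPred_eq]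
      rw [Finset.mem_erase, mem_points] at hy'
      exact ⟨⟨this.1, this.2.1⟩, not_adj_iff.2 ⟨y, hy'.2, this.2.2⟩⟩
    · intro y hy z hz h
      have hy' := Finset.mem_coe.1 hy
      have hz' := Finset.mem_coe.1 hz
      have h1 := hf y hy'
      have h2 := hf z hz'
      rw [Finset.mem_erase, mem_points] at hy' hz'
      refine hM.sep (f y) h1.1 A hA ?_ y z hy'.2 hz'.2 h1.2.2 (h ▸ h2.2.2)
      intro h0
      exact hu (h0 ▸ h1.2.1)
    · intro D hD
      simp only [Finset.coe_filter, Finset.mem_filter, Set.mem_ofPred_eq] at hD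
      obtain ⟨⟨hDM, hDu⟩, hD⟩ := hD
      obtain ⟨y, hy, hyD⟩ := not_adj_iff.1 hD
      have hyx : y ≠ x := by
        rintro rfl
        exact hu (hyD.symm.trans hDu)
      have hy' : y ∈ points.erase x := Finset.mem_erase.2 ⟨hyx, mem_points.2 hy⟩
      have := hf y hy'
      exact ⟨y, hy', hM.eq_of_pair hx hy hyx.symm this.1 hDM (this.2.1.trans hDu.symm)
        (this.2.2.trans hyD.symm)⟩
  have h16 := hM.card_line hx u
  rw [← Finset.card_filter_add_card_filter_not (fun D => Adj D A), h14] at h16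
  have : (nbrs M A).filter (fun D => x ᵥ* D = u)
      = (M.filter fun D => x ᵥ* D = u).filter fun D => Adj D A := by
    rw [nbrs, Finset.filter_filter, Finset.filter_filter]
    congr 1
    ext D
    exact and_comm
  rw [this]
  omega

/-- Fifteen lines of one parallel class miss `A`, with two neighbours on each. -/
theorem card_nbrs {A : Mat} (hA : A ∈ M) : (nbrs M A).card = 30 := by
  have hx := single_ne_zero
  rw [Finset.card_eq_sum_card_fiberwise (f := fun D => (Pi.single 3 1 : Vec) ᵥ* D)
    (t := Finset.univ.erase ((Pi.single 3 1 : Vec) ᵥ* A))]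
  · rw [Finset.sum_congr rfl fun u hu =>
      hM.card_line_nbrs hA hx (Finset.ne_of_mem_erase hu).symm, Finset.sum_const,
      Finset.card_erase_of_mem (Finset.mem_univ _), Finset.card_univ, card_vec]
    rfl
  · intro D hD
    have hD' := mem_nbrs.1 (Finset.mem_coe.1 hD)
    exact Finset.mem_coe.2 (Finset.mem_erase.2 ⟨adj_iff.1 hD'.2 _ hx, Finset.mem_univ _⟩)

theorem card_agree {A B : Mat} (hA : A ∈ M) (hB : B ∈ M) (hne : A ≠ B) :
    (points.filter fun x => x ᵥ* A = x ᵥ* B).card = if Adj A B then 0 else 1 := by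
  split_ifs with h
  · rw [Finset.card_eq_zero, Finset.filter_eq_empty_iff]
    intro x hx
    exact adj_iff.1 h x (mem_points.1 hx)
  · obtain ⟨x, hx, hxe⟩ := not_adj_iff.1 h
    rw [Finset.card_eq_one]
    refine ⟨x, Finset.eq_singleton_iff_unique_mem.2 ⟨by simp [mem_points, hx, hxe], ?_⟩⟩
    intro y hy
    rw [Finset.mem_filter, mem_points] at hy
    exact hM.sep A hA B hB hne y x hy.1 hx hy.2 hxe

/-- Double counting of pairs `(D, x)` with `xD = xB`: a nonadjacent `D` agrees with `B` at exactly
one point, an adjacent one nowhere. -/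
theorem sum_agree {S : Finset Mat} (hS : S ⊆ M) {B : Mat} (hB : B ∈ M) (hBS : B ∉ S) :
    ∑ x ∈ points, (S.filter fun D => x ᵥ* D = x ᵥ* B).card
      = (S.filter fun D => ¬ Adj D B).card := by
  have := Finset.sum_card_bipartiteAbove_eq_sum_card_bipartiteBelow (s := S) (t := points)
    (fun (D : Mat) (x : Vec) => x ᵥ* D = x ᵥ* B)
  simp only [Finset.bipartiteAbove, Finset.bipartiteBelow] at this
  rw [← this, Finset.card_filter]
  refine Finset.sum_congr rfl fun D hD => ?_
  rw [hM.card_agree (hS hD) hB fun h => hBS (h ▸ hD)]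
  split_ifs <;> simp_all

/-- Each of the 15 lines through `p` misses `A` and therefore carries one neighbour of `A` besides
`p`. -/
theorem card_nonadj {A p : Mat} (hA : A ∈ M) (hp : p ∈ nbrs M A) :
    (((nbrs M A).erase p).filter fun D => ¬ Adj D p).card = 15 := by
  obtain ⟨hpM, hpA⟩ := mem_nbrs.1 hp
  rw [← hM.sum_agree ((Finset.erase_subset _ _).trans (nbrs_subset M A)) hpM
    (Finset.notMem_erase _ _), ← card_points]
  rw [Finset.card_eq_sum_ones]
  refine Finset.sum_congr rfl fun x hx => ?_
  have h2 := hM.card_line_nbrs hA (u := x ᵥ* p) (mem_points.1 hx)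
    (adj_iff.1 hpA x (mem_points.1 hx)).symm
  have hmem : p ∈ (nbrs M A).filter fun D => x ᵥ* D = x ᵥ* p := Finset.mem_filter.2 ⟨hp, rfl⟩
  rw [Finset.filter_erase, Finset.card_erase_of_mem hmem, h2]

theorem card_common {A p : Mat} (hA : A ∈ M) (hp : p ∈ nbrs M A) :
    ((nbrs M A).filter fun D => Adj D p).card = 14 := by
  have h1 := hM.card_nonadj hA hp
  have h2 := Finset.card_filter_add_card_filter_not (s := (nbrs M A).erase p) (fun D => Adj D p)
  rw [h1, Finset.card_erase_of_mem hp, hM.card_nbrs hA, Finset.filter_erase,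
    Finset.erase_eq_of_notMem] at h2
  · omega
  · intro h
    exact (Finset.mem_filter.1 h).2.ne rfl

/-- Of the 15 lines through `q`, one passes through `p` and carries no neighbour of `p`; the other
14 carry two each. So 28 of the 30 neighbours of `p` are not adjacent to `q`. -/
theorem card_common_of_not_adj {p q : Mat} (hp : p ∈ M) (hq : q ∈ M) (hne : p ≠ q)
    (h : ¬ Adj p q) : ((nbrs M p).filter fun D => Adj D q).card = 2 := by
  have hqN : q ∉ nbrs M p := fun hq' => h (mem_nbrs.1 hq').2.symm
  have h1 := hM.sum_agree (nbrs_subset M p) hq hqN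
  obtain ⟨z, hz, hze⟩ := not_adj_iff.1 h
  have h2 : ∑ x ∈ points, ((nbrs M p).filter fun D => x ᵥ* D = x ᵥ* q).card = 28 := by
    rw [← Finset.add_sum_erase _ _ (mem_points.2 hz), Finset.sum_congr rfl
      (g := fun _ => 2)]
    · rw [Finset.sum_const, Finset.card_erase_of_mem (mem_points.2 hz), card_points]
      have : (nbrs M p).filter (fun D => z ᵥ* D = z ᵥ* q) = ∅ := by
        rw [Finset.filter_eq_empty_iff]
        intro D hD hDz
        exact adj_iff.1 (mem_nbrs.1 hD).2 z hz (hDz.trans hze.symm)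
      rw [this]
      rfl
    · intro x hx
      rw [Finset.mem_erase, mem_points] at hx
      refine hM.card_line_nbrs hp hx.2 fun he => hx.1 ?_
      exact hM.sep p hp q hq hne x z hx.2 hz he hze
  have h3 := Finset.card_filter_add_card_filter_not (s := nbrs M p) (fun D => Adj D q)
  have h4 := hM.card_nbrs hp
  change _ = ((nbrs M p).filter fun D => ¬ Adj D q).card at h1
  omega

/-- Three pairwise nonadjacent neighbours of `A` would give three sets of 14 common neighbours with
`A`, inside the 30 neighbours of `A`. Two of these sets share at most one matrix, as `A` is already
one of the two common neighbours; but `42 - 3 > 30`. -/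
theorem adj_of_not_adj {A p q r : Mat} (hA : A ∈ M) (hp : p ∈ nbrs M A) (hq : q ∈ nbrs M A)
    (hr : r ∈ nbrs M A) (hpq : p ≠ q) (hpr : p ≠ r) (hqr : q ≠ r) (h1 : ¬ Adj p q)
    (h2 : ¬ Adj p r) : Adj q r := by
  by_contra h3
  have key : ∀ {p q : Mat}, p ∈ nbrs M A → q ∈ nbrs M A → p ≠ q → ¬ Adj p q →
      (((nbrs M A).filter fun D => Adj D p) ∩ ((nbrs M A).filter fun D => Adj D q)).card ≤ 1 := by
    intro p q hp hq hne h
    obtain ⟨hp, hpA⟩ := mem_nbrs.1 hp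
    obtain ⟨hq, hqA⟩ := mem_nbrs.1 hq
    have hc := hM.card_common_of_not_adj hp hq hne h
    have hAm : A ∈ (nbrs M p).filter fun D => Adj D q :=
      Finset.mem_filter.2 ⟨mem_nbrs.2 ⟨hA, hpA.symm⟩, hqA.symm⟩
    have : ((nbrs M A).filter fun D => Adj D p) ∩ ((nbrs M A).filter fun D => Adj D q) ⊆
        ((nbrs M p).filter fun D => Adj D q).erase A := by
      intro D hD
      simp only [Finset.mem_inter, Finset.mem_filter, mem_nbrs] at hD
      exact Finset.mem_erase.2 ⟨hD.1.1.2.ne,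
        Finset.mem_filter.2 ⟨mem_nbrs.2 ⟨hD.1.1.1, hD.1.2⟩, hD.2.2⟩⟩
    refine (Finset.card_le_card this).trans ?_
    rw [Finset.card_erase_of_mem hAm, hc]
  set X := (nbrs M A).filter fun D => Adj D p with hX
  set Y := (nbrs M A).filter fun D => Adj D q with hY
  set Z := (nbrs M A).filter fun D => Adj D r with hZ
  have hXY : (X ∩ Y).card ≤ 1 := key hp hq hpq h1
  have hXZ : (X ∩ Z).card ≤ 1 := key hp hr hpr h2
  have hYZ : (Y ∩ Z).card ≤ 1 := key hq hr hqr h3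
  have cX : X.card = 14 := hM.card_common hA hp
  have cY : Y.card = 14 := hM.card_common hA hq
  have cZ : Z.card = 14 := hM.card_common hA hr
  have hU : (X ∪ Y ∪ Z).card ≤ 30 := by
    rw [← hM.card_nbrs hA]
    exact Finset.card_le_card (Finset.union_subset (Finset.union_subset (Finset.filter_subset _ _)
      (Finset.filter_subset _ _)) (Finset.filter_subset _ _))
  have e1 := Finset.card_union_add_card_inter X Y
  have e2 := Finset.card_union_add_card_inter (X ∪ Y) Z
  have e3 : ((X ∪ Y) ∩ Z).card ≤ (X ∩ Z).card + (Y ∩ Z).card := by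
    rw [Finset.union_inter_distrib_right]
    exact Finset.card_union_le _ _
  omega

end IsCode

end SpreadSearch

/-! ### Rows and columns of an MRD code. -/

namespace SpreadSearch

/-- A clique of size `16` in the graph `Adj` on the code `M`. -/
structure IsRow (M R : Finset Mat) : Prop where
  subset : R ⊆ M
  card_eq : R.card = 16
  adj : ∀ r ∈ R, ∀ r' ∈ R, r ≠ r' → Adj r r'

/-- The other clique through a point of a row. -/
def col (M R : Finset Mat) (A : Mat) : Finset Mat := insert A (nbrs M A \ R)

def diff (R : Finset Mat) (A : Mat) : Set Mat := (fun D => D - A) '' {D | D ∈ R ∧ D ≠ A}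

/-- For a neighbour `p` of `A`, the 15 neighbours of `A` not adjacent to `p` are mutually adjacent;
with `A` they form the clique through `A` that avoids `p`. -/
theorem IsCode.exists_row {M : Finset Mat} (hM : IsCode M) {A : Mat} (hA : A ∈ M) :
    ∃ R, IsRow M R ∧ A ∈ R := by
  obtain ⟨p, hp⟩ : ∃ p, p ∈ nbrs M A := Finset.card_pos.1 (by rw [hM.card_nbrs hA]; norm_num)
  have hQ : ∀ D, D ∈ ((nbrs M A).erase p).filter (fun D => ¬ Adj D p) ↔
      D ≠ p ∧ D ∈ nbrs M A ∧ ¬ Adj D p := by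
    intro D; rw [Finset.mem_filter, Finset.mem_erase, and_assoc]
  have hAQ : A ∉ ((nbrs M A).erase p).filter (fun D => ¬ Adj D p) := by
    rw [hQ]
    exact fun h => (mem_nbrs.1 h.2.1).2.ne rfl
  refine ⟨insert A (((nbrs M A).erase p).filter fun D => ¬ Adj D p), ⟨?_, ?_, ?_⟩,
    Finset.mem_insert_self _ _⟩
  · intro D hD
    rcases Finset.mem_insert.1 hD with rfl | hD
    · exact hA
    · exact nbrs_subset _ _ ((hQ D).1 hD).2.1
  · rw [Finset.card_insert_of_notMem hAQ, hM.card_nonadj hA hp]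
  · intro r hr r' hr' hne
    rcases Finset.mem_insert.1 hr with rfl | hr
    · rcases Finset.mem_insert.1 hr' with rfl | hr'
      · exact absurd rfl hne
      · exact (mem_nbrs.1 ((hQ _).1 hr').2.1).2.symm
    · rcases Finset.mem_insert.1 hr' with rfl | hr'
      · exact (mem_nbrs.1 ((hQ _).1 hr).2.1).2
      · rw [hQ] at hr hr'
        exact hM.adj_of_not_adj hA hp hr.2.1 hr'.2.1 hr.1.symm hr'.1.symm hne
          (fun h => hr.2.2 h.symm) (fun h => hr'.2.2 h.symm)

namespace IsRow

variable {M R : Finset Mat} (hM : IsCode M) (hR : IsRow M R)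

include hR in
theorem exists_ne (A : Mat) : ∃ p ∈ R, p ≠ A := by
  have : 0 < (R.erase A).card :=
    lt_of_lt_of_le (by rw [hR.card_eq]; norm_num) Finset.pred_card_le_card_erase
  obtain ⟨p, hp⟩ := Finset.card_pos.1 this
  exact ⟨p, Finset.mem_of_mem_erase hp, Finset.ne_of_mem_erase hp⟩

include hR in
theorem mem_nbrs_of_mem {A p : Mat} (hA : A ∈ R) (hp : p ∈ R) (hne : p ≠ A) : p ∈ nbrs M A :=
  mem_nbrs.2 ⟨hR.subset hp, hR.adj p hp A hA hne⟩

include hM hR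

/-- The row already contains 14 common neighbours of `A` and `p`, which is all of them. -/
theorem not_adj_of_mem_sdiff {A p D : Mat} (hA : A ∈ R) (hp : p ∈ R) (hne : p ≠ A)
    (hD : D ∈ nbrs M A \ R) : ¬ Adj D p := by
  rw [Finset.mem_sdiff] at hD
  intro h
  have hsub : (R.erase A).erase p ⊆ (nbrs M A).filter fun D => Adj D p := by
    intro q hq
    rw [Finset.mem_erase, Finset.mem_erase] at hq
    exact Finset.mem_filter.2 ⟨hR.mem_nbrs_of_mem hA hq.2.2 hq.2.1, hR.adj q hq.2.2 p hp hq.1⟩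
  have heq := Finset.eq_of_subset_of_card_le hsub (by
    rw [hM.card_common (hR.subset hA) (hR.mem_nbrs_of_mem hA hp hne),
      Finset.card_erase_of_mem (Finset.mem_erase.2 ⟨hne, hp⟩), Finset.card_erase_of_mem hA,
      hR.card_eq])
  have hDm : D ∈ (nbrs M A).filter fun D => Adj D p := Finset.mem_filter.2 ⟨hD.1, h⟩
  rw [← heq] at hDm
  exact hD.2 (Finset.mem_of_mem_erase (Finset.mem_of_mem_erase hDm))

theorem card_sdiff {A : Mat} (hA : A ∈ R) : (nbrs M A \ R).card = 15 := by
  have hsub : R.erase A ⊆ nbrs M A := fun q hq => by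
    rw [Finset.mem_erase] at hq
    exact hR.mem_nbrs_of_mem hA hq.2 hq.1
  have : nbrs M A \ R = nbrs M A \ R.erase A := by
    ext D
    simp only [Finset.mem_sdiff, Finset.mem_erase, not_and]
    refine and_congr_right fun hD => ⟨fun h _ => h, fun h => h ?_⟩
    exact (mem_nbrs.1 hD).2.ne
  rw [this, Finset.card_sdiff_of_subset hsub, hM.card_nbrs (hR.subset hA),
    Finset.card_erase_of_mem hA, hR.card_eq]

theorem isRow_col {A : Mat} (hA : A ∈ R) : IsRow M (col M R A) := by
  obtain ⟨p, hp, hpA⟩ := hR.exists_ne A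
  have hpN := hR.mem_nbrs_of_mem hA hp hpA
  refine ⟨?_, ?_, ?_⟩
  · exact Finset.insert_subset (hR.subset hA) (Finset.sdiff_subset.trans (nbrs_subset _ _))
  · rw [col, Finset.card_insert_of_notMem, hR.card_sdiff hM hA]
    intro h
    exact (Finset.mem_sdiff.1 h).2 hA
  · intro r hr r' hr' hne
    rcases Finset.mem_insert.1 hr with rfl | hr
    · rcases Finset.mem_insert.1 hr' with rfl | hr'
      · exact absurd rfl hne
      · exact (mem_nbrs.1 (Finset.mem_sdiff.1 hr').1).2.symm
    · rcases Finset.mem_insert.1 hr' with rfl | hr'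
      · exact (mem_nbrs.1 (Finset.mem_sdiff.1 hr).1).2
      · have h1 := hR.not_adj_of_mem_sdiff hM hA hp hpA hr
        have h2 := hR.not_adj_of_mem_sdiff hM hA hp hpA hr'
        rw [Finset.mem_sdiff] at hr hr'
        refine hM.adj_of_not_adj (hR.subset hA) hpN hr.1 hr'.1 ?_ ?_ hne
          (fun h => h1 h.symm) (fun h => h2 h.symm)
        · rintro rfl; exact hr.2 hp
        · rintro rfl; exact hr'.2 hp

-- Fifteen invertible differences send a nonzero `x` injectively to the fifteen nonzero vectors,
-- which gives transitivity.
omit hM in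
theorem isSpread {A : Mat} (hA : A ∈ R) : IsSpread (diff R A) := by
  refine ⟨?_, ?_, ?_⟩
  · rintro _ ⟨D, ⟨hD, hne⟩, rfl⟩
    exact hR.adj D hD A hA hne
  · rintro _ ⟨D, ⟨hD, -⟩, rfl⟩ _ ⟨D', ⟨hD', -⟩, rfl⟩ hne
    simp only [sub_sub_sub_cancel_right]
    exact hR.adj D hD D' hD' fun h => hne (by rw [h])
  · intro x y hx hy
    have hinj : Set.InjOn (fun D : Mat => x ᵥ* (D - A)) (R.erase A : Finset Mat) := by
      intro D hD D' hD' h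
      by_contra hne
      simp only [Matrix.vecMul_sub, sub_left_inj] at h
      exact adj_iff.1 (hR.adj D (Finset.mem_of_mem_erase (Finset.mem_coe.1 hD)) D'
        (Finset.mem_of_mem_erase (Finset.mem_coe.1 hD')) hne) x hx h
    have hsub : (R.erase A).image (fun D : Mat => x ᵥ* (D - A)) ⊆ points := by
      intro v hv
      obtain ⟨D, hD, rfl⟩ := Finset.mem_image.1 hv
      rw [Finset.mem_erase] at hD
      exact mem_points.2 (vecMul_ne_zero (hR.adj D hD.2 A hA hD.1) hx)
    have heq := Finset.eq_of_subset_of_card_le hsub (by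
      rw [Finset.card_image_of_injOn hinj, Finset.card_erase_of_mem hA, hR.card_eq, card_points])
    have hy' := mem_points.2 hy
    rw [← heq, Finset.mem_image] at hy'
    obtain ⟨D, hD, rfl⟩ := hy'
    rw [Finset.mem_erase] at hD
    exact ⟨_, ⟨D, ⟨hD.2, hD.1⟩, rfl⟩, rfl⟩

theorem isCross {A : Mat} (hA : A ∈ R) : IsCross (diff R A) (diff (col M R A) A) := by
  refine ⟨hR.isSpread hA, (hR.isRow_col hM hA).isSpread (Finset.mem_insert_self _ _), ?_⟩
  rintro _ ⟨D, ⟨hD, hDA⟩, rfl⟩ _ ⟨D', ⟨hD', hDA'⟩, rfl⟩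
  have hm : D' ∈ nbrs M A \ R := (Finset.mem_insert.1 hD').resolve_left hDA'
  have hn := hR.not_adj_of_mem_sdiff hM hA hD hDA hm
  have hne : D ≠ D' := by rintro rfl; exact (Finset.mem_sdiff.1 hm).2 hD
  obtain ⟨x, hx, hxe⟩ := not_adj_iff.1 hn
  simp only [sub_sub_sub_cancel_right, Matrix.vecMul_sub, sub_eq_zero]
  refine ⟨x, ⟨hx, hxe.symm⟩, fun y hy => ?_⟩
  exact hM.sep D (hR.subset hD) D' (nbrs_subset _ _ (Finset.mem_sdiff.1 hm).1) hne y x hy.1 hx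
    hy.2 hxe.symm

-- Moving the base point along the row is a translation; this supplies the crosses at the other base
-- points that `IsCross.isField` asks for.
omit hM hR in
theorem shift_diff {A B : Mat} (hA : A ∈ R) (hne : B ≠ A) :
    shift (diff R A) (B - A) = diff R B := by
  ext X
  simp only [shift, diff, Set.mem_insert_iff, Set.mem_image, Set.mem_sdiff, Set.mem_singleton_iff,
    Set.mem_ofPred_eq]
  constructor
  · rintro (rfl | ⟨_, ⟨⟨D, ⟨hD, -⟩, rfl⟩, hDB⟩, rfl⟩)
    · exact ⟨A, ⟨hA, hne.symm⟩, by abel⟩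
    · exact ⟨D, ⟨hD, fun h => hDB (by rw [h])⟩, by abel⟩
  · rintro ⟨D, ⟨hD, hDB⟩, rfl⟩
    by_cases h : D = A
    · subst h
      left; abel
    · exact Or.inr ⟨D - A, ⟨⟨D, ⟨hD, h⟩, rfl⟩, fun h => hDB (sub_left_injective h)⟩, by abel⟩

theorem isField {A a : Mat} (hA : A ∈ R) (ha : a ∈ diff R A) : IsField (diff R A) a := by
  refine (hR.isCross hM hA).isField ?_ ha
  rintro _ ⟨B, ⟨hB, hne⟩, rfl⟩
  simp only [shift_diff hA hne]
  exact ⟨_, hR.isCross hM hB⟩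

/-- The columns through the 16 members of the row are disjoint outside the row and contribute 15
matrices each: `16 · 15 = 256 - 16`. -/
theorem existsUnique_adj {D : Mat} (hD : D ∈ M) (hDR : D ∉ R) : ∃! s, s ∈ R ∧ Adj D s := by
  have huniq : ∀ s ∈ R, ∀ s' ∈ R, Adj D s → Adj D s' → s' = s := by
    intro s hs s' hs' h h'
    by_contra hne
    exact hR.not_adj_of_mem_sdiff hM hs hs' hne
      (Finset.mem_sdiff.2 ⟨mem_nbrs.2 ⟨hD, h⟩, hDR⟩) h'
  have hdisj : (R : Set Mat).PairwiseDisjoint fun s => nbrs M s \ R := by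
    intro s hs s' hs' hne
    rw [Function.onFun, Finset.disjoint_left]
    intro D hD hD'
    exact hR.not_adj_of_mem_sdiff hM hs hs' hne.symm hD
      (mem_nbrs.1 (Finset.mem_sdiff.1 hD').1).2
  have hsub : R.biUnion (fun s => nbrs M s \ R) ⊆ M \ R := by
    intro D hD
    obtain ⟨s, hs, hD⟩ := Finset.mem_biUnion.1 hD
    rw [Finset.mem_sdiff] at hD ⊢
    exact ⟨nbrs_subset _ _ hD.1, hD.2⟩
  have heq := Finset.eq_of_subset_of_card_le hsub (by
    rw [Finset.card_sdiff_of_subset hR.subset, hM.card_eq, hR.card_eq,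
      Finset.card_biUnion hdisj, Finset.sum_congr rfl fun s hs => hR.card_sdiff hM hs,
      Finset.sum_const, hR.card_eq]
    norm_num)
  have hmem : D ∈ M \ R := Finset.mem_sdiff.2 ⟨hD, hDR⟩
  rw [← heq, Finset.mem_biUnion] at hmem
  obtain ⟨s, hs, hDs⟩ := hmem
  have hadj := (mem_nbrs.1 (Finset.mem_sdiff.1 hDs).1).2
  exact ⟨s, ⟨hs, hadj⟩, fun s' hs' => huniq s hs s' hs'.1 hadj hs'.2⟩

end IsRow

end SpreadSearch

/-! ### Equivalence of codes, and the field carried by a row. -/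

namespace SpreadSearch

section Transform

theorem mul_sub_mul_sub (P A Q X Y : Mat) : P * (X - A) * Q - P * (Y - A) * Q = P * (X - Y) * Q := by
  rw [image_sub, sub_sub_sub_cancel_right]

variable {P A Q : Mat} (hP : P.det ≠ 0) (hQ : Q.det ≠ 0)

include hP hQ

theorem det_mul_mul_ne_zero {X : Mat} : (P * X * Q).det ≠ 0 ↔ X.det ≠ 0 := by
  rw [Matrix.det_mul, Matrix.det_mul]
  simp [hP, hQ]

theorem affine_injective : Function.Injective fun X : Mat => P * (X - A) * Q := fun _ _ h =>
  sub_left_injective (mul_mul_cancel hP hQ h)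

theorem IsCode.affine {M : Finset Mat} (hM : IsCode M) :
    IsCode (M.image fun X => P * (X - A) * Q) := by
  refine ⟨by rw [Finset.card_image_of_injective _ (affine_injective hP hQ), hM.card_eq], ?_⟩
  intro X hX Y hY hne x y hx hy hxe hye
  obtain ⟨X, hXM, rfl⟩ := Finset.mem_image.1 hX
  obtain ⟨Y, hYM, rfl⟩ := Finset.mem_image.1 hY
  have key : ∀ z : Vec, z ᵥ* (P * (X - A) * Q) = z ᵥ* (P * (Y - A) * Q) →
      (z ᵥ* P) ᵥ* X = (z ᵥ* P) ᵥ* Y := by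
    intro z hz
    rw [← sub_eq_zero, ← Matrix.vecMul_sub, mul_sub_mul_sub, ← Matrix.vecMul_vecMul] at hz
    have h0 : z ᵥ* (P * (X - Y)) = 0 := by
      by_contra h
      exact vecMul_ne_zero hQ h hz
    rwa [← Matrix.vecMul_vecMul, Matrix.vecMul_sub, sub_eq_zero] at h0
  have := hM.sep X hXM Y hYM (by rintro rfl; exact hne rfl) _ _ (vecMul_ne_zero hP hx)
    (vecMul_ne_zero hP hy) (key x hxe) (key y hye)
  rw [← sub_eq_zero, ← Matrix.sub_vecMul] at this
  by_contra hxy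
  exact vecMul_ne_zero hP (sub_ne_zero.2 hxy) this

theorem IsRow.affine {M R : Finset Mat} (hR : IsRow M R) :
    IsRow (M.image fun X => P * (X - A) * Q) (R.image fun X => P * (X - A) * Q) := by
  refine ⟨Finset.image_subset_image hR.subset,
    by rw [Finset.card_image_of_injective _ (affine_injective hP hQ), hR.card_eq], ?_⟩
  intro X hX Y hY hne
  obtain ⟨X, hXM, rfl⟩ := Finset.mem_image.1 hX
  obtain ⟨Y, hYM, rfl⟩ := Finset.mem_image.1 hY
  rw [Adj, mul_sub_mul_sub, det_mul_mul_ne_zero hP hQ]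
  exact hR.adj X hXM Y hYM (by rintro rfl; exact hne rfl)

end Transform

section FieldOfSpread

variable {N : Set Mat} {a : Mat} (hS : IsSpread N) (hF : IsField N a) (ha : a ∈ N)

-- Let `z ∈ N` agree with `r a⁻¹ r'` at `e`. By commutativity both can be moved past `s a⁻¹` for
-- every `s ∈ N`, so they agree at all vectors `e s a⁻¹`, which include every standard basis vector.
include hS hF ha in
theorem IsField.mul_mul_mem {r r' : Mat} (hr : r ∈ N) (hr' : r' ∈ N) : r * a⁻¹ * r' ∈ N := by
  obtain ⟨e, he⟩ : ∃ e : Vec, e ≠ 0 := ⟨_, single_ne_zero⟩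
  have hda := hS.det_ne a ha
  have hne : e ᵥ* (r * a⁻¹ * r') ≠ 0 :=
    vecMul_ne_zero ((det_mul_mul_ne_zero (hS.det_ne r hr) (hS.det_ne r' hr')).2 (det_inv_ne hda)) he
  obtain ⟨z, hz, hze⟩ := hS.trans e _ he hne
  suffices h : z = r * a⁻¹ * r' by rwa [← h]
  refine Matrix.ext_of_single_vecMul fun i => ?_
  obtain ⟨s, hs, hse⟩ := hS.trans e (Pi.single i 1 ᵥ* a) he
    (vecMul_ne_zero hda fun h => by simpa using congrFun h i)
  have hy : (Pi.single i 1 : Vec) = e ᵥ* (s * a⁻¹) := by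
    rw [← Matrix.vecMul_vecMul, hse, Matrix.vecMul_vecMul, mul_inv_self hda, Matrix.vecMul_one]
  rw [hy, Matrix.vecMul_vecMul, Matrix.vecMul_vecMul, hF.2 s hs z hz, Matrix.mul_assoc z,
    ← Matrix.vecMul_vecMul, hze, Matrix.vecMul_vecMul]
  refine congrArg (e ᵥ* ·) ?_
  have h1 := hF.2 s hs r hr
  have h2 := hF.2 s hs r' hr'
  calc r * a⁻¹ * r' * (a⁻¹ * s) = r * a⁻¹ * (r' * a⁻¹ * s) := by simp only [Matrix.mul_assoc]
    _ = (r * a⁻¹ * s) * a⁻¹ * r' := by rw [← h2]; simp only [Matrix.mul_assoc]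
    _ = s * a⁻¹ * (r * a⁻¹ * r') := by rw [← h1]; simp only [Matrix.mul_assoc]

theorem mat_neg (X : Mat) : -X = X := by ext i j; simp [ZModModule.neg_eq_self]

theorem mat_add_self (X : Mat) : X + X = 0 := by
  rw [← sub_neg_eq_add, mat_neg, sub_self]

/-- The matrices `r * a⁻¹` together with zero. -/
def spreadRing : Subring Mat where
  carrier := {X | X = 0 ∨ X * a ∈ N}
  zero_mem' := Or.inl rfl
  one_mem' := Or.inr (by rwa [Matrix.one_mul])
  neg_mem' := fun {X} h => by rwa [mat_neg]
  add_mem' := by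
    rintro X Y (rfl | hX) (rfl | hY)
    · exact Or.inl (add_zero 0)
    · exact Or.inr (by rwa [zero_add])
    · exact Or.inr (by rwa [add_zero])
    · by_cases h : X = Y
      · subst h
        exact Or.inl (mat_add_self X)
      · right
        have := hF.1 _ hX _ hY fun h' => h (by
          have := congrArg (· * a⁻¹) h'
          simpa only [Matrix.mul_assoc, mul_inv_self (hS.det_ne a ha), Matrix.mul_one] using this)
        rwa [← Matrix.sub_mul, sub_eq_add_neg, mat_neg] at this
  mul_mem' := by
    rintro X Y (rfl | hX) hY
    · exact Or.inl (zero_mul _)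
    · rcases hY with rfl | hY
      · exact Or.inl (mul_zero _)
      · right
        have := hF.mul_mul_mem hS ha hX hY
        rwa [Matrix.mul_assoc X, mul_inv_self (hS.det_ne a ha), Matrix.mul_one,
          ← Matrix.mul_assoc] at this

variable {hS hF ha}

theorem det_ne_of_mem_spreadRing {X : Mat} (hX : X ∈ spreadRing hS hF ha) (h0 : X ≠ 0) :
    X.det ≠ 0 := by
  have := hS.det_ne _ (hX.resolve_left h0)
  rw [Matrix.det_mul] at this
  exact left_ne_zero_of_mul this

instance : NoZeroDivisors (spreadRing hS hF ha) where
  eq_zero_or_eq_zero_of_mul_eq_zero := by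
    rintro ⟨X, hX⟩ ⟨Y, hY⟩ h
    by_contra! hne
    have hX0 : X ≠ 0 := fun h => hne.1 (Subtype.ext h)
    have hY0 : Y ≠ 0 := fun h => hne.2 (Subtype.ext h)
    have h' : X * Y = 0 := congrArg Subtype.val h
    have h1 := det_ne_of_mem_spreadRing hX hX0
    have h2 := det_ne_of_mem_spreadRing hY hY0
    have := congrArg Matrix.det h'
    rw [Matrix.det_mul, Matrix.det_zero] at this
    exact mul_ne_zero h1 h2 this

instance : Nontrivial (spreadRing hS hF ha) :=
  ⟨0, 1, fun h => zero_ne_one (congrArg Subtype.val h : (0 : Mat) = 1)⟩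

/-- Evaluation at `e_3` shows that the ring has as many elements as there are vectors, namely 16. -/
theorem bijective_vecMul : Function.Bijective
    fun X : spreadRing hS hF ha => (Pi.single 3 1 : Vec) ᵥ* X.1 := by
  have hda := hS.det_ne a ha
  constructor
  · intro X Y h
    by_contra hne
    refine vecMul_ne_zero (det_ne_of_mem_spreadRing (X - Y).2 fun h => hne ?_) single_ne_zero
      (x := Pi.single 3 1) ?_
    · exact Subtype.ext (sub_eq_zero.1 h)
    · rw [AddSubgroupClass.coe_sub, Matrix.vecMul_sub]
      exact sub_eq_zero.2 h
  · intro y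
    by_cases hy : y = 0
    · exact ⟨0, by simp [hy]⟩
    obtain ⟨s, hs, hse⟩ := hS.trans _ (y ᵥ* a) single_ne_zero (vecMul_ne_zero hda hy)
    refine ⟨⟨s * a⁻¹, Or.inr ?_⟩, ?_⟩
    · rwa [Matrix.mul_assoc, inv_mul_self hda, Matrix.mul_one]
    · simp only [← Matrix.vecMul_vecMul, hse]
      rw [Matrix.vecMul_vecMul, mul_inv_self hda, Matrix.vecMul_one]

/-- A finite domain is a field, and finite fields of equal order are isomorphic. -/
theorem nonempty_ringEquiv {K : Type*} [Field K] [Finite K] (hK : Nat.card K = 16) :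
    Nonempty (K ≃+* spreadRing hS hF ha) := by
  classical
  have := NoZeroDivisors.to_isDomain (spreadRing hS hF ha)
  have hf := Finite.isDomain_to_isField (spreadRing hS hF ha)
  let := Fintype.ofFinite K
  let := Fintype.ofFinite (spreadRing hS hF ha)
  let := hf.toField
  refine ⟨FiniteField.ringEquivOfCardEq ?_⟩
  rw [← Nat.card_eq_fintype_card, hK, Fintype.card_of_bijective bijective_vecMul, card_vec]

end FieldOfSpread

section Matrices

variable {K : Type*} [Field K] [Algebra (ZMod 2) K] (b : Module.Basis (Fin 4) (ZMod 2) K)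

/-- The matrix that represents a linear map on row vectors of coordinates. -/
noncomputable def toMat (f : K →ₗ[ZMod 2] K) : Mat := (LinearMap.toMatrix b b f)ᵀ

variable {b}

theorem vecMul_toMat (f : K →ₗ[ZMod 2] K) (x : K) :
    b.equivFun x ᵥ* toMat b f = b.equivFun (f x) := by
  rw [toMat, Matrix.vecMul_transpose]
  exact LinearMap.toMatrix_mulVec_repr b b f x

theorem eq_of_forall_vecMul {X Y : Mat} (h : ∀ x, b.equivFun x ᵥ* X = b.equivFun x ᵥ* Y) :
    X = Y := by
  refine Matrix.ext_of_single_vecMul fun i => ?_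
  have := h (b.equivFun.symm (Pi.single i 1))
  rwa [LinearEquiv.apply_symm_apply] at this

theorem eq_toMat_iff {X : Mat} {f : K →ₗ[ZMod 2] K} :
    X = toMat b f ↔ ∀ x, b.equivFun x ᵥ* X = b.equivFun (f x) := by
  constructor
  · rintro rfl x
    exact vecMul_toMat f x
  · exact fun h => eq_of_forall_vecMul fun x => by rw [h, vecMul_toMat]

theorem toMat_surjective : Function.Surjective (toMat b) := fun X =>
  ⟨LinearMap.toMatrix b b |>.symm Xᵀ, by simp [toMat]⟩

theorem toMat_injective : Function.Injective (toMat b) := fun _ _ h =>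
  (LinearMap.toMatrix b b).injective (Matrix.transpose_injective h)

theorem toMat_sub (f g : K →ₗ[ZMod 2] K) : toMat b f - toMat b g = toMat b (f - g) := by
  simp [toMat]

variable (b) in
include b in
theorem finite_of_basis : Finite K := Finite.of_equiv _ b.equivFun.symm.toEquiv

variable (b) in
include b in
theorem card_of_basis : Nat.card K = 16 := by
  rw [Nat.card_congr b.equivFun.toEquiv, Nat.card_eq_fintype_card, card_vec]

/-- Up to equivalence, the multiplications of the field form a row of the code. -/
theorem IsCode.exists_normalized (b : Module.Basis (Fin 4) (ZMod 2) K) {M : Finset Mat}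
    (hM : IsCode M) : ∃ P A Q : Mat, P.det ≠ 0 ∧ Q.det ≠ 0 ∧ ∃ R,
      IsRow (M.image fun X => P * (X - A) * Q) R ∧
      ∀ X, X ∈ R ↔ ∃ s : K, X = toMat b (LinearMap.mulLeft (ZMod 2) s) := by
  obtain ⟨A, hA⟩ : M.Nonempty := Finset.card_pos.1 (by rw [hM.card_eq]; norm_num)
  obtain ⟨R, hR, hAR⟩ := hM.exists_row hA
  obtain ⟨p, hp, hpA⟩ := hR.exists_ne A
  have ha : p - A ∈ diff R A := ⟨p, ⟨hp, hpA⟩, rfl⟩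
  set a := p - A with ha_def
  have hS := hR.isSpread hAR
  have hF := hR.isField hM hAR ha
  have hda := hS.det_ne a ha
  have := finite_of_basis b
  obtain ⟨φ⟩ := nonempty_ringEquiv (hS := hS) (hF := hF) (ha := ha) (card_of_basis b)
  -- The bijection `ψ` satisfies `ψ (s x) = ψ x · φ s`. With `P` as its matrix in the basis `b`,
  -- conjugation by `P` turns `φ s` into multiplication by `s`.
  let ψ : K →ₗ[ZMod 2] Vec := AddMonoidHom.toZModLinearMap 2
    { toFun := fun x => (Pi.single 3 1 : Vec) ᵥ* (φ x).1
      map_zero' := by simp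
      map_add' := fun x y => by simp [Matrix.vecMul_add] }
  have hψ : ∀ x, ψ x = (Pi.single 3 1 : Vec) ᵥ* (φ x).1 := fun _ => rfl
  have hψinj : Function.Injective ψ := fun x y h =>
    φ.injective (bijective_vecMul.1 h)
  let P : Mat := Matrix.of fun i => ψ (b i)
  have hPψ : ∀ x, b.equivFun x ᵥ* P = ψ x := by
    intro x
    rw [Matrix.vecMul_eq_sum]
    conv_rhs => rw [← b.sum_equivFun x, map_sum]
    simp only [map_smul]
    rfl
  have hP : P.det ≠ 0 := by
    intro h
    obtain ⟨v, hv, hvP⟩ := Matrix.exists_vecMul_eq_zero_iff.2 h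
    obtain ⟨x, rfl⟩ := b.equivFun.surjective v
    rw [hPψ, ← map_zero ψ] at hvP
    rw [hψinj hvP] at hv
    exact hv (map_zero _)
  have hmul : ∀ s : K, P * (φ s).1 * P⁻¹ = toMat b (LinearMap.mulLeft (ZMod 2) s) := by
    intro s
    rw [eq_toMat_iff]
    intro x
    have h1 : b.equivFun x ᵥ* (P * (φ s).1) = b.equivFun (s * x) ᵥ* P := by
      rw [← Matrix.vecMul_vecMul, hPψ, hPψ, hψ, hψ, Matrix.vecMul_vecMul, mul_comm s, map_mul]
      rfl
    rw [← Matrix.vecMul_vecMul, h1, Matrix.vecMul_vecMul, mul_inv_self hP, Matrix.vecMul_one]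
    rfl
  refine ⟨P, A, a⁻¹ * P⁻¹, hP, by
      rw [Matrix.det_mul]; exact mul_ne_zero (det_inv_ne hda) (det_inv_ne hP), _,
    hR.affine hP (by rw [Matrix.det_mul]; exact mul_ne_zero (det_inv_ne hda) (det_inv_ne hP)), ?_⟩
  intro X
  rw [Finset.mem_image]
  constructor
  · rintro ⟨D, hD, rfl⟩
    have hmem : (D - A) * a⁻¹ ∈ spreadRing hS hF ha := by
      by_cases h : D = A
      · subst h
        left; simp
      · right
        rw [Matrix.mul_assoc, inv_mul_self hda, Matrix.mul_one]
        exact ⟨D, ⟨hD, h⟩, rfl⟩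
    refine ⟨φ.symm ⟨_, hmem⟩, ?_⟩
    rw [← hmul, RingEquiv.apply_symm_apply]
    simp only [Matrix.mul_assoc]
  · rintro ⟨s, rfl⟩
    rw [← hmul]
    rcases (φ s).2 with h | ⟨D, ⟨hD, -⟩, hDe⟩
    · exact ⟨A, hAR, by rw [h]; simp⟩
    · refine ⟨D, hD, ?_⟩
      simp only at hDe
      rw [hDe, Matrix.mul_assoc, Matrix.mul_assoc, Matrix.mul_assoc, ← Matrix.mul_assoc a,
        mul_inv_self hda, Matrix.one_mul]

end Matrices

end SpreadSearch

/-! ### Linearised polynomials over the field with 16 elements. -/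

namespace SpreadSearch

section Linearized

variable {K : Type*} [Field K] [Algebra (ZMod 2) K]

variable (K) in
theorem charP_two : CharP K 2 := charP_of_injective_algebraMap (algebraMap (ZMod 2) K).injective 2

/-- The map `x ↦ c₀ x + c₁ x² + c₂ x⁴ + c₃ x⁸`. -/
def lin (c₀ c₁ c₂ c₃ : K) : K →ₗ[ZMod 2] K :=
  AddMonoidHom.toZModLinearMap 2
    { toFun := fun x => c₀ * x + c₁ * x ^ 2 + c₂ * x ^ 4 + c₃ * x ^ 8
      map_zero' := by simp
      map_add' := fun x y => by
        have := charP_two K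
        have h2 : (x + y) ^ 2 = x ^ 2 + y ^ 2 := CharTwo.add_sq x y
        have h4 : (x + y) ^ 4 = x ^ 4 + y ^ 4 := by
          rw [show 4 = 2 * 2 by rfl, pow_mul, pow_mul, pow_mul, h2, CharTwo.add_sq]
        have h8 : (x + y) ^ 8 = x ^ 8 + y ^ 8 := by
          rw [show 8 = 4 * 2 by rfl, pow_mul, pow_mul, pow_mul, h4, CharTwo.add_sq]
        rw [h2, h4, h8]; ring }

theorem lin_apply (c₀ c₁ c₂ c₃ x : K) :
    lin c₀ c₁ c₂ c₃ x = c₀ * x + c₁ * x ^ 2 + c₂ * x ^ 4 + c₃ * x ^ 8 := rfl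

theorem mulLeft_eq_lin (s : K) : LinearMap.mulLeft (ZMod 2) s = lin s 0 0 0 := by
  ext x; simp [lin_apply]

theorem lin_sub (a₀ a₁ a₂ a₃ c₀ c₁ c₂ c₃ : K) :
    lin a₀ a₁ a₂ a₃ - lin c₀ c₁ c₂ c₃ = lin (a₀ - c₀) (a₁ - c₁) (a₂ - c₂) (a₃ - c₃) := by
  ext x; simp only [lin_apply, LinearMap.sub_apply]; ring

section

variable [Finite K] (hK : Nat.card K = 16) [Fintype Kˣ]

include hK

theorem sum_units_pow (i : ℕ) : ∑ x : Kˣ, (x : K) ^ i = if 15 ∣ i then 1 else 0 := by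
  classical
  have := charP_two K
  let := Fintype.ofFinite K
  have h := FiniteField.sum_pow_units K i
  rw [← Nat.card_eq_fintype_card, hK, CharTwo.neg_eq] at h
  convert h

theorem sum_units_mul_pow (c : K) (i : ℕ) :
    ∑ x : Kˣ, c * (x : K) ^ i = if 15 ∣ i then c else 0 := by
  rw [← Finset.mul_sum, sum_units_pow hK]; split_ifs <;> simp

theorem eq_zero_of_lin_eq_zero {c₀ c₁ c₂ c₃ : K}
    (h : ∀ x : K, lin c₀ c₁ c₂ c₃ x = 0) : c₀ = 0 ∧ c₁ = 0 ∧ c₂ = 0 ∧ c₃ = 0 := by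
  have key : ∀ j, (∑ x : Kˣ, c₀ * (x : K) ^ (j + 1)) + (∑ x : Kˣ, c₁ * (x : K) ^ (j + 2)) +
      (∑ x : Kˣ, c₂ * (x : K) ^ (j + 4)) + (∑ x : Kˣ, c₃ * (x : K) ^ (j + 8)) = 0 := by
    intro j
    simp only [← Finset.sum_add_distrib]
    refine Finset.sum_eq_zero fun x _ => ?_
    have := h x
    rw [lin_apply] at this
    linear_combination (x : K) ^ j * this
  simp only [sum_units_mul_pow hK] at key
  -- These shifts raise the exponents 1, 2, 4, 8 in turn to 15, while no other exponent becomes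
  -- divisible by 15; each power sum isolates one coefficient.
  have h0 := key 14
  have h1 := key 13
  have h2 := key 11
  have h3 := key 7
  norm_num at h0 h1 h2 h3
  exact ⟨h0, h1, h2, h3⟩

/-- A linearised polynomial `L` such that `L(x) / x` takes every nonzero value. -/
theorem coeff_of_surjective {c₀ c₁ c₂ c₃ : K}
    (h : ∀ t : K, t ≠ 0 → ∃ x, x ≠ 0 ∧ lin c₀ c₁ c₂ c₃ x = t * x) :
    c₀ = 0 ∧ c₂ = 0 ∧ c₁ * c₃ = 0 := by
  have := charP_two K
  have h' : ∀ t : Kˣ, ∃ x : Kˣ, c₀ + c₁ * x + c₂ * (x : K) ^ 3 + c₃ * (x : K) ^ 7 = t := by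
    intro t
    obtain ⟨x, hx, he⟩ := h t t.ne_zero
    refine ⟨Units.mk0 x hx, mul_right_cancel₀ hx ?_⟩
    rw [← he, lin_apply, Units.val_mk0]; ring
  choose σ hσ using h'
  -- The value of the quotient determines `t`, so `σ` is injective, hence a permutation of the
  -- units. The quotient therefore has the same power sums as the identity.
  have hσb : Function.Bijective σ := Finite.injective_iff_bijective.1 fun x y hxy => by
    rw [← Units.val_inj, ← hσ x, ← hσ y, hxy]
  have hsum : ∀ k, ∑ x : Kˣ, (c₀ + c₁ * x + c₂ * (x : K) ^ 3 + c₃ * (x : K) ^ 7) ^ k =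
      ∑ x : Kˣ, (x : K) ^ k := fun k =>
    (hσb.sum_comp (fun x : Kˣ => (c₀ + c₁ * x + c₂ * (x : K) ^ 3 + c₃ * (x : K) ^ 7) ^ k)).symm.trans
      (Finset.sum_congr rfl fun x _ => by rw [hσ])
  have h0 : c₀ = 0 := by
    have h1 := hsum 1
    have e : ∀ x : Kˣ, (c₀ + c₁ * x + c₂ * (x : K) ^ 3 + c₃ * (x : K) ^ 7) ^ 1 =
      c₀ * (x : K) ^ 0 + c₁ * (x : K) ^ 1 + c₂ * (x : K) ^ 3 + c₃ * (x : K) ^ 7 := fun x => by ring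
    simp only [e, Finset.sum_add_distrib, sum_units_mul_pow hK, sum_units_pow hK] at h1
    norm_num at h1
    exact h1
  subst h0
  have h2 : c₂ = 0 := by
    -- The fifth power is the fourth power, computed by Frobenius, times the first. Among its
    -- exponents only 15, with coefficient `c₂ ^ 5`, is divisible by 15.
    have h1 := hsum 5
    have e : ∀ x : Kˣ, (0 + c₁ * x + c₂ * (x : K) ^ 3 + c₃ * (x : K) ^ 7) ^ 5 =
        c₁ ^ 4 * c₁ * (x : K) ^ 5 + c₁ ^ 4 * c₂ * (x : K) ^ 7 + c₁ ^ 4 * c₃ * (x : K) ^ 11 +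
        c₂ ^ 4 * c₁ * (x : K) ^ 13 + c₂ ^ 5 * (x : K) ^ 15 + c₂ ^ 4 * c₃ * (x : K) ^ 19 +
        c₃ ^ 4 * c₁ * (x : K) ^ 29 + c₃ ^ 4 * c₂ * (x : K) ^ 31 + c₃ ^ 5 * (x : K) ^ 35 := by
      intro x
      have e4 : (0 + c₁ * x + c₂ * (x : K) ^ 3 + c₃ * (x : K) ^ 7) ^ 4 =
          c₁ ^ 4 * (x : K) ^ 4 + c₂ ^ 4 * (x : K) ^ 12 + c₃ ^ 4 * (x : K) ^ 28 := by
        rw [show 4 = 2 * 2 by rfl, pow_mul, zero_add, CharTwo.add_sq, CharTwo.add_sq,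
          CharTwo.add_sq, CharTwo.add_sq]
        ring
      rw [pow_succ, e4]; ring
    simp only [e, Finset.sum_add_distrib, sum_units_mul_pow hK, sum_units_pow hK] at h1
    norm_num at h1
    exact h1
  subst h2
  refine ⟨rfl, rfl, ?_⟩
  -- In the cube only the term `3 c₁ c₃² x^15` survives summation.
  have h1 := hsum 3
  have e : ∀ x : Kˣ, (0 + c₁ * x + 0 * (x : K) ^ 3 + c₃ * (x : K) ^ 7) ^ 3 =
      c₁ ^ 3 * (x : K) ^ 3 + 3 * c₁ ^ 2 * c₃ * (x : K) ^ 9 + 3 * c₁ * c₃ ^ 2 * (x : K) ^ 15 +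
      c₃ ^ 3 * (x : K) ^ 21 := fun x => by ring
  simp only [e, Finset.sum_add_distrib, sum_units_mul_pow hK, sum_units_pow hK] at h1
  have h3 : (3 : K) = 1 := by
    rw [show (3 : K) = 2 + 1 by norm_num, CharTwo.two_eq_zero, zero_add]
  norm_num [h3] at h1
  rcases h1 with (h1 | h1) | h1
  · exact absurd (h3.symm.trans h1) one_ne_zero
  · rw [h1, zero_mul]
  · rw [h1, mul_zero]

/-- Suitable coefficients give a map with two nonzero roots. -/
theorem exists_two_roots {u : K} (hu : u ≠ 0) : ∃ a c x y : K, a ≠ 0 ∧ c ≠ 0 ∧ x ≠ 0 ∧ y ≠ 0 ∧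
    x ≠ y ∧ lin u a 0 c x = 0 ∧ lin u a 0 c y = 0 := by
  -- If all units had sixth power 1, the power sums of exponents 6 and 0 would agree, but they are 0
  -- and 1.
  have hex : ∃ w : Kˣ, (w : K) ^ 6 ≠ 1 := by
    by_contra! hall
    have h1 := sum_units_pow hK (K := K) 6
    have h2 := sum_units_pow hK (K := K) 0
    simp only [hall] at h1
    simp only [pow_zero] at h2
    rw [h1] at h2
    norm_num at h2
  obtain ⟨w, hw⟩ := hex
  have hcard : (w : K) ^ 15 = 1 := by
    have : Fintype.card Kˣ = 15 := by
      rw [← Nat.card_eq_fintype_card, Nat.card_units, hK]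
    have h := pow_card_eq_one (x := w)
    rw [this] at h
    simpa using congrArg Units.val h
  have hw7 : (w : K) ^ 7 ≠ 1 := by
    intro h
    apply hw
    have : (w : K) ^ 15 = (w ^ 7) ^ 2 * w := by ring
    rw [h, hcard, one_pow, one_mul] at this
    rw [← this, one_pow]
  have hw1 : (w : K) ≠ 1 := fun h => hw (by rw [h, one_pow])
  have hw0 : (w : K) ≠ 0 := w.ne_zero
  have hd : (w : K) ^ 7 - w ≠ 0 := by
    rw [show (w : K) ^ 7 - w = w * (w ^ 6 - 1) by ring]
    exact mul_ne_zero hw0 (sub_ne_zero.2 hw)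
  -- The coefficients solve `u + a + c = 0` and `u + a w + c w^7 = 0`, so that `1` and `w` are roots
  -- of `x (u + a x + c x^7)`.
  refine ⟨-u * (w ^ 7 - 1) / (w ^ 7 - w), u * (w - 1) / (w ^ 7 - w), 1, w,
    div_ne_zero (mul_ne_zero (neg_ne_zero.2 hu) (sub_ne_zero.2 hw7)) hd,
    div_ne_zero (mul_ne_zero hu (sub_ne_zero.2 hw1)) hd, one_ne_zero, hw0, hw1.symm, ?_, ?_⟩
  · rw [lin_apply]; field_simp; ring
  · rw [lin_apply]; field_simp; ring

end

/-- Coefficient quadruples map injectively to linear maps, and both sets have `2^16` elements. -/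
theorem exists_eq_lin (b : Module.Basis (Fin 4) (ZMod 2) K) (f : K →ₗ[ZMod 2] K) :
    ∃ c₀ c₁ c₂ c₃, f = lin c₀ c₁ c₂ c₃ := by
  have := finite_of_basis b
  let := Fintype.ofFinite Kˣ
  have : Finite (K →ₗ[ZMod 2] K) := Finite.of_injective _ (toMat_injective (b := b))
  have hinj : Function.Injective
      fun c : K × K × K × K => lin c.1 c.2.1 c.2.2.1 c.2.2.2 := by
    intro c d h
    have h0 : ∀ x, lin (c.1 - d.1) (c.2.1 - d.2.1) (c.2.2.1 - d.2.2.1) (c.2.2.2 - d.2.2.2) x = 0 := by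
      intro x
      rw [← lin_sub, LinearMap.sub_apply, sub_eq_zero]
      exact LinearMap.congr_fun h x
    obtain ⟨h0, h1, h2, h3⟩ := eq_zero_of_lin_eq_zero (card_of_basis b) h0
    exact Prod.ext (sub_eq_zero.1 h0) (Prod.ext (sub_eq_zero.1 h1)
      (Prod.ext (sub_eq_zero.1 h2) (sub_eq_zero.1 h3)))
  have hbij := hinj.bijective_of_nat_card_le (by
    rw [Nat.card_congr (Equiv.ofBijective _ ⟨toMat_injective (b := b), toMat_surjective⟩)]
    simp only [Nat.card_prod, card_of_basis b]
    simp [Nat.card_eq_fintype_card, Matrix, ZMod.card])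
  obtain ⟨c, hc⟩ := hbij.2 f
  exact ⟨_, _, _, _, hc.symm⟩

theorem lin_inj (b : Module.Basis (Fin 4) (ZMod 2) K) {a₀ a₁ a₂ a₃ c₀ c₁ c₂ c₃ : K}
    (h : toMat b (lin a₀ a₁ a₂ a₃) = toMat b (lin c₀ c₁ c₂ c₃)) :
    a₀ = c₀ ∧ a₁ = c₁ ∧ a₂ = c₂ ∧ a₃ = c₃ := by
  have := finite_of_basis b
  let := Fintype.ofFinite Kˣ
  have h' := toMat_injective h
  rw [← sub_eq_zero, lin_sub] at h'
  obtain ⟨h0, h1, h2, h3⟩ := eq_zero_of_lin_eq_zero (card_of_basis b)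
    fun x => LinearMap.congr_fun h' x
  exact ⟨sub_eq_zero.1 h0, sub_eq_zero.1 h1, sub_eq_zero.1 h2, sub_eq_zero.1 h3⟩

end Linearized

end SpreadSearch

/-! ### The Gabidulin code is the only MRD code up to equivalence. -/

namespace SpreadSearch

section Classification

variable {K : Type*} [Field K] [Algebra (ZMod 2) K] {b : Module.Basis (Fin 4) (ZMod 2) K}
  {M R : Finset Mat} (hM : IsCode M) (hR : IsRow M R)
  (hmul : ∀ X, X ∈ R ↔ ∃ s : K, X = toMat b (LinearMap.mulLeft (ZMod 2) s))

include hmul in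
theorem mem_row (s : K) : toMat b (lin s 0 0 0) ∈ R := (hmul _).2 ⟨s, by rw [mulLeft_eq_lin]⟩

include hM hR hmul

/-- Outside the row, `D` is adjacent to a single multiplication `s`. For each `t ≠ 0` the difference
of `D` and multiplication by `s + t` is singular, so `coeff_of_surjective` applies to `D - s`. -/
theorem exists_lin_of_mem {D : Mat} (hD : D ∈ M) :
    ∃ s a c : K, a * c = 0 ∧ D = toMat b (lin s a 0 c) ∧
      (D ∉ R → Adj D (toMat b (lin s 0 0 0))) := by
  have := finite_of_basis b
  let := Fintype.ofFinite Kˣ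
  by_cases hDR : D ∈ R
  · obtain ⟨s, hs⟩ := (hmul D).1 hDR
    exact ⟨s, 0, 0, mul_zero 0, by rw [hs, mulLeft_eq_lin], fun h => absurd hDR h⟩
  obtain ⟨X, ⟨hX, hadj⟩, huniq⟩ := hR.existsUnique_adj hM hD hDR
  obtain ⟨s, rfl⟩ := (hmul X).1 hX
  rw [mulLeft_eq_lin] at hadj huniq
  obtain ⟨f, rfl⟩ := toMat_surjective (b := b) D
  obtain ⟨c₀, c₁, c₂, c₃, rfl⟩ := exists_eq_lin b f
  obtain ⟨h0, h2, h13⟩ := coeff_of_surjective (card_of_basis b) (c₀ := c₀ - s) (c₁ := c₁)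
    (c₂ := c₂) (c₃ := c₃) (by
      intro t ht
      have hn : ¬ Adj (toMat b (lin c₀ c₁ c₂ c₃)) (toMat b (lin (s + t) 0 0 0)) := by
        intro h
        have := (lin_inj b (huniq _ ⟨mem_row hmul _, h⟩)).1
        simp [ht] at this
      obtain ⟨v, hv, hve⟩ := not_adj_iff.1 hn
      obtain ⟨x, rfl⟩ := b.equivFun.surjective v
      rw [vecMul_toMat, vecMul_toMat, EmbeddingLike.apply_eq_iff_eq] at hve
      refine ⟨x, fun h => hv (by rw [h, map_zero]), ?_⟩
      rw [lin_apply] at hve ⊢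
      rw [lin_apply] at hve
      linear_combination hve)
  rw [sub_eq_zero] at h0
  subst h0 h2
  exact ⟨c₀, c₁, c₃, h13, rfl, fun _ => hadj⟩

theorem exists_lin_of_mem_col {s : K} {D : Mat} (hD : D ∈ col M R (toMat b (lin s 0 0 0))) :
    ∃ a c : K, a * c = 0 ∧ D = toMat b (lin s a 0 c) := by
  rcases Finset.mem_insert.1 hD with rfl | hD
  · exact ⟨0, 0, mul_zero 0, rfl⟩
  rw [Finset.mem_sdiff] at hD
  have hDM := nbrs_subset _ _ hD.1
  obtain ⟨t, a, c, hac, hDe, hadj⟩ := exists_lin_of_mem hM hR hmul hDM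
  have := (hR.existsUnique_adj hM hDM hD.2).unique
    ⟨mem_row hmul s, (mem_nbrs.1 hD.1).2⟩ ⟨mem_row hmul t, hadj hD.2⟩
  obtain rfl := (lin_inj b this).1
  exact ⟨a, c, hac, hDe⟩

/-- A column is closed under differences after translation, by `IsRow.isField`. Nonzero terms `a
x^2` and `c x^8` in one column would produce a member with both coefficients nonzero, contrary to `a
c = 0`; counting then fills the column with one kind. -/
theorem col_eq (s : K) :
    (∀ a, toMat b (lin s a 0 0) ∈ col M R (toMat b (lin s 0 0 0))) ∨
      ∀ c, toMat b (lin s 0 0 c) ∈ col M R (toMat b (lin s 0 0 0)) := by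
  classical
  have := finite_of_basis b
  let := Fintype.ofFinite K
  set A := toMat b (lin s 0 0 0) with hA
  have hrow := hR.isRow_col hM (mem_row hmul s)
  have hAc : A ∈ col M R A := Finset.mem_insert_self _ _
  obtain ⟨p, hp, hpA⟩ := hrow.exists_ne A
  have hadd := (hrow.isField hM hAc ⟨p, ⟨hp, hpA⟩, rfl⟩).1
  have hmix : ∀ a c : K, a ≠ 0 → c ≠ 0 → toMat b (lin s a 0 0) ∈ col M R A →
      toMat b (lin s 0 0 c) ∈ col M R A → False := by
    intro a c ha hc h1 h2
    have hne : ∀ a c a' c' : K, ¬ (a = a' ∧ c = c') →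
        toMat b (lin s a 0 c) ≠ toMat b (lin s a' 0 c') := fun a c a' c' hn h =>
      hn ⟨(lin_inj b h).2.1, (lin_inj b h).2.2.2⟩
    obtain ⟨E, ⟨hE, -⟩, hEe⟩ := hadd _ ⟨_, ⟨h1, hne _ _ _ _ (by simp [ha])⟩, rfl⟩ _
      ⟨_, ⟨h2, hne _ _ _ _ (by simp [hc])⟩, rfl⟩
      (fun h => hne _ _ _ _ (by simp [ha]) (sub_left_injective h))
    obtain ⟨a', c', hac, rfl⟩ := exists_lin_of_mem_col hM hR hmul hE
    simp only [hA, toMat_sub, lin_sub] at hEe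
    obtain ⟨-, h3, -, h4⟩ := lin_inj b hEe
    simp only [sub_zero, zero_sub] at h3 h4
    rw [h3, h4] at hac
    simp [ha, hc] at hac
  have hcardK : Fintype.card K = 16 := by rw [← Nat.card_eq_fintype_card, card_of_basis b]
  have hfin : ∀ f : K → Mat, (∀ D ∈ col M R A, ∃ a, D = f a) → ∀ a, f a ∈ col M R A := by
    intro f hf a
    have hsub : col M R A ⊆ Finset.univ.image f := by
      intro D hD
      obtain ⟨a, rfl⟩ := hf D hD
      exact Finset.mem_image_of_mem _ (Finset.mem_univ _)
    rw [Finset.eq_of_subset_of_card_le hsub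
      (Finset.card_image_le.trans (by rw [Finset.card_univ, hcardK, hrow.card_eq]))]
    exact Finset.mem_image_of_mem _ (Finset.mem_univ _)
  by_cases hex : ∃ a : K, a ≠ 0 ∧ toMat b (lin s a 0 0) ∈ col M R A
  · left
    obtain ⟨a, ha, haC⟩ := hex
    refine hfin (fun a => toMat b (lin s a 0 0)) fun D hD => ?_
    obtain ⟨a', c, hac, rfl⟩ := exists_lin_of_mem_col hM hR hmul hD
    rcases mul_eq_zero.1 hac with rfl | rfl
    · by_cases hc : c = 0
      · exact ⟨0, by rw [hc]⟩
      · exact (hmix a c ha hc haC hD).elim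
    · exact ⟨_, rfl⟩
  · right
    push Not at hex
    refine hfin (fun c => toMat b (lin s 0 0 c)) fun D hD => ?_
    obtain ⟨a, c, hac, rfl⟩ := exists_lin_of_mem_col hM hR hmul hD
    rcases mul_eq_zero.1 hac with rfl | rfl
    · exact ⟨_, rfl⟩
    · by_cases ha : a = 0
      · exact ⟨0, by rw [ha]⟩
      · exact absurd hD (hex a ha)

-- Columns of different kinds would contain two matrices whose difference has two nonzero roots,
-- which the minimum distance forbids.
omit hR hmul in
theorem not_mixed {s t : K} (hst : s ≠ t) (h1 : ∀ a, toMat b (lin s a 0 0) ∈ M)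
    (h2 : ∀ c, toMat b (lin t 0 0 c) ∈ M) : False := by
  have := finite_of_basis b
  let := Fintype.ofFinite Kˣ
  obtain ⟨a, c, x, y, ha, -, hx, hy, hxy, hx0, hy0⟩ :=
    exists_two_roots (card_of_basis b) (sub_ne_zero.2 hst)
  have key : ∀ z, lin (s - t) a 0 c z = 0 →
      b.equivFun z ᵥ* toMat b (lin s a 0 0) = b.equivFun z ᵥ* toMat b (lin t 0 0 (-c)) := by
    intro z hz
    rw [vecMul_toMat, vecMul_toMat]
    congr 1
    rw [← sub_eq_zero, ← LinearMap.sub_apply, lin_sub]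
    simpa using hz
  have := hM.sep _ (h1 a) _ (h2 (-c)) (fun h => ha (lin_inj b h).2.1) _ _
    (fun h => hx (b.equivFun.map_eq_zero_iff.1 h)) (fun h => hy (b.equivFun.map_eq_zero_iff.1 h))
    (key x hx0) (key y hy0)
  exact hxy (b.equivFun.injective this)

omit hR hmul in
theorem mem_iff_of_forall_mem (f : K → K → Mat) (hf : Function.Injective fun p : K × K => f p.1 p.2)
    (b : Module.Basis (Fin 4) (ZMod 2) K) (h : ∀ s a, f s a ∈ M) (X : Mat) :
    X ∈ M ↔ ∃ s a, X = f s a := by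
  classical
  have := finite_of_basis b
  let := Fintype.ofFinite K
  have hcardK : Fintype.card K = 16 := by rw [← Nat.card_eq_fintype_card, card_of_basis b]
  have hsub : (Finset.univ.image fun p : K × K => f p.1 p.2) ⊆ M := by
    intro D hD
    obtain ⟨p, -, rfl⟩ := Finset.mem_image.1 hD
    exact h _ _
  have heq := Finset.eq_of_subset_of_card_le hsub (by
    rw [Finset.card_image_of_injective _ hf, Finset.card_univ, Fintype.card_prod, hcardK,
      hM.card_eq])
  rw [← heq]
  simp [eq_comm]

theorem mem_iff_exists_lin :
    (∀ X, X ∈ M ↔ ∃ s a : K, X = toMat b (lin s a 0 0)) ∨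
      ∀ X, X ∈ M ↔ ∃ s a : K, X = toMat b (lin s 0 0 a) := by
  have hcolM : ∀ s, col M R (toMat b (lin s 0 0 0)) ⊆ M := fun s =>
    (hR.isRow_col hM (mem_row hmul s)).subset
  have hcol := col_eq hM hR hmul
  by_cases h : ∀ s a, toMat b (lin s a 0 0) ∈ M
  · exact Or.inl (mem_iff_of_forall_mem hM (fun s a => toMat b (lin s a 0 0))
      (fun p q h => Prod.ext (lin_inj b h).1 (lin_inj b h).2.1) b h)
  · right
    push Not at h
    obtain ⟨s, a, hsa⟩ := h
    have hs := (hcol s).resolve_left fun h => hsa (hcolM s (h a))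
    refine mem_iff_of_forall_mem hM (fun s a => toMat b (lin s 0 0 a))
      (fun p q h => Prod.ext (lin_inj b h).1 (lin_inj b h).2.2.2) b fun t c => ?_
    by_cases hst : t = s
    · subst hst
      exact hcolM _ (hs c)
    · refine hcolM _ (((hcol t).resolve_left fun ht => ?_) c)
      exact not_mixed hM hst (fun a => hcolM _ (ht a)) fun c => hcolM _ (hs c)

end Classification

section Gabidulin

variable {K : Type*} [Field K] [Algebra (ZMod 2) K] (b : Module.Basis (Fin 4) (ZMod 2) K)

theorem mem_gabidulinCode_iff {X : Mat} :
    X ∈ SubspaceCode.gabidulinCode b 3 ↔ ∃ s a : K, X = toMat b (lin s a 0 0) := by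
  simp only [SubspaceCode.gabidulinCode, Set.mem_ofPred_eq, Nat.card_zmod, eq_toMat_iff, lin_apply]
  constructor
  · rintro ⟨a, ha⟩
    refine ⟨a 0, a 1, fun x => ?_⟩
    rw [ha]
    congr 1
    rw [show (∑ i : Fin (4 - 3 + 1), a i * x ^ 2 ^ (i : ℕ)) = ∑ i : Fin 2, a i * x ^ 2 ^ (i : ℕ)
      from rfl, Fin.sum_univ_two]
    simp
  · rintro ⟨s, a, h⟩
    refine ⟨![s, a], fun x => ?_⟩
    rw [h]
    congr 1
    rw [show (∑ i : Fin (4 - 3 + 1), (![s, a] : Fin 2 → K) i * x ^ 2 ^ (i : ℕ)) =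
      ∑ i : Fin 2, (![s, a] : Fin 2 → K) i * x ^ 2 ^ (i : ℕ) from rfl, Fin.sum_univ_two]
    simp

theorem det_toMat_frobenius_ne_zero : (toMat b (lin 0 1 0 0)).det ≠ 0 := by
  intro h
  obtain ⟨v, hv, hve⟩ := Matrix.exists_vecMul_eq_zero_iff.2 h
  obtain ⟨x, rfl⟩ := b.equivFun.surjective v
  rw [vecMul_toMat, b.equivFun.map_eq_zero_iff, lin_apply] at hve
  refine hv (b.equivFun.map_eq_zero_iff.2 ?_)
  simpa using hve

/-- Since `x^16 = x`, substituting `x^2` into `s x + a x^8` gives `a x + s x^2`. -/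
theorem toMat_frobenius_mul (s a : K) :
    toMat b (lin 0 1 0 0) * toMat b (lin s 0 0 a) = toMat b (lin a s 0 0) := by
  have := finite_of_basis b
  let := Fintype.ofFinite K
  rw [eq_toMat_iff]
  intro x
  rw [← Matrix.vecMul_vecMul, vecMul_toMat, vecMul_toMat]
  have h16 : x ^ 16 = x := by
    rw [← card_of_basis b, Nat.card_eq_fintype_card, FiniteField.pow_card]
  congr 1
  simp only [lin_apply]
  have : (0 * x + 1 * x ^ 2 + 0 * x ^ 4 + 0 * x ^ 8) = x ^ 2 := by ring
  rw [this]
  linear_combination a * h16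

/-- Every code with the parameters of the Gabidulin code is equivalent to it. -/
theorem IsCode.exists_equiv_gabidulinCode {M : Finset Mat} (hM : IsCode M) :
    ∃ P A Q : Mat, P.det ≠ 0 ∧ Q.det ≠ 0 ∧
      (fun X => P * (X - A) * Q) '' M = SubspaceCode.gabidulinCode b 3 := by
  obtain ⟨P, A, Q, hP, hQ, R, hR, hmul⟩ := hM.exists_normalized b
  rcases mem_iff_exists_lin (hM.affine hP hQ) hR hmul with h | h
  · refine ⟨P, A, Q, hP, hQ, ?_⟩
    ext X
    rw [mem_gabidulinCode_iff, ← h, ← Finset.mem_coe, Finset.coe_image]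
  · refine ⟨toMat b (lin 0 1 0 0) * P, A, Q, ?_, hQ, ?_⟩
    · rw [Matrix.det_mul]
      exact mul_ne_zero (det_toMat_frobenius_ne_zero b) hP
    ext X
    rw [mem_gabidulinCode_iff]
    constructor
    · rintro ⟨Y, hY, rfl⟩
      obtain ⟨s, a, hsa⟩ := (h _).1 (Finset.mem_image_of_mem _ (Finset.mem_coe.1 hY))
      refine ⟨a, s, ?_⟩
      rw [← toMat_frobenius_mul b s a, ← hsa]
      simp only [Matrix.mul_assoc]
    · rintro ⟨s, a, rfl⟩
      obtain ⟨Y, hY, hYe⟩ := Finset.mem_image.1 ((h _).2 ⟨a, s, rfl⟩)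
      refine ⟨Y, hY, ?_⟩
      rw [← toMat_frobenius_mul b a s, ← hYe]
      simp only [Matrix.mul_assoc]

end Gabidulin

end SpreadSearch

/-! ### Rank, kernels and the MRD property of the Gabidulin code. -/

namespace SpreadSearch

open SubspaceCode

section BinarySpaces

/-- Over the field with two elements a line has just one nonzero vector; all dimension bounds below
are used in this form. -/
theorem finrank_le_one_iff_forall {V : Type*} [AddCommGroup V] [Module (ZMod 2) V]
    [Module.Finite (ZMod 2) V] :
    Module.finrank (ZMod 2) V ≤ 1 ↔ ∀ x y : V, x ≠ 0 → y ≠ 0 → x = y := by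
  rw [finrank_le_one_iff]
  have hZ : ∀ c : ZMod 2, c = 0 ∨ c = 1 := by decide
  constructor
  · rintro ⟨v, hv⟩
    have h1 : ∀ x : V, x ≠ 0 → x = v := by
      intro x hx
      obtain ⟨c, rfl⟩ := hv x
      rcases hZ c with rfl | rfl
      · simp at hx
      · simp
    intro x y hx hy
    rw [h1 x hx, h1 y hy]
  · intro h
    by_cases hex : ∃ v : V, v ≠ 0
    · obtain ⟨v, hv⟩ := hex
      refine ⟨v, fun w => ?_⟩
      by_cases hw : w = 0
      · exact ⟨0, by rw [hw, zero_smul]⟩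
      · exact ⟨1, by rw [one_smul, h w v hw hv]⟩
    · push Not at hex
      exact ⟨0, fun w => ⟨0, by rw [hex w, smul_zero]⟩⟩

theorem Submodule.finrank_le_one_iff_forall {V : Type*} [AddCommGroup V] [Module (ZMod 2) V]
    [Module.Finite (ZMod 2) V] (W : Submodule (ZMod 2) V) :
    Module.finrank (ZMod 2) W ≤ 1 ↔ ∀ x ∈ W, ∀ y ∈ W, x ≠ 0 → y ≠ 0 → x = y := by
  rw [SpreadSearch.finrank_le_one_iff_forall]
  exact ⟨fun h x hx y hy hx0 hy0 => congrArg Subtype.val (h ⟨x, hx⟩ ⟨y, hy⟩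
      (fun h => hx0 (congrArg Subtype.val h)) fun h => hy0 (congrArg Subtype.val h)),
    fun h x y hx hy => Subtype.ext (h x x.2 y y.2 (fun h => hx (Subtype.ext h))
      fun h => hy (Subtype.ext h))⟩

end BinarySpaces

section Rank

theorem rank_add_finrank_ker (A : Mat) :
    A.rank + Module.finrank (ZMod 2) (LinearMap.ker A.vecMulLinear) = 4 := by
  have h := LinearMap.finrank_range_add_finrank_ker A.vecMulLinear
  rw [range_vecMulLinear, ← Matrix.rank_eq_finrank_span_row, Module.finrank_fin_fun] at h
  exact h

theorem three_le_rank_iff {A : Mat} :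
    3 ≤ A.rank ↔ ∀ x y : Vec, x ≠ 0 → y ≠ 0 → x ᵥ* A = 0 → y ᵥ* A = 0 → x = y := by
  have h := rank_add_finrank_ker A
  have h' : 3 ≤ A.rank ↔ Module.finrank (ZMod 2) (LinearMap.ker A.vecMulLinear) ≤ 1 := by omega
  rw [h', Submodule.finrank_le_one_iff_forall]
  simp only [LinearMap.mem_ker, Matrix.vecMulLinear_apply]
  exact ⟨fun h x y hx hy h1 h2 => h x h1 y h2 hx hy, fun h x h1 y h2 hx hy => h x y hx hy h1 h2⟩

theorem rank_lt_four {A : Mat} {x : Vec} (hx : x ≠ 0) (hxA : x ᵥ* A = 0) : A.rank < 4 := by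
  have h := rank_add_finrank_ker A
  have : Nontrivial (LinearMap.ker A.vecMulLinear) :=
    ⟨⟨x, hxA⟩, 0, fun h => hx (congrArg Subtype.val h)⟩
  have := Module.finrank_pos (R := ZMod 2) (M := LinearMap.ker A.vecMulLinear)
  omega

theorem isCode_of_isMRD {M : Set Mat} (hM : IsMRD M 3) :
    ∃ M' : Finset Mat, IsCode M' ∧ (M' : Set Mat) = M := by
  classical
  have hfin : M.Finite := Set.toFinite M
  refine ⟨hfin.toFinset, ⟨?_, ?_⟩, hfin.coe_toFinset⟩
  · rw [← Set.ncard_eq_toFinset_card M hfin, hM.ncard_eq, Nat.card_zmod]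
    norm_num
  · intro A hA B hB hne x y hx hy hxe hye
    rw [hfin.mem_toFinset] at hA hB
    have h3 : 3 ≤ (A - B).rank := hM.minDist.2 ⟨A, hA, B, hB, hne, rfl⟩
    refine three_le_rank_iff.1 h3 x y hx hy ?_ ?_
    · rw [Matrix.vecMul_sub, hxe, sub_self]
    · rw [Matrix.vecMul_sub, hye, sub_self]

end Rank

section Gabidulin

variable {K : Type*} [Field K] [Algebra (ZMod 2) K] (b : Module.Basis (Fin 4) (ZMod 2) K)

/-- After division by `x` the equation `s x + a x^2 = 0` is linear. -/
theorem root_unique {s a x y : K} (h : lin s a 0 0 ≠ 0) (hx : x ≠ 0) (hy : y ≠ 0)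
    (hx0 : lin s a 0 0 x = 0) (hy0 : lin s a 0 0 y = 0) : x = y := by
  rw [lin_apply] at hx0 hy0
  have h1 : s + a * x = 0 := mul_right_cancel₀ hx (by linear_combination hx0)
  have h2 : s + a * y = 0 := mul_right_cancel₀ hy (by linear_combination hy0)
  by_cases ha : a = 0
  · subst ha
    rw [zero_mul, add_zero] at h1
    exact absurd (by rw [h1]; ext; simp [lin_apply]) h
  · exact mul_left_cancel₀ ha (by linear_combination h1 - h2)

theorem gabidulinCode_sub_mem {X Y : Mat} (hX : X ∈ gabidulinCode b 3)
    (hY : Y ∈ gabidulinCode b 3) : X - Y ∈ gabidulinCode b 3 := by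
  rw [mem_gabidulinCode_iff] at *
  obtain ⟨s, a, rfl⟩ := hX
  obtain ⟨t, c, rfl⟩ := hY
  exact ⟨s - t, a - c, by rw [toMat_sub, lin_sub, sub_zero]⟩

theorem gabidulinCode_kernel {X : Mat} (hX : X ∈ gabidulinCode b 3) (h0 : X ≠ 0) {x y : Vec}
    (hx : x ≠ 0) (hy : y ≠ 0) (hxX : x ᵥ* X = 0) (hyX : y ᵥ* X = 0) : x = y := by
  obtain ⟨s, a, rfl⟩ := (mem_gabidulinCode_iff b).1 hX
  obtain ⟨x, rfl⟩ := b.equivFun.surjective x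
  obtain ⟨y, rfl⟩ := b.equivFun.surjective y
  rw [vecMul_toMat, b.equivFun.map_eq_zero_iff] at hxX hyX
  rw [root_unique (fun h => h0 ?_) (fun h => hx ?_) (fun h => hy ?_) hxX hyX]
  · rw [h]; simp [toMat]
  · rw [h, map_zero]
  · rw [h, map_zero]

theorem ncard_gabidulinCode : (gabidulinCode b 3).ncard = 256 := by
  have h : gabidulinCode b 3 = Set.range fun p : K × K => toMat b (lin p.1 p.2 0 0) := by
    ext X
    rw [mem_gabidulinCode_iff]
    simp [eq_comm]
  rw [h, ← Set.image_univ, Set.ncard_image_of_injective _ fun p q h =>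
    Prod.ext (lin_inj b h).1 (lin_inj b h).2.1, Set.ncard_univ, Nat.card_prod, card_of_basis b]

theorem zero_mem_gabidulinCode : (0 : Mat) ∈ gabidulinCode b 3 :=
  (mem_gabidulinCode_iff b).2 ⟨0, 0, (eq_toMat_iff.2 fun x => by simp [lin_apply])⟩

/-- A nonzero singular member of the code. -/
theorem exists_singular_mem_gabidulinCode : ∃ X ∈ gabidulinCode b 3, X ≠ 0 ∧
    ∃ x : Vec, x ≠ 0 ∧ x ᵥ* X = 0 := by
  have := charP_two K
  refine ⟨toMat b (lin 1 1 0 0), (mem_gabidulinCode_iff b).2 ⟨1, 1, rfl⟩, fun h => ?_,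
    b.equivFun 1, fun h => one_ne_zero (b.equivFun.map_eq_zero_iff.1 h), ?_⟩
  · have h0 : (0 : Mat) = toMat b (lin 0 0 0 0) := eq_toMat_iff.2 fun x => by simp [lin_apply]
    rw [h0] at h
    exact one_ne_zero (lin_inj b h).1
  · rw [vecMul_toMat, b.equivFun.map_eq_zero_iff, lin_apply]
    simp [CharTwo.add_self_eq_zero]

theorem isMRD_gabidulinCode : IsMRD (gabidulinCode b 3) 3 := by
  have hge : ∀ X ∈ gabidulinCode b 3, X ≠ 0 → 3 ≤ X.rank := fun X hX h0 =>
    three_le_rank_iff.2 fun x y hx hy => gabidulinCode_kernel b hX h0 hx hy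
  refine ⟨⟨?_, ?_⟩, by rw [ncard_gabidulinCode, Nat.card_zmod]; norm_num⟩
  · obtain ⟨X, hX, h0, x, hx, hxX⟩ := exists_singular_mem_gabidulinCode b
    refine ⟨X, hX, 0, zero_mem_gabidulinCode b, h0, ?_⟩
    have h1 := hge X hX h0
    have h2 := rank_lt_four hx hxX
    rw [sub_zero]; omega
  · rintro _ ⟨A, hA, B, hB, hne, rfl⟩
    exact hge _ (gabidulinCode_sub_mem b hA hB) (sub_ne_zero.2 hne)

theorem exists_isCode_gabidulinCode :
    ∃ M : Finset Mat, IsCode M ∧ (M : Set Mat) = gabidulinCode b 3 :=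
  isCode_of_isMRD (isMRD_gabidulinCode b)

end Gabidulin

end SpreadSearch

/-! ### Lifted matrices and block maps of the ambient space. -/

namespace SpreadSearch

open SubspaceCode

abbrev Space := Submodule (ZMod 2) (Fin 8 → ZMod 2)

section Halves

def lft : (Fin 8 → ZMod 2) →ₗ[ZMod 2] Vec where
  toFun v i := v (Fin.castAdd 4 i)
  map_add' _ _ := rfl
  map_smul' _ _ := rfl

def rgt : (Fin 8 → ZMod 2) →ₗ[ZMod 2] Vec where
  toFun v i := v (Fin.natAdd 4 i)
  map_add' _ _ := rfl
  map_smul' _ _ := rfl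

def join (x y : Vec) : Fin 8 → ZMod 2 := (Fin.append x y : Fin (4 + 4) → ZMod 2)

@[simp] theorem lft_join (x y : Vec) : lft (join x y) = x :=
  funext fun i => Fin.append_left x y i

@[simp] theorem rgt_join (x y : Vec) : rgt (join x y) = y :=
  funext fun i => Fin.append_right x y i

theorem ext_halves {u v : Fin 8 → ZMod 2} (h1 : lft u = lft v) (h2 : rgt u = rgt v) : u = v :=
  funext fun i => Fin.addCases (motive := fun i : Fin (4 + 4) => u i = v i)
    (fun i => congrFun h1 i) (fun i => congrFun h2 i) i

theorem join_halves (v : Fin 8 → ZMod 2) : join (lft v) (rgt v) = v :=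
  ext_halves (lft_join _ _) (rgt_join _ _)

theorem vecMul_hcat {k m n : ℕ} (A : Matrix (Fin k) (Fin m) (ZMod 2))
    (B : Matrix (Fin k) (Fin n) (ZMod 2)) (w : Fin k → ZMod 2) :
    w ᵥ* hcat A B = Fin.append (w ᵥ* A) (w ᵥ* B) := by
  funext i
  refine Fin.addCases (fun i => ?_) (fun i => ?_) i
  · simp [Matrix.vecMul, dotProduct, hcat]
  · simp [Matrix.vecMul, dotProduct, hcat]

theorem mem_rowSpace {k n : ℕ} (A : Matrix (Fin k) (Fin n) (ZMod 2)) (v : Fin n → ZMod 2) :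
    v ∈ rowSpace A ↔ ∃ w, w ᵥ* A = v := by
  rw [rowSpace, show (Set.range fun i => A i) = Set.range A.row from rfl, ← range_vecMulLinear]
  rfl

theorem mem_lift {A : Mat} {v : Fin 8 → ZMod 2} :
    v ∈ (lift A : Space) ↔ rgt v = lft v ᵥ* A := by
  refine (mem_rowSpace (n := 4 + 4) _ v).trans ?_
  simp only [vecMul_hcat, Matrix.vecMul_one]
  constructor
  · rintro ⟨w, rfl⟩
    exact (rgt_join _ _).trans (congrArg (· ᵥ* A) (lft_join w (w ᵥ* A)).symm)
  · intro h
    exact ⟨lft v, (congrArg (join (lft v)) h.symm).trans (join_halves v)⟩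

/-- The subspace `(0 | I)`. -/
def infinity : Space := rowSpace (hcat (0 : Mat) (1 : Mat))

theorem mem_infinity {v : Fin 8 → ZMod 2} : v ∈ infinity ↔ lft v = 0 := by
  refine (mem_rowSpace (n := 4 + 4) _ v).trans ?_
  simp only [vecMul_hcat, Matrix.vecMul_one, Matrix.vecMul_zero]
  constructor
  · rintro ⟨w, rfl⟩
    exact lft_join 0 w
  · intro h
    exact ⟨rgt v, (congrArg (join · (rgt v)) h.symm).trans (join_halves v)⟩

/-- The subspace `(0 | I | 0)` with three leading zero columns. -/
def oblique : Space := rowSpace (hcat (hcat (0 : Matrix (Fin 4) (Fin 3) (ZMod 2)) (1 : Mat))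
  (0 : Matrix (Fin 4) (Fin 1) (ZMod 2)))

theorem mem_oblique {v : Fin 8 → ZMod 2} : v ∈ oblique ↔
    (lft v = 0 ∨ lft v = Pi.single 3 1) ∧ rgt v 3 = 0 := by
  have key : ∀ w : Vec, w ᵥ* hcat (hcat (0 : Matrix (Fin 4) (Fin 3) (ZMod 2)) (1 : Mat))
      (0 : Matrix (Fin 4) (Fin 1) (ZMod 2)) = join ![0, 0, 0, w 0] ![w 1, w 2, w 3, 0] := by
    decide +kernel
  have hZ : ∀ x : Vec, (∃ c, x = ![0, 0, 0, c]) ↔ (x = 0 ∨ x = Pi.single 3 1) := by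
    decide +kernel
  refine (mem_rowSpace (n := 3 + 4 + 1) _ v).trans ?_
  rw [← hZ]
  constructor
  · rintro ⟨w, rfl⟩
    refine ⟨⟨w 0, ?_⟩, ?_⟩
    · exact (congrArg lft (key w)).trans (lft_join _ _)
    · exact congrFun ((congrArg rgt (key w)).trans (rgt_join _ _)) 3
  · rintro ⟨⟨c, hc⟩, h3⟩
    refine ⟨![c, rgt v 0, rgt v 1, rgt v 2], (key _).trans (ext_halves ?_ ?_)⟩
    · rw [lft_join, hc]; rfl
    · rw [rgt_join]
      funext i
      fin_cases i
      · rfl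
      · rfl
      · rfl
      · exact h3.symm

end Halves

section Block

/-- The linear map `(x, y) ↦ (x P⁻¹, (y - x A) Q)`. -/
noncomputable def blockMap (P A Q : Mat) :
    (Fin 8 → ZMod 2) →ₗ[ZMod 2] (Fin 8 → ZMod 2) where
  toFun v := join (lft v ᵥ* P⁻¹) ((rgt v - lft v ᵥ* A) ᵥ* Q)
  map_add' u v := ext_halves (by simp [Matrix.add_vecMul]) (by
    simp only [map_add, rgt_join, Matrix.add_vecMul, Matrix.sub_vecMul]; abel)
  map_smul' c v := ext_halves (by simp [Matrix.smul_vecMul]) (by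
    simp [Matrix.smul_vecMul, Matrix.sub_vecMul, smul_sub])

theorem lft_blockMap (P A Q : Mat) (v : Fin 8 → ZMod 2) :
    lft (blockMap P A Q v) = lft v ᵥ* P⁻¹ := lft_join _ _

theorem rgt_blockMap (P A Q : Mat) (v : Fin 8 → ZMod 2) :
    rgt (blockMap P A Q v) = (rgt v - lft v ᵥ* A) ᵥ* Q := rgt_join _ _

variable {P A Q : Mat} (hP : P.det ≠ 0) (hQ : Q.det ≠ 0)

include hP hQ in
theorem blockMap_injective : Function.Injective (blockMap P A Q) := by
  refine (injective_iff_map_eq_zero _).2 fun v hv => ?_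
  have h1 := congrArg lft hv
  have h2 := congrArg rgt hv
  rw [lft_blockMap, map_zero] at h1
  rw [rgt_blockMap, map_zero] at h2
  have h3 : lft v = 0 := by
    by_contra h
    exact vecMul_ne_zero (det_inv_ne hP) h h1
  rw [h3, Matrix.zero_vecMul, sub_zero] at h2
  refine ext_halves (by rw [h3, map_zero]) ?_
  by_contra h
  exact vecMul_ne_zero hQ (by rwa [map_zero] at h) h2

noncomputable def blockEquiv : (Fin 8 → ZMod 2) ≃ₗ[ZMod 2] (Fin 8 → ZMod 2) :=
  LinearEquiv.ofInjectiveEndo (blockMap P A Q) (blockMap_injective hP hQ)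

theorem blockEquiv_apply (v : Fin 8 → ZMod 2) :
    blockEquiv hP hQ (A := A) v = blockMap P A Q v := rfl

include hP hQ in
theorem blockMap_mem_lift {X : Mat} {v : Fin 8 → ZMod 2} :
    blockMap P A Q v ∈ (lift (P * (X - A) * Q) : Space) ↔ v ∈ (lift X : Space) := by
  rw [mem_lift, mem_lift, rgt_blockMap, lft_blockMap, Matrix.vecMul_vecMul, ← Matrix.mul_assoc,
    ← Matrix.mul_assoc, inv_mul_self hP, Matrix.one_mul, ← Matrix.vecMul_vecMul,
    Matrix.vecMul_sub, ← sub_eq_zero, ← Matrix.sub_vecMul, sub_sub_sub_cancel_right]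
  constructor
  · intro h
    by_contra hne
    exact vecMul_ne_zero hQ (sub_ne_zero.2 hne) h
  · intro h
    rw [h, sub_self, Matrix.zero_vecMul]

/-- Code equivalences `X ↦ P (X - A) Q` thus come from collineations, which lets the uniqueness of
the matrix code act on subspace codes. -/
theorem map_lift (X : Mat) : (lift X : Space).map (blockEquiv hP hQ (A := A)).toLinearMap =
    (lift (P * (X - A) * Q) : Space) := by
  ext w
  obtain ⟨v, rfl⟩ := (blockEquiv hP hQ (A := A)).surjective w
  rw [blockEquiv_apply, blockMap_mem_lift hP hQ]
  constructor
  · rintro ⟨u, hu, he⟩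
    rwa [← (blockEquiv hP hQ (A := A)).injective he]
  · exact fun h => ⟨v, h, rfl⟩

end Block

section Dimension

theorem finrank_rowSpace {n : ℕ} {A : Matrix (Fin 4) (Fin n) (ZMod 2)}
    (h : Function.Injective fun w => w ᵥ* A) : Module.finrank (ZMod 2) (rowSpace A) = 4 := by
  rw [rowSpace, show (Set.range fun i => A i) = Set.range A.row from rfl, ← range_vecMulLinear,
    LinearMap.finrank_range_of_inj h, Module.finrank_fin_fun]

theorem finrank_lift (X : Mat) : Module.finrank (ZMod 2) (lift X : Space) = 4 := by
  refine finrank_rowSpace (n := 4 + 4) fun v w h => ?_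
  simp only [vecMul_hcat, Matrix.vecMul_one] at h
  have h' := congrArg lft (show join v _ = join w _ from h)
  rwa [lft_join, lft_join] at h'

theorem finrank_infinity : Module.finrank (ZMod 2) infinity = 4 := by
  refine finrank_rowSpace (n := 4 + 4) fun v w h => ?_
  simp only [vecMul_hcat, Matrix.vecMul_one] at h
  have h' := congrArg rgt (show join _ v = join _ w from h)
  rwa [rgt_join, rgt_join] at h'

theorem finrank_oblique : Module.finrank (ZMod 2) oblique = 4 :=
  finrank_rowSpace (n := 3 + 4 + 1) (by
    intro v w h
    simp only [vecMul_hcat, Matrix.vecMul_one] at h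
    funext i
    have := congrFun h (Fin.castAdd 1 (Fin.natAdd 3 i))
    simpa only [Fin.append_left, Fin.append_right] using this)

theorem lift_injective : Function.Injective fun X : Mat => (lift X : Space) := by
  intro X Y h
  refine Matrix.ext_of_single_vecMul fun i => ?_
  have h1 : join (Pi.single i 1) (Pi.single i 1 ᵥ* X) ∈ (lift X : Space) :=
    mem_lift.2 (by rw [lft_join, rgt_join])
  have h' : (lift X : Space) = lift Y := h
  rw [h', mem_lift, lft_join, rgt_join] at h1
  exact h1

end Dimension

end SpreadSearch

/-! ### The polarity, isomorphism, and its invariants. -/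

namespace SpreadSearch

open SubspaceCode

section Perp

def dotForm : LinearMap.BilinForm (ZMod 2) (Fin 8 → ZMod 2) := Matrix.toBilin' 1

theorem dotForm_apply (x y : Fin 8 → ZMod 2) : dotForm x y = x ⬝ᵥ y := by
  rw [dotForm, Matrix.toBilin'_apply', Matrix.one_mulVec]

theorem dotForm_nondegenerate : dotForm.Nondegenerate :=
  Matrix.nondegenerate_toBilin'_iff.2 (Matrix.nondegenerate_of_det_ne_zero (by simp))

theorem dotForm_isRefl : dotForm.IsRefl := fun x y h => by
  rw [dotForm_apply] at *; rwa [dotProduct_comm]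

theorem perp_eq_orthogonal (U : Space) : perp U = dotForm.orthogonal U := by
  ext x
  simp only [LinearMap.BilinForm.mem_orthogonal_iff, dotForm_apply]
  rfl

theorem perp_perp (U : Space) : perp (perp U) = U := by
  rw [perp_eq_orthogonal, perp_eq_orthogonal,
    LinearMap.BilinForm.orthogonal_orthogonal dotForm_nondegenerate dotForm_isRefl]

theorem perp_injective : Function.Injective (perp : Space → Space) :=
  Function.LeftInverse.injective perp_perp

theorem finrank_perp (U : Space) :
    Module.finrank (ZMod 2) (perp U) = 8 - Module.finrank (ZMod 2) U := by
  rw [perp_eq_orthogonal, LinearMap.BilinForm.finrank_orthogonal dotForm_nondegenerate,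
    Module.finrank_fin_fun]

theorem perp_inf_perp (U W : Space) : perp U ⊓ perp W = perp (U ⊔ W) := by
  ext x
  constructor
  · rintro ⟨h1, h2⟩ u hu
    obtain ⟨y, hy, z, hz, rfl⟩ := Submodule.mem_sup.1 hu
    rw [add_dotProduct, h1 y hy, h2 z hz, add_zero]
  · exact fun h => ⟨fun u hu => h u (Submodule.mem_sup_left hu),
      fun u hu => h u (Submodule.mem_sup_right hu)⟩

/-- The intersection of the polars is the polar of the sum, and `8 - (4 + 4 - dim (U ∩ W)) = dim (U
∩ W)`. -/
theorem finrank_perp_inf_perp {U W : Space} (hU : Module.finrank (ZMod 2) U = 4)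
    (hW : Module.finrank (ZMod 2) W = 4) :
    Module.finrank (ZMod 2) ↥(perp U ⊓ perp W) = Module.finrank (ZMod 2) ↥(U ⊓ W) := by
  rw [perp_inf_perp, finrank_perp]
  have := Submodule.finrank_sup_add_finrank_inf_eq U W
  have := (U ⊔ W).finrank_le
  rw [Module.finrank_fin_fun] at this
  omega

/-- The polarity carries linear maps to their contragredients. -/
theorem exists_map_perp (e : (Fin 8 → ZMod 2) ≃ₗ[ZMod 2] (Fin 8 → ZMod 2)) :
    ∃ e' : (Fin 8 → ZMod 2) ≃ₗ[ZMod 2] (Fin 8 → ZMod 2), ∀ U : Space,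
      (perp U).map e.toLinearMap = perp (U.map e'.toLinearMap) := by
  let T := LinearMap.toMatrix' e.symm.toLinearMap
  have hT : ∀ u x, (u ᵥ* T) ⬝ᵥ x = u ⬝ᵥ e.symm x := by
    intro u x
    rw [← Matrix.dotProduct_mulVec]
    congr 1
    exact LinearMap.toMatrix'_mulVec _ _
  have hinj : Function.Injective T.vecMulLinear := by
    refine (injective_iff_map_eq_zero _).2 fun u hu => ?_
    rw [Matrix.vecMulLinear_apply] at hu
    refine dotProduct_eq_zero u fun x => ?_
    rw [← e.symm_apply_apply x, ← hT, hu, zero_dotProduct]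
  refine ⟨LinearEquiv.ofInjectiveEndo T.vecMulLinear hinj, fun U => ?_⟩
  ext x
  constructor
  · rintro ⟨y, hy, rfl⟩ _ ⟨u, hu, rfl⟩
    refine (hT u _).trans ?_
    rw [LinearEquiv.coe_coe, e.symm_apply_apply]
    exact hy u hu
  · intro h
    refine ⟨e.symm x, fun u hu => ?_, e.apply_symm_apply x⟩
    rw [← hT]
    exact h _ ⟨u, hu, rfl⟩

end Perp

section Isomorphism

theorem map_map_equiv (e f : (Fin 8 → ZMod 2) ≃ₗ[ZMod 2] (Fin 8 → ZMod 2)) (U : Space) :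
    (U.map e.toLinearMap).map f.toLinearMap = U.map (e.trans f).toLinearMap := by
  rw [← Submodule.map_comp]; rfl

theorem isomorphic_map {C D : Set Space} (h : Isomorphic C D)
    (e : (Fin 8 → ZMod 2) ≃ₗ[ZMod 2] (Fin 8 → ZMod 2)) :
    Isomorphic C ((fun U => U.map e.toLinearMap) '' D) := by
  obtain ⟨f, rfl | rfl⟩ := h
  · refine ⟨f.trans e, Or.inl ?_⟩
    rw [Set.image_image]
    simp only [map_map_equiv]
  · obtain ⟨e', he'⟩ := exists_map_perp e
    refine ⟨f.trans e', Or.inr ?_⟩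
    rw [Set.image_image]
    simp only [he', map_map_equiv]

theorem isomorphic_refl (C : Set Space) : Isomorphic C C :=
  ⟨LinearEquiv.refl _ _, Or.inl (by simp)⟩

end Isomorphism

/-- A set of four-dimensional subspaces, any two of which meet in dimension at most one. -/
structure IsFan (C : Set Space) : Prop where
  finrank_eq : ∀ U ∈ C, Module.finrank (ZMod 2) U = 4
  finrank_inf_le : ∀ U ∈ C, ∀ W ∈ C, U ≠ W → Module.finrank (ZMod 2) ↥(U ⊓ W) ≤ 1

section Fan

theorem subspaceDist_eq {U W : Space} (hU : Module.finrank (ZMod 2) U = 4)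
    (hW : Module.finrank (ZMod 2) W = 4) :
    subspaceDist U W = 8 - 2 * Module.finrank (ZMod 2) ↥(U ⊓ W) := by
  have := Submodule.finrank_sup_add_finrank_inf_eq U W
  rw [subspaceDist]
  omega

theorem isFan_of_isCDC {C : Set Space} (h : IsCDC C 8 257 6 4) : IsFan C := by
  refine ⟨h.finrank_eq, fun U hU W hW hne => ?_⟩
  have := h.minDist.2 ⟨U, hU, W, hW, hne, rfl⟩
  rw [subspaceDist_eq (h.finrank_eq U hU) (h.finrank_eq W hW)] at this
  omega

theorem IsFan.isCDC {C : Set Space} (h : IsFan C) (hcard : C.ncard = 257)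
    (hex : ∃ U ∈ C, ∃ W ∈ C, U ≠ W ∧ U ⊓ W ≠ ⊥) : IsCDC C 8 257 6 4 := by
  refine ⟨Module.finrank_fin_fun _, Set.finite_of_ncard_ne_zero (by rw [hcard]; norm_num), hcard,
    h.finrank_eq, ?_, ?_⟩
  · obtain ⟨U, hU, W, hW, hne, hinf⟩ := hex
    refine ⟨U, hU, W, hW, hne, ?_⟩
    rw [subspaceDist_eq (h.finrank_eq U hU) (h.finrank_eq W hW)]
    have h1 := h.finrank_inf_le U hU W hW hne
    have h2 : Module.finrank (ZMod 2) ↥(U ⊓ W) ≠ 0 := fun h0 => hinf (Submodule.finrank_eq_zero.1 h0)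
    omega
  · rintro _ ⟨U, hU, W, hW, hne, rfl⟩
    rw [subspaceDist_eq (h.finrank_eq U hU) (h.finrank_eq W hW)]
    have h1 := h.finrank_inf_le U hU W hW hne
    omega

variable {C : Set Space} (e : (Fin 8 → ZMod 2) ≃ₗ[ZMod 2] (Fin 8 → ZMod 2))

theorem map_equiv_injective :
    Function.Injective fun U : Space => U.map e.toLinearMap :=
  Submodule.map_injective_of_injective e.injective

theorem finrank_map_equiv (U : Space) :
    Module.finrank (ZMod 2) (U.map e.toLinearMap) = Module.finrank (ZMod 2) U :=
  LinearEquiv.finrank_map_eq e U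

theorem map_inf_equiv (U W : Space) :
    U.map e.toLinearMap ⊓ W.map e.toLinearMap = (U ⊓ W).map e.toLinearMap :=
  (Submodule.map_inf _ e.injective).symm

theorem IsFan.map (h : IsFan C) : IsFan ((fun U => U.map e.toLinearMap) '' C) := by
  refine ⟨?_, ?_⟩
  · rintro _ ⟨U, hU, rfl⟩
    rw [finrank_map_equiv, h.finrank_eq U hU]
  · rintro _ ⟨U, hU, rfl⟩ _ ⟨W, hW, rfl⟩ hne
    rw [map_inf_equiv, finrank_map_equiv]
    exact h.finrank_inf_le U hU W hW fun h => hne (by rw [h])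

theorem IsFan.perp (h : IsFan C) : IsFan (perp '' C) := by
  refine ⟨?_, ?_⟩
  · rintro _ ⟨U, hU, rfl⟩
    rw [finrank_perp, h.finrank_eq U hU]
  · rintro _ ⟨U, hU, rfl⟩ _ ⟨W, hW, rfl⟩ hne
    rw [finrank_perp_inf_perp (h.finrank_eq U hU) (h.finrank_eq W hW)]
    exact h.finrank_inf_le U hU W hW fun h => hne (by rw [h])

theorem IsFan.of_isomorphic {D : Set Space} (h : IsFan C) (hD : Isomorphic C D) : IsFan D := by
  obtain ⟨e, rfl | rfl⟩ := hD
  · exact h.map e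
  · have := (h.map e).perp
    rwa [Set.image_image] at this

theorem ncard_of_isomorphic {D : Set Space} (hD : Isomorphic C D) : D.ncard = C.ncard := by
  obtain ⟨e, rfl | rfl⟩ := hD
  · exact Set.ncard_image_of_injective _ (map_equiv_injective e)
  · exact Set.ncard_image_of_injective _ (perp_injective.comp (map_equiv_injective e))

/-- A code word that meets every other one trivially. -/
def HasIsolated (C : Set Space) : Prop := ∃ Z ∈ C, ∀ W ∈ C, W ≠ Z → Z ⊓ W = ⊥

theorem HasIsolated.of_isomorphic {D : Set Space} (hC : IsFan C) (h : HasIsolated C)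
    (hD : Isomorphic C D) : HasIsolated D := by
  obtain ⟨Z, hZ, hiso⟩ := h
  obtain ⟨e, rfl | rfl⟩ := hD
  · refine ⟨_, ⟨Z, hZ, rfl⟩, ?_⟩
    rintro _ ⟨W, hW, rfl⟩ hne
    rw [map_inf_equiv, hiso W hW (fun h => hne (by rw [h])), Submodule.map_bot]
  · refine ⟨_, ⟨Z, hZ, rfl⟩, ?_⟩
    rintro _ ⟨W, hW, rfl⟩ hne
    rw [← Submodule.finrank_eq_zero, finrank_perp_inf_perp
      (by rw [finrank_map_equiv, hC.finrank_eq Z hZ])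
      (by rw [finrank_map_equiv, hC.finrank_eq W hW]), map_inf_equiv, finrank_map_equiv,
      hiso W hW (fun h => hne (by rw [h])), finrank_bot]

end Fan

end SpreadSearch

/-! ### The additional codeword and the two extended codes. -/

namespace SpreadSearch

open SubspaceCode

section ExtraWord

variable {K : Type*} [Field K] [Algebra (ZMod 2) K] (b : Module.Basis (Fin 4) (ZMod 2) K)

theorem vecMul_toMat_lin (c x : K) :
    b.equivFun x ᵥ* toMat b (lin c 0 0 0) = b.equivFun (c * x) := by
  rw [vecMul_toMat]; simp [lin_apply]

theorem det_toMat_lin_ne_zero {c : K} (hc : c ≠ 0) : (toMat b (lin c 0 0 0)).det ≠ 0 := by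
  intro h
  obtain ⟨v, hv, hve⟩ := Matrix.exists_vecMul_eq_zero_iff.2 h
  obtain ⟨x, rfl⟩ := b.equivFun.surjective v
  rw [vecMul_toMat_lin, b.equivFun.map_eq_zero_iff] at hve
  exact hv (b.equivFun.map_eq_zero_iff.2 ((mul_eq_zero.1 hve).resolve_left hc))

/-- Composing `x ↦ (t - s) x + a x^2` with multiplications before and after keeps its shape. These
symmetries of the Gabidulin code suffice to normalise the additional codeword. -/
theorem mul_sub_mul_mem_gabidulinCode (c s d : K) {X : Mat} (hX : X ∈ gabidulinCode b 3) :
    toMat b (lin c 0 0 0) * (X - toMat b (lin s 0 0 0)) * toMat b (lin d 0 0 0) ∈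
      gabidulinCode b 3 := by
  rw [mem_gabidulinCode_iff] at *
  obtain ⟨t, a, rfl⟩ := hX
  refine ⟨d * (t - s) * c, d * a * c ^ 2, eq_toMat_iff.2 fun x => ?_⟩
  rw [toMat_sub, lin_sub, ← Matrix.vecMul_vecMul, ← Matrix.vecMul_vecMul, vecMul_toMat_lin,
    vecMul_toMat, vecMul_toMat_lin]
  congr 1
  simp only [lin_apply]
  ring

/-- Every hyperplane of the field is a multiple of a fixed coordinate hyperplane. -/
theorem exists_coord_mul_eq_zero {H : Submodule (ZMod 2) K} (hH : H ≠ ⊤) :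
    ∃ d : K, d ≠ 0 ∧ ∀ h ∈ H, b.equivFun (d * h) 3 = 0 := by
  have : Module.Finite (ZMod 2) K := Module.Finite.of_basis b
  obtain ⟨φ, hφ, hle⟩ := Submodule.exists_le_ker_of_lt_top H (lt_top_iff_ne_top.2 hH)
  -- The pairing `(d, z) ↦` last coordinate of `d z` is nondegenerate, so every linear form arises
  -- from some `d`.
  let ψ : K →ₗ[ZMod 2] Module.Dual (ZMod 2) K := (LinearMap.mul (ZMod 2) K).compr₂ (b.coord 3)
  have hψ : ∀ d z, ψ d z = b.equivFun (d * z) 3 := fun _ _ => rfl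
  have hinj : Function.Injective ψ := by
    refine (injective_iff_map_eq_zero _).2 fun d hd => ?_
    by_contra h
    have := LinearMap.congr_fun hd (d⁻¹ * b 3)
    rw [hψ, mul_inv_cancel_left₀ h] at this
    simp at this
  obtain ⟨d, rfl⟩ := (LinearMap.injective_iff_surjective_of_finrank_eq_finrank
    Subspace.dual_finrank_eq.symm).1 hinj φ
  refine ⟨d, fun h => hφ (by rw [h, map_zero]), fun h hh => ?_⟩
  rw [← hψ]
  exact hle hh

variable {b}

/-- Two vectors of `U` with distinct nonzero left halves lie in a common lifted matrix, by
`exists_of_pair`, and would make the intersection too large. -/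
theorem IsCode.lft_eq_of_mem {M : Finset Mat} (hM : IsCode M) {U : Space}
    (h : ∀ X ∈ M, Module.finrank (ZMod 2) ↥(U ⊓ (lift X : Space)) ≤ 1) {u v : Fin 8 → ZMod 2}
    (hu : u ∈ U) (hv : v ∈ U) (hu0 : lft u ≠ 0) (hv0 : lft v ≠ 0) : lft u = lft v := by
  by_contra hne
  obtain ⟨X, hX, h1, h2⟩ := hM.exists_of_pair hu0 hv0 hne (rgt u) (rgt v)
  refine hne (congrArg lft ((Submodule.finrank_le_one_iff_forall _).1 (h X hX)
    u ⟨hu, mem_lift.2 h1.symm⟩ v ⟨hv, mem_lift.2 h2.symm⟩ ?_ ?_))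
  · rintro rfl; exact hu0 (map_zero _)
  · rintro rfl; exact hv0 (map_zero _)

/-- A subspace that extends the lifted Gabidulin code is either at infinity or can be moved to the
oblique subspace by an automorphism of the lifted code. -/
theorem eq_infinity_or_exists_map (b : Module.Basis (Fin 4) (ZMod 2) K) {U : Space}
    (hU : Module.finrank (ZMod 2) U = 4)
    (h : ∀ X ∈ gabidulinCode b 3, Module.finrank (ZMod 2) ↥(U ⊓ (lift X : Space)) ≤ 1) :
    U = infinity ∨ ∃ (P A Q : Mat) (hP : P.det ≠ 0) (hQ : Q.det ≠ 0),
      (∀ X ∈ gabidulinCode b 3, P * (X - A) * Q ∈ gabidulinCode b 3) ∧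
      U.map (blockEquiv hP hQ (A := A)).toLinearMap = oblique := by
  obtain ⟨M, hM, hMG⟩ := exists_isCode_gabidulinCode b
  have hlft : ∀ u ∈ U, ∀ v ∈ U, lft u ≠ 0 → lft v ≠ 0 → lft u = lft v := fun u hu v hv =>
    hM.lft_eq_of_mem (fun X hX => h X (by rw [← hMG]; exact hX)) hu hv
  by_cases hinf : ∀ u ∈ U, lft u = 0
  · left
    exact Submodule.eq_of_le_of_finrank_eq (fun u hu => mem_infinity.2 (hinf u hu))
      (by rw [hU, finrank_infinity])
  right
  push Not at hinf
  obtain ⟨u, hu, hu0⟩ := hinf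
  obtain ⟨x, hx⟩ := b.equivFun.surjective (lft u)
  obtain ⟨y, hy⟩ := b.equivFun.surjective (rgt u)
  have hx0 : x ≠ 0 := by
    rintro rfl
    exact hu0 (by rw [← hx, map_zero])
  let J : K →ₗ[ZMod 2] (Fin 8 → ZMod 2) :=
    { toFun := fun z => join 0 (b.equivFun z)
      map_add' := fun _ _ => ext_halves (by simp) (by simp)
      map_smul' := fun _ _ => ext_halves (by simp) (by simp) }
  have hJ : ∀ z, J z = join 0 (b.equivFun z) := fun _ => rfl
  -- If `U` contained all vectors with zero left half it would equal that subspace, by dimension,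
  -- and could not contain `u`.
  have hH : U.comap J ≠ ⊤ := by
    intro htop
    have hle : infinity ≤ U := by
      intro v hv
      obtain ⟨z, hz⟩ := b.equivFun.surjective (rgt v)
      have hzU : z ∈ U.comap J := htop ▸ Submodule.mem_top
      rw [Submodule.mem_comap, hJ, hz, ← mem_infinity.1 hv, join_halves] at hzU
      exact hzU
    have := Submodule.eq_of_le_of_finrank_eq hle (by rw [hU, finrank_infinity])
    rw [← this] at hu
    exact hu0 (mem_infinity.1 hu)
  obtain ⟨d, hd, hdH⟩ := exists_coord_mul_eq_zero b hH
  have hb3 : b 3 ≠ 0 := b.ne_zero 3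
  have hc : x / b 3 ≠ 0 := div_ne_zero hx0 hb3
  have hP := det_toMat_lin_ne_zero b hc
  have hQ := det_toMat_lin_ne_zero b hd
  -- Here `P` is multiplication by `x / b 3`, so its inverse takes `x` to the last basis vector; `A`
  -- takes `x` to `y` and so clears the right half of `u`; `Q` is multiplication by `d` and takes
  -- the right halves of the vectors with zero left half into the coordinate hyperplane.
  refine ⟨_, toMat b (lin (y / x) 0 0 0), _, hP, hQ,
    fun X hX => mul_sub_mul_mem_gabidulinCode b _ _ _ hX, ?_⟩
  refine Submodule.eq_of_le_of_finrank_eq ?_ (by rw [finrank_map_equiv, hU, finrank_oblique])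
  have hker : ∀ v ∈ U, lft v = 0 → (rgt v ᵥ* toMat b (lin d 0 0 0)) 3 = 0 := by
    intro v hv hv0
    obtain ⟨z, hz⟩ := b.equivFun.surjective (rgt v)
    rw [← hz, vecMul_toMat_lin]
    refine hdH z ?_
    rw [Submodule.mem_comap, hJ, hz, ← hv0, join_halves]
    exact hv
  rintro _ ⟨v, hv, rfl⟩
  rw [LinearEquiv.coe_coe, blockEquiv_apply, mem_oblique, lft_blockMap, rgt_blockMap]
  by_cases hv0 : lft v = 0
  · refine ⟨Or.inl (by rw [hv0, Matrix.zero_vecMul]), ?_⟩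
    rw [hv0, Matrix.zero_vecMul, sub_zero]
    exact hker v hv hv0
  · have hvu := hlft v hv u hu hv0 hu0
    constructor
    · right
      have he : b.equivFun (b 3) = Pi.single 3 1 := by
        funext j
        rw [b.equivFun_self, Pi.single_apply]
        exact if_congr eq_comm rfl rfl
      have h3 : b.equivFun x = (Pi.single 3 1 : Vec) ᵥ* toMat b (lin (x / b 3) 0 0 0) := by
        rw [← he, vecMul_toMat_lin, div_mul_cancel₀ _ hb3]
      rw [hvu, ← hx, h3, Matrix.vecMul_vecMul, mul_inv_self hP, Matrix.vecMul_one]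
    · have := hker (v - u) (U.sub_mem hv hu) (by rw [map_sub, hvu, sub_self])
      rwa [hvu, ← hx, vecMul_toMat_lin, div_mul_cancel₀ _ hx0, hy, ← map_sub]

end ExtraWord

section Extended

variable {K : Type*} [Field K] [Algebra (ZMod 2) K] (b : Module.Basis (Fin 4) (ZMod 2) K)

theorem extendedCode₁_eq : extendedCode₁ b =
    insert infinity ((fun X : Mat => (lift X : Space)) '' gabidulinCode b 3) :=
  Set.union_singleton

theorem extendedCode₂_eq : extendedCode₂ b =
    insert oblique ((fun X : Mat => (lift X : Space)) '' gabidulinCode b 3) :=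
  Set.union_singleton

theorem ncard_lift_gabidulinCode :
    ((fun X : Mat => (lift X : Space)) '' gabidulinCode b 3).ncard = 256 := by
  rw [Set.ncard_image_of_injective _ lift_injective, ncard_gabidulinCode]

theorem infinity_inf_lift (X : Mat) : infinity ⊓ (lift X : Space) = ⊥ := by
  rw [eq_bot_iff]
  rintro v ⟨h1, h2⟩
  have h1' := mem_infinity.1 h1
  have h2' := mem_lift.1 h2
  rw [h1', Matrix.zero_vecMul] at h2'
  exact (Submodule.mem_bot _).2 (ext_halves (by rw [h1', map_zero]) (by rw [h2', map_zero]))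

theorem finrank_oblique_inf_lift_le (X : Mat) :
    Module.finrank (ZMod 2) ↥(oblique ⊓ (lift X : Space)) ≤ 1 := by
  rw [Submodule.finrank_le_one_iff_forall]
  have key : ∀ v ∈ oblique ⊓ (lift X : Space), v ≠ 0 → lft v = Pi.single 3 1 := by
    rintro v ⟨h1, h2⟩ hv
    refine (mem_oblique.1 h1).1.resolve_left fun h0 => hv ?_
    have h2' := mem_lift.1 h2
    rw [h0, Matrix.zero_vecMul] at h2'
    exact ext_halves (by rw [h0, map_zero]) (by rw [h2', map_zero])
  intro v hv w hw hv0 hw0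
  have h1 := key v hv hv0
  have h2 := key w hw hw0
  refine ext_halves (h1.trans h2.symm) ?_
  rw [mem_lift.1 hv.2, mem_lift.1 hw.2, h1, h2]

theorem finrank_lift_inf_lift_le {X Y : Mat} (hX : X ∈ gabidulinCode b 3)
    (hY : Y ∈ gabidulinCode b 3) (hne : X ≠ Y) :
    Module.finrank (ZMod 2) ↥((lift X : Space) ⊓ (lift Y : Space)) ≤ 1 := by
  rw [Submodule.finrank_le_one_iff_forall]
  have key : ∀ v ∈ (lift X : Space) ⊓ (lift Y : Space), v ≠ 0 →
      lft v ≠ 0 ∧ lft v ᵥ* (X - Y) = 0 := by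
    rintro v ⟨h1, h2⟩ hv
    have h1' := mem_lift.1 h1
    have h2' := mem_lift.1 h2
    refine ⟨fun h0 => hv ?_, by rw [Matrix.vecMul_sub, ← h1', ← h2', sub_self]⟩
    rw [h0, Matrix.zero_vecMul] at h1'
    exact ext_halves (by rw [h0, map_zero]) (by rw [h1', map_zero])
  intro v hv w hw hv0 hw0
  have h1 := key v hv hv0
  have h2 := key w hw hw0
  have h := gabidulinCode_kernel b (gabidulinCode_sub_mem b hX hY) (sub_ne_zero.2 hne)
    h1.1 h2.1 h1.2 h2.2
  exact ext_halves h (by rw [mem_lift.1 hv.1, mem_lift.1 hw.1, h])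

/-- The member of the code that meets a given one in a line. -/
theorem exists_lift_inf_lift_ne_bot {X : Mat} (hX : X ∈ gabidulinCode b 3) :
    ∃ Y ∈ gabidulinCode b 3, Y ≠ X ∧ (lift X : Space) ⊓ (lift Y : Space) ≠ ⊥ := by
  obtain ⟨D, hD, hD0, x, hx, hxD⟩ := exists_singular_mem_gabidulinCode b
  refine ⟨X - D, gabidulinCode_sub_mem b hX hD, fun h => hD0 (by simpa using h), fun h => ?_⟩
  have hmem : join x (x ᵥ* X) ∈ (lift X : Space) ⊓ (lift (X - D) : Space) :=
    ⟨mem_lift.2 (by rw [lft_join, rgt_join]),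
      mem_lift.2 (by rw [lft_join, rgt_join, Matrix.vecMul_sub, hxD, sub_zero])⟩
  rw [h, Submodule.mem_bot] at hmem
  exact hx (by rw [← lft_join x (x ᵥ* X), hmem, map_zero])

theorem isFan_insert {Z : Space} (hZ : Module.finrank (ZMod 2) Z = 4)
    (h : ∀ X : Mat, Module.finrank (ZMod 2) ↥(Z ⊓ (lift X : Space)) ≤ 1) :
    IsFan (insert Z ((fun X : Mat => (lift X : Space)) '' gabidulinCode b 3)) := by
  refine ⟨?_, ?_⟩
  · rintro U (rfl | ⟨X, -, rfl⟩)
    · exact hZ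
    · exact finrank_lift X
  · rintro U (rfl | ⟨X, hX, rfl⟩) W (rfl | ⟨Y, hY, rfl⟩) hne
    · exact absurd rfl hne
    · exact h Y
    · rw [inf_comm]; exact h X
    · exact finrank_lift_inf_lift_le b hX hY fun h => hne (by rw [h])

theorem ncard_insert {Z : Space} (hZ : Module.finrank (ZMod 2) Z = 4)
    (h : ∀ X : Mat, Module.finrank (ZMod 2) ↥(Z ⊓ (lift X : Space)) ≤ 1) :
    (insert Z ((fun X : Mat => (lift X : Space)) '' gabidulinCode b 3)).ncard = 257 := by
  rw [Set.ncard_insert_of_notMem _ (Set.toFinite _), ncard_lift_gabidulinCode]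
  rintro ⟨X, -, rfl⟩
  have := h X
  rw [inf_idem, finrank_lift] at this
  omega

theorem isCDC_insert {Z : Space} (hZ : Module.finrank (ZMod 2) Z = 4)
    (h : ∀ X : Mat, Module.finrank (ZMod 2) ↥(Z ⊓ (lift X : Space)) ≤ 1) :
    IsCDC (insert Z ((fun X : Mat => (lift X : Space)) '' gabidulinCode b 3)) 8 257 6 4 := by
  refine (isFan_insert b hZ h).isCDC (ncard_insert b hZ h) ?_
  obtain ⟨Y, hY, hne, hinf⟩ := exists_lift_inf_lift_ne_bot b (zero_mem_gabidulinCode b)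
  exact ⟨_, Or.inr ⟨0, zero_mem_gabidulinCode b, rfl⟩, _, Or.inr ⟨Y, hY, rfl⟩,
    fun h => hne (lift_injective h).symm, hinf⟩

theorem containsLMRD_insert (Z : Space) :
    ContainsLMRD (insert Z ((fun X : Mat => (lift X : Space)) '' gabidulinCode b 3)) :=
  ⟨_, Set.subset_insert _ _, _, ⟨_, isMRD_gabidulinCode b, rfl⟩, isomorphic_refl _⟩

theorem finrank_infinity_inf_lift_le (X : Mat) :
    Module.finrank (ZMod 2) ↥(infinity ⊓ (lift X : Space)) ≤ 1 := by
  rw [infinity_inf_lift, finrank_bot]; exact zero_le_one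

theorem hasIsolated_extendedCode₁ : HasIsolated (extendedCode₁ b) := by
  rw [extendedCode₁_eq]
  refine ⟨infinity, Set.mem_insert _ _, ?_⟩
  rintro W (rfl | ⟨X, -, rfl⟩) hne
  · exact absurd rfl hne
  · exact infinity_inf_lift X

/-- The oblique subspace meets the lifted zero matrix in `(e_3 | 0)`, and each lifted codeword meets
another one because the code contains a nonzero singular matrix. -/
theorem not_hasIsolated_extendedCode₂ : ¬ HasIsolated (extendedCode₂ b) := by
  rw [extendedCode₂_eq]
  rintro ⟨Z, rfl | ⟨X, hX, rfl⟩, h⟩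
  · have hne : (lift (0 : Mat) : Space) ≠ oblique := by
      intro he
      have := finrank_oblique_inf_lift_le 0
      rw [he, inf_idem, finrank_oblique] at this
      omega
    have h0 := h _ (Or.inr ⟨0, zero_mem_gabidulinCode b, rfl⟩) hne
    have hmem : join (Pi.single 3 1) 0 ∈ oblique ⊓ (lift (0 : Mat) : Space) :=
      ⟨mem_oblique.2 ⟨Or.inr (lft_join _ _), by rw [rgt_join]; rfl⟩,
        mem_lift.2 (by rw [rgt_join, Matrix.vecMul_zero])⟩
    rw [h0, Submodule.mem_bot] at hmem
    exact single_ne_zero (by rw [← lft_join (Pi.single 3 1) 0, hmem, map_zero])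
  · obtain ⟨Y, hY, hne, hinf⟩ := exists_lift_inf_lift_ne_bot b hX
    exact hinf (h _ (Or.inr ⟨Y, hY, rfl⟩) fun h => hne (lift_injective h))

theorem not_isomorphic_extendedCodes : ¬ Isomorphic (extendedCode₁ b) (extendedCode₂ b) :=
  fun h => not_hasIsolated_extendedCode₂ b ((hasIsolated_extendedCode₁ b).of_isomorphic (by
    rw [extendedCode₁_eq]
    exact isFan_insert b finrank_infinity finrank_infinity_inf_lift_le) h)

theorem exists_isomorphic_supset {C : Set Space} (hC : ContainsLMRD C) :
    ∃ (M : Set Mat) (D : Set Space), IsMRD M 3 ∧ Isomorphic C D ∧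
      (fun X : Mat => (lift X : Space)) '' M ⊆ D := by
  obtain ⟨C', hC', L, ⟨M, hM, rfl⟩, e, he | he⟩ := hC
  · exact ⟨M, _, hM, ⟨e, Or.inl rfl⟩, he.trans_subset (Set.image_mono hC')⟩
  · exact ⟨M, _, hM, ⟨e, Or.inr rfl⟩, he.trans_subset (Set.image_mono hC')⟩

theorem isomorphic_extendedCode {C : Set Space} (hC : IsCDC C 8 257 6 4) (hL : ContainsLMRD C) :
    Isomorphic C (extendedCode₁ b) ∨ Isomorphic C (extendedCode₂ b) := by
  obtain ⟨M, D₀, hMRD, hiso₀, hsub₀⟩ := exists_isomorphic_supset hL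
  obtain ⟨M, hM, rfl⟩ := isCode_of_isMRD hMRD
  obtain ⟨P, A, Q, hP, hQ, hG⟩ := hM.exists_equiv_gabidulinCode b
  obtain ⟨D, hiso, hsub⟩ : ∃ D, Isomorphic C D ∧
      (fun X : Mat => (lift X : Space)) '' gabidulinCode b 3 ⊆ D := by
    refine ⟨_, isomorphic_map hiso₀ (blockEquiv hP hQ (A := A)), ?_⟩
    rw [← hG, Set.image_image]
    rintro _ ⟨X, hX, rfl⟩
    exact ⟨_, hsub₀ ⟨X, hX, rfl⟩, map_lift hP hQ X⟩
  have hfan := (isFan_of_isCDC hC).of_isomorphic hiso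
  have hcard := (ncard_of_isomorphic hiso).trans hC.ncard_eq
  -- Since `257 = 256 + 1`, exactly one codeword lies outside the lifted Gabidulin code.
  have hone : (D \ (fun X : Mat => (lift X : Space)) '' gabidulinCode b 3).ncard = 1 := by
    rw [Set.ncard_sdiff hsub (Set.toFinite _), hcard, ncard_lift_gabidulinCode]
  obtain ⟨U, hU⟩ := Set.ncard_eq_one.1 hone
  have hUm : U ∈ D \ (fun X : Mat => (lift X : Space)) '' gabidulinCode b 3 := by
    rw [hU]; exact rfl
  have hD : D = insert U ((fun X : Mat => (lift X : Space)) '' gabidulinCode b 3) := by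
    rw [Set.insert_eq, ← hU, Set.sdiff_union_of_subset hsub]
  rcases eq_infinity_or_exists_map b (hfan.finrank_eq U hUm.1) (fun X hX =>
    hfan.finrank_inf_le U hUm.1 _ (hsub ⟨X, hX, rfl⟩) fun h => hUm.2 ⟨X, hX, h.symm⟩) with
    rfl | ⟨P', A', Q', hP', hQ', hinv, hmap⟩
  · left
    rw [extendedCode₁_eq, ← hD]
    exact hiso
  · right
    -- An injective map of a finite set into itself is onto, so the normalisation of `U` preserves
    -- the lifted code as a whole.
    have himg : (fun X => P' * (X - A') * Q') '' gabidulinCode b 3 = gabidulinCode b 3 := by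
      refine Set.eq_of_subset_of_ncard_le ?_ ?_ (Set.toFinite _)
      · rintro _ ⟨X, hX, rfl⟩
        exact hinv X hX
      · rw [Set.ncard_image_of_injective _ (affine_injective hP' hQ')]
    convert isomorphic_map hiso (blockEquiv hP' hQ' (A := A')) using 1
    rw [hD, Set.image_insert_eq, hmap, Set.image_image, extendedCode₂_eq]
    congr 1
    simp only [map_lift hP' hQ']
    conv_lhs => rw [← himg, Set.image_image]

end Extended

end SpreadSearch

theorem mainTheorem3 {K : Type*} [Field K] [Algebra (ZMod 2) K]
    (b : Module.Basis (Fin 4) (ZMod 2) K) :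
    (∀ C : Set (Submodule (ZMod 2) (Fin 8 → ZMod 2)),
      SubspaceCode.IsCDC C 8 257 6 4 → SubspaceCode.ContainsLMRD C →
        SubspaceCode.Isomorphic C (SubspaceCode.extendedCode₁ b) ∨
        SubspaceCode.Isomorphic C (SubspaceCode.extendedCode₂ b)) ∧
    (SubspaceCode.IsCDC (SubspaceCode.extendedCode₁ b) 8 257 6 4 ∧
      SubspaceCode.IsCDC (SubspaceCode.extendedCode₂ b) 8 257 6 4 ∧
      SubspaceCode.IsMRD (SubspaceCode.gabidulinCode b 3) 3 ∧
      SubspaceCode.ContainsLMRD (SubspaceCode.extendedCode₁ b) ∧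
      SubspaceCode.ContainsLMRD (SubspaceCode.extendedCode₂ b)) ∧
    ¬ SubspaceCode.Isomorphic (SubspaceCode.extendedCode₁ b) (SubspaceCode.extendedCode₂ b) := by
  refine ⟨fun C hC hL => SpreadSearch.isomorphic_extendedCode b hC hL, ⟨?_, ?_,
    SpreadSearch.isMRD_gabidulinCode b, ?_, ?_⟩, SpreadSearch.not_isomorphic_extendedCodes b⟩
  · rw [SpreadSearch.extendedCode₁_eq]
    exact SpreadSearch.isCDC_insert b SpreadSearch.finrank_infinity
      SpreadSearch.finrank_infinity_inf_lift_le
  · rw [SpreadSearch.extendedCode₂_eq]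
    exact SpreadSearch.isCDC_insert b SpreadSearch.finrank_oblique
      SpreadSearch.finrank_oblique_inf_lift_le
  · rw [SpreadSearch.extendedCode₁_eq]
    exact SpreadSearch.containsLMRD_insert b _
  · rw [SpreadSearch.extendedCode₂_eq]
    exact SpreadSearch.containsLMRD_insert b _
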